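/- **Setting.** Let $d\ge 2$, let $E\in\{\mathbb Z,\mathbb R\}$ with counting resp. Lebesgue measure $\lambda$, let $\mathcal L\subset\mathbb Z^d$ be a full-rank sublattice, and let $\Omega$ be the set of functions $\phi:\mathbb Z^d\to E$. Write $\Lambda\subset\subset\mathbb Z^d$ for finite subsets, $d_1$ for the graph metric of the square lattice, and $(\theta_x\phi)(y)=\phi(y+x)$. Let $\mathcal F^\nabla_\Lambda=\sigma(\phi(y)-\phi(x):x,y\in\Lambda)$ and $\mathcal F^\nabla=\mathcal F^\nabla_{\mathbb Z^d}$, and let $\mathcal P_{\mathcal L}(\Omega,\mathcal F^\nabla)$ be the set of probability measures on $(\Omega,\mathcal F^\nabla)$ invariant under $\theta_x$ for all $x\in\mathcal L$. **Potentials.** A periodic gradient potential is a family of $\mathcal F^\nabla_\Lambda$-measurable functions $\Phi_\Lambda:\Omega\to\mathbb R\cup\{\infty\}$, $\Lambda\subset\subset\mathbb Z^d$, with $\Phi_{\Lambda+x}(\phi)=\Phi_\Lambda(\theta_x\phi)$ for $x\in\mathcal L$, and $\Phi_\Lambda\equiv0$ if $|\Lambda|\le1$. Put $H^0_\Lambda=\sum_{\emptyset\ne\Gamma\subset\Lambda}\Phi_\Gamma$.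 **Lipschitz constraints.** An admissible quasimetric is an $\mathcal L$-invariant function $q:\mathbb Z^d\times\mathbb Z^d\to\mathbb R$ with $q(x,x)=0$, $q(x,y)+q(y,x)>0$ for $x\ne y$, and $q(x,z)\le q(x,y)+q(y,z)$. A local Lipschitz constraint is a pair $(\mathbb A,q)$ with $\mathbb A$ an $\mathcal L$-invariant connected graph of bounded degree on $\mathbb Z^d$ and $q$ an admissible quasimetric such that every admissible quasimetric $p$ with $p(x,y)\le q(x,y)$ for all $\{x,y\}\in\mathbb A$ satisfies $p\le q$. If $E=\mathbb Z$, then $q$ is assumed to be integer-valued. Let $q_\varepsilon$ be the largest admissible quasimetric with $q_\varepsilon\le q-\varepsilon$ on $\mathbb A$, and let $$\Omega_q=\{\phi\in\Omega:\phi(y)-\phi(x)\le q(x,y)\text{ for all }x,y\}.$$ **The class $\mathcal S_{\mathcal L}+\mathcal W_{\mathcal L}$.** A strong interaction $\Psi\in\mathcal S_{\mathcal L}$ with constraint $(\mathbb A,q)$ is a periodic gradient potential with $\Psi_\Lambda\ge0$; with $\Psi_\Lambda\equiv0$ whenever the $d_1$-diameter of $\Lambda$ exceeds some fixed $R$; such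 that $\Psi_\Lambda(\phi)=\infty$ if and only if $\Lambda=\{x,y\}\in\mathbb A$ and $\phi(y)-\phi(x)>q(x,y)$ for some $x,y$; and, if $E=\mathbb R$, such that for all sufficiently small $\varepsilon>0$ there is $C_\varepsilon<\infty$ with $\sum_{\Gamma\ni x}\Psi_\Gamma(\phi)\le C_\varepsilon$ for every $x$ and every $\phi$ that satisfies the constraint $q_\varepsilon$ along the edges of $\mathbb A$ at $x$. A weak interaction $\Xi\in\mathcal W_{\mathcal L}$ is a periodic gradient potential with $\sup_{x,\phi}\sum_{\Lambda\ni x}|\Xi_\Lambda(\phi)|<\infty$ for which $$e^-(\Lambda)=\sup_{\phi}\ \sum_{\Delta\cap\Lambda\ne\emptyset,\ \Delta\not\subset\Lambda}|\Xi_\Delta(\phi)|$$ is amenable: finite, $\mathcal L$-invariant, subadditive on disjoint sets, and $e^-(\Lambda_n)=o(|\Lambda_n|)$ along every sequence of finite sets with $|\Lambda_n|\to\infty$ and $|\partial\Lambda_n|/|\Lambda_n|\to0$, where $\partial\Lambda$ is the set of vertices outside $\Lambda$ adjacent to $\Lambda$ in the square lattice. **Minimizers.** For $x\in\Lambda$ let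 $\lambda^{\Lambda-1}$ be the measure on $(\Omega,\mathcal F^\nabla_\Lambda)$ under which $(\phi(y)-\phi(x))_{y\in\Lambda\setminus\{x\}}$ has law $\lambda^{\Lambda\setminus\{x\}}$ (it does not depend on $x$). Let $\mathcal H_\Lambda(\mu|\Phi)$ be the relative entropy on $\mathcal F^\nabla_\Lambda$ of $\mu$ with respect to $e^{-H^0_\Lambda}\lambda^{\Lambda-1}$ (with $\infty-\infty=\infty$), and let $\mathcal H(\mu|\Phi)=\lim_{n\to\infty}n^{-d}\mathcal H_{[0,n)^d\cap\mathbb Z^d}(\mu|\Phi)$. If $\phi(y)-\phi(x)$ is $\mu$-integrable for all $x,y$, the slope $S(\mu)\in(\mathbb R^d)^*$ is the linear functional with $S(\mu)(x)=\mu(\phi(x)-\phi(0))$ for $x\in\mathcal L$. Let $\sigma(u)=\inf\{\mathcal H(\nu|\Phi):\nu\in\mathcal P_{\mathcal L}(\Omega,\mathcal F^\nabla),\ S(\nu)=u\}$. A minimizer is a measure $\mu\in\mathcal P_{\mathcal L}(\Omega,\mathcal F^\nabla)$ with a slope and with $\mathcal H(\mu|\Phi)=\sigma(S(\mu))<\infty$.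 **Theorem (finite energy).** Let $\Phi=\Psi+\Xi$ with $\Psi\in\mathcal S_{\mathcal L}$ a strong interaction with constraint $(\mathbb A,q)$ and $\Xi\in\mathcal W_{\mathcal L}$, and let $\mu$ be a minimizer. Then for every $\Lambda\subset\subset\mathbb Z^d$, $$1_{\Omega_q}\,(\mu\pi_{\mathbb Z^d\setminus\Lambda}\times\lambda^\Lambda)\ll\mu$$ as measures on $(\Omega,\mathcal F^\nabla)$, where $(\mu\pi_{\mathbb Z^d\setminus\Lambda}\times\lambda^\Lambda)(A)=\int\lambda^\Lambda(\{\psi\in E^\Lambda:\psi\,\phi_{\mathbb Z^d\setminus\Lambda}\in A\})\,d\mu(\phi)$ for $A\in\mathcal F^\nabla$, and $\psi\,\phi_{\mathbb Z^d\setminus\Lambda}$ is the function equal to $\psi$ on $\Lambda$ and to $\phi$ off $\Lambda$. -/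

import Mathlib

open MeasureTheory Filter Topology
open scoped ENNReal

noncomputable section

namespace HeightModel

/-! ### Height functions and the gradient sigma-algebras -/

/-- The two possible choices of the height space `E`: the integers or the reals. -/
inductive HeightSpace
  | int
  | real

/-- The underlying type of `E`. -/
def HeightSpace.carrier : HeightSpace → Type
  | .int => ℤ
  | .real => ℝ

instance : CoeSort HeightSpace Type := ⟨HeightSpace.carrier⟩

instance (E : HeightSpace) : AddCommGroup E :=
  match E with
  | .int => inferInstanceAs (AddCommGroup ℤ)
  | .real => inferInstanceAs (AddCommGroup ℝ)

/-- The Borel sigma-algebra on `E`. -/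
instance (E : HeightSpace) : MeasurableSpace E :=
  match E with
  | .int => inferInstanceAs (MeasurableSpace ℤ)
  | .real => inferInstanceAs (MeasurableSpace ℝ)

/-- The inclusion of `E` into the reals. -/
def HeightSpace.toReal (E : HeightSpace) : E → ℝ :=
  match E with
  | .int => fun n : ℤ => (n : ℝ)
  | .real => fun t : ℝ => t

/-- The reference measure on `E`: counting measure on `ℤ`, Lebesgue measure on `ℝ`. -/
def HeightSpace.refMeasure (E : HeightSpace) : Measure E :=
  match E with
  | .int => (Measure.count : Measure ℤ)
  | .real => (volume : Measure ℝ)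

instance (E : HeightSpace) : MeasurableAdd₂ E :=
  match E with
  | .int => inferInstanceAs (MeasurableAdd₂ ℤ)
  | .real => inferInstanceAs (MeasurableAdd₂ ℝ)

instance (E : HeightSpace) : MeasurableSub₂ E :=
  match E with
  | .int => inferInstanceAs (MeasurableSub₂ ℤ)
  | .real => inferInstanceAs (MeasurableSub₂ ℝ)

instance (E : HeightSpace) : SigmaFinite E.refMeasure :=
  match E with
  | .int => inferInstanceAs (SigmaFinite (Measure.count : Measure ℤ))
  | .real => inferInstanceAs (SigmaFinite (volume : Measure ℝ))

instance (E : HeightSpace) : E.refMeasure.IsAddRightInvariant :=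
  match E with
  | .int => inferInstanceAs ((Measure.count : Measure ℤ).IsAddRightInvariant)
  | .real => inferInstanceAs ((volume : Measure ℝ).IsAddRightInvariant)

/-- The vertices of the square lattice. -/
abbrev Vertex (d : ℕ) : Type := Fin d → ℤ

/-- The graph metric of the square lattice. -/
def dist1 {d : ℕ} (x y : Vertex d) : ℕ := ∑ i, (x i - y i).natAbs

/-- Height functions, that is, functions from the square lattice to `E`. -/
@[ext]
structure Config (E : HeightSpace) (d : ℕ) : Type where
  toFun : Vertex d → E

instance (E : HeightSpace) (d : ℕ) : CoeFun (Config E d) fun _ => Vertex d → E :=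
  ⟨Config.toFun⟩

variable {E : HeightSpace} {d : ℕ}

/-- The sigma-algebra generated by the height differences `φ y - φ x` with `x, y ∈ Λ`. -/
@[reducible]
def gradAlg (E : HeightSpace) {d : ℕ} (Λ : Set (Vertex d)) : MeasurableSpace (Config E d) :=
  MeasurableSpace.comap (fun (φ : Config E d) (p : Λ × Λ) => φ p.2 - φ p.1) MeasurableSpace.pi

/-- Measures on `Config E d` are gradient measures: the sigma-algebra used is the one that is
generated by all height differences. -/
instance : MeasurableSpace (Config E d) := gradAlg E Set.univ

theorem measurable_config_iff {X : Type*} [MeasurableSpace X] {Λ : Set (Vertex d)}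
    {f : X → Config E d} :
    Measurable[_, gradAlg E Λ] f ↔ ∀ x ∈ Λ, ∀ y ∈ Λ, Measurable fun a => f a y - f a x := by
  constructor
  · intro h x hx y hy
    have h1 := (measurable_pi_apply ((⟨x, hx⟩, ⟨y, hy⟩) : Λ × Λ)).comp
      ((comap_measurable (m := MeasurableSpace.pi)
        (fun (φ : Config E d) (p : Λ × Λ) => φ p.2 - φ p.1)).comp h)
    exact h1
  · intro h
    refine Measurable.of_comap_le ?_
    rw [gradAlg, MeasurableSpace.comap_comp]
    refine Measurable.comap_le ?_
    exact measurable_pi_iff.2 fun p => h _ p.1.2 _ p.2.2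

theorem measurable_grad (x y : Vertex d) : Measurable fun φ : Config E d => φ y - φ x :=
  measurable_config_iff.1 measurable_id x (Set.mem_univ x) y (Set.mem_univ y)

theorem gradAlg_le (Λ : Set (Vertex d)) :
    gradAlg E Λ ≤ (inferInstance : MeasurableSpace (Config E d)) := by
  have h : Measurable[_, gradAlg E Λ] (id : Config E d → Config E d) :=
    measurable_config_iff.2 fun x _ y _ => measurable_grad x y
  simpa using h.comap_le

/-! ### Shifts -/

/-- The shifted height function `y ↦ φ (y + x)`. -/
def shift (x : Vertex d) (φ : Config E d) : Config E d := ⟨fun y => φ (y + x)⟩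

theorem measurable_shift (x : Vertex d) : Measurable (shift x : Config E d → Config E d) :=
  measurable_config_iff.2 fun y _ z _ => measurable_grad (y + x) (z + x)

/-- `μ` is an `L`-invariant gradient probability measure. -/
structure IsInvariantProb (L : AddSubgroup (Vertex d)) (μ : Measure (Config E d)) : Prop where
  isProb : IsProbabilityMeasure μ
  map_shift : ∀ x ∈ L, μ.map (shift x) = μ

/-- The translate `Λ + x`. -/
def translate (x : Vertex d) (Λ : Finset (Vertex d)) : Finset (Vertex d) := Λ.image (· + x)

/-! ### Potentials -/

/-- A gradient potential: a family of functions `Φ_Λ` with values in `ℝ ∪ {∞}`, each measurable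
for the height differences within `Λ`; by convention `Φ_Λ = 0` if `Λ` is empty or a singleton. -/
structure GradPotential (E : HeightSpace) (d : ℕ) where
  toFun : Finset (Vertex d) → Config E d → EReal
  ne_bot : ∀ Λ φ, toFun Λ φ ≠ ⊥
  measurable : ∀ Λ : Finset (Vertex d), Measurable[gradAlg E (Λ : Set (Vertex d))] (toFun Λ)
  zero_of_card_le_one : ∀ Λ, Λ.card ≤ 1 → ∀ φ, toFun Λ φ = 0

instance : CoeFun (GradPotential E d) fun _ => Finset (Vertex d) → Config E d → EReal :=
  ⟨GradPotential.toFun⟩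

/-- Invariance of a potential under translations by elements of `L`. -/
def GradPotential.IsPeriodic (L : AddSubgroup (Vertex d)) (Φ : GradPotential E d) : Prop :=
  ∀ x ∈ L, ∀ Λ φ, Φ (translate x Λ) φ = Φ Λ (shift x φ)

/-- The interior Hamiltonian `H⁰_Λ`. -/
def GradPotential.interiorHamiltonian (Φ : GradPotential E d) (Λ : Finset (Vertex d))
    (φ : Config E d) : EReal :=
  ∑ Γ ∈ Λ.powerset with Γ.Nonempty, Φ Γ φ

/-! ### Local Lipschitz constraints -/

structure IsAdmissibleGraph (L : AddSubgroup (Vertex d)) (A : SimpleGraph (Vertex d)) :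
    Prop where
  invariant : ∀ v ∈ L, ∀ x y, A.Adj (x + v) (y + v) ↔ A.Adj x y
  connected : A.Connected
  bounded_degree : ∃ D : ℕ, ∀ x, (A.neighborSet x).encard ≤ D

structure IsAdmissibleQuasimetric (L : AddSubgroup (Vertex d))
    (q : Vertex d → Vertex d → ℝ) : Prop where
  self : ∀ x, q x x = 0
  pos : ∀ x y, x ≠ y → 0 < q x y + q y x
  triangle : ∀ x y z, q x z ≤ q x y + q y z
  invariant : ∀ v ∈ L, ∀ x y, q (x + v) (y + v) = q x y

structure IsLocalLipschitzConstraint (L : AddSubgroup (Vertex d)) (A : SimpleGraph (Vertex d))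
    (q : Vertex d → Vertex d → ℝ) : Prop where
  graph : IsAdmissibleGraph L A
  quasimetric : IsAdmissibleQuasimetric L q
  maximal : ∀ p, IsAdmissibleQuasimetric L p → (∀ x y, A.Adj x y → p x y ≤ q x y) →
    ∀ x y, p x y ≤ q x y

/-- `p` is the quasimetric `q_ε`: the largest admissible quasimetric which is at most `q - ε` on
the edges. -/
def IsShrunk (L : AddSubgroup (Vertex d)) (A : SimpleGraph (Vertex d))
    (q : Vertex d → Vertex d → ℝ) (ε : ℝ) (p : Vertex d → Vertex d → ℝ) : Prop :=
  IsGreatest {r | IsAdmissibleQuasimetric L r ∧ ∀ x y, A.Adj x y → r x y ≤ q x y - ε} p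

/-- The set of `q`-Lipschitz height functions. -/
def lipschitzSet (E : HeightSpace) {d : ℕ} (q : Vertex d → Vertex d → ℝ) : Set (Config E d) :=
  {φ | ∀ x y, E.toReal (φ y) - E.toReal (φ x) ≤ q x y}

/-- `φ` satisfies the constraint `p` along each edge at `x`. -/
def IsLipschitzAt (A : SimpleGraph (Vertex d)) (p : Vertex d → Vertex d → ℝ) (φ : Config E d)
    (x : Vertex d) : Prop :=
  ∀ y, A.Adj x y → E.toReal (φ y) - E.toReal (φ x) ≤ p x y ∧
    E.toReal (φ x) - E.toReal (φ y) ≤ p y x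

/-! ### Strong and weak interactions -/

/-- A strong interaction with local Lipschitz constraint `(A, q)`. The sum in `locally_bounded` is
the Hamiltonian of `{x}`; it has nonnegative terms. -/
structure IsStrong (L : AddSubgroup (Vertex d)) (A : SimpleGraph (Vertex d))
    (q : Vertex d → Vertex d → ℝ) (Ψ : GradPotential E d) : Prop where
  periodic : Ψ.IsPeriodic L
  nonneg : ∀ Λ φ, 0 ≤ Ψ Λ φ
  finite_range : ∃ R : ℕ, ∀ Λ : Finset (Vertex d), (∃ x ∈ Λ, ∃ y ∈ Λ, R < dist1 x y) →
    ∀ φ, Ψ Λ φ = 0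
  constraint : IsLocalLipschitzConstraint L A q
  lipschitz : ∀ Λ φ, Ψ Λ φ = ⊤ ↔
    ∃ x y, A.Adj x y ∧ Λ = {x, y} ∧ q x y < E.toReal (φ y) - E.toReal (φ x)
  locally_bounded : E = HeightSpace.real → ∃ ε₀ > 0, ∀ ε, 0 < ε → ε < ε₀ →
    ∀ p, IsShrunk L A q ε p → ∃ C : ℝ, ∀ (x : Vertex d) (φ : Config E d), IsLipschitzAt A p φ x →
      ∑' Γ : {Γ : Finset (Vertex d) // x ∈ Γ}, (Ψ Γ φ).toENNReal ≤ ENNReal.ofReal C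

/-- The vertices outside `Λ` which are adjacent to `Λ` in the square lattice. -/
def boundary (Λ : Finset (Vertex d)) : Set (Vertex d) :=
  {x | x ∉ Λ ∧ ∃ y ∈ Λ, dist1 x y = 1}

def IsVanHove (Λ : ℕ → Finset (Vertex d)) : Prop :=
  Tendsto (fun n => (Λ n).card) atTop atTop ∧
    Tendsto (fun n => ((boundary (Λ n)).ncard : ℝ) / ((Λ n).card : ℝ)) atTop (𝓝 0)

structure IsAmenable (L : AddSubgroup (Vertex d)) (f : Finset (Vertex d) → ℝ≥0∞) : Prop where
  ne_top : ∀ Λ, f Λ ≠ ⊤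
  invariant : ∀ x ∈ L, ∀ Λ, f (translate x Λ) = f Λ
  subadditive : ∀ Λ Δ, Disjoint Λ Δ → f (Λ ∪ Δ) ≤ f Λ + f Δ
  sublinear : ∀ Λ : ℕ → Finset (Vertex d), IsVanHove Λ →
    Tendsto (fun n => f (Λ n) / ((Λ n).card : ℝ≥0∞)) atTop (𝓝 0)

/-- The lower exterior bound `e⁻`. -/
def lowerExteriorBound (Ξ : GradPotential E d) (Λ : Finset (Vertex d)) : ℝ≥0∞ :=
  ⨆ φ : Config E d,
    ∑' Δ : {Δ : Finset (Vertex d) // (∃ x ∈ Δ, x ∈ Λ) ∧ ∃ x ∈ Δ, x ∉ Λ}, (Ξ Δ φ).abs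

/-- A weak interaction. -/
structure IsWeak (L : AddSubgroup (Vertex d)) (Ξ : GradPotential E d) : Prop where
  periodic : Ξ.IsPeriodic L
  summable : (⨆ (x : Vertex d) (φ : Config E d),
    ∑' Λ : {Λ : Finset (Vertex d) // x ∈ Λ}, (Ξ Λ φ).abs) < ⊤
  amenable : IsAmenable L (lowerExteriorBound Ξ)

/-- `Φ` is the sum of a strong interaction, with local Lipschitz constraint `(A, q)`, and a weak
interaction. -/
def IsStrongPlusWeak (L : AddSubgroup (Vertex d)) (A : SimpleGraph (Vertex d))
    (q : Vertex d → Vertex d → ℝ) (Φ : GradPotential E d) : Prop :=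
  ∃ Ψ Ξ : GradPotential E d, IsStrong L A q Ψ ∧ IsWeak L Ξ ∧ ∀ Λ φ, Φ Λ φ = Ψ Λ φ + Ξ Λ φ

/-! ### Free energy, specific free energy, surface tension -/

open Classical in
/-- The relative entropy of `μ` with respect to `ν`, with values in `[-∞, ∞]`: the integral of
`log (dμ/dν)` against `μ` if `μ ≪ ν`, and `∞` otherwise (convention: `∞ - ∞ = ∞`). -/
def relEntropy {X : Type*} [MeasurableSpace X] (μ ν : Measure X) : EReal :=
  if μ ≪ ν ∧ ∫⁻ x, ENNReal.ofReal (llr μ ν x) ∂μ ≠ ⊤ then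
    ((∫⁻ x, ENNReal.ofReal (llr μ ν x) ∂μ : ℝ≥0∞) : EReal) -
      ((∫⁻ x, ENNReal.ofReal (-llr μ ν x) ∂μ : ℝ≥0∞) : EReal)
  else ⊤

/-- The height function which is `ψ` on `Λ` and `0` elsewhere. -/
def extendZero (Λ : Finset (Vertex d)) (ψ : Λ → E) : Config E d :=
  ⟨fun y => if h : y ∈ Λ then ψ ⟨y, h⟩ else 0⟩

theorem measurable_extendZero_apply (Λ : Finset (Vertex d)) (y : Vertex d) :
    Measurable fun ψ : Λ → E => extendZero Λ ψ y := by
  unfold extendZero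
  by_cases h : y ∈ Λ
  · simpa [h] using measurable_pi_apply (⟨y, h⟩ : Λ)
  · simp [h]

theorem measurable_extendZero (Λ : Finset (Vertex d)) (S : Set (Vertex d)) :
    Measurable[_, gradAlg E S] (extendZero (E := E) Λ) :=
  measurable_config_iff.2 fun x _ y _ =>
    (measurable_extendZero_apply Λ y).sub (measurable_extendZero_apply Λ x)

/-- The gradient reference measure on `Λ` with reference vertex `x ∈ Λ`: the law, on the
sigma-algebra of the height differences in `Λ`, of the height function which vanishes at `x` and
has the product reference measure on `Λ \ {x}`. -/
def gradRefMeasure (E : HeightSpace) {d : ℕ} (Λ : Finset (Vertex d)) (x : Vertex d) :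
    Measure[gradAlg E (Λ : Set (Vertex d))] (Config E d) :=
  @Measure.map _ _ _ (gradAlg E (Λ : Set (Vertex d))) (extendZero (Λ.erase x))
    (Measure.pi fun _ => E.refMeasure)

/-- Under the gradient reference measure, the heights in `Λ \ {x}` relative to the height at `x`
have the product reference measure as their law. -/
theorem map_gradRefMeasure (Λ : Finset (Vertex d)) (x : Vertex d) (hx : x ∈ Λ) :
    @Measure.map _ _ (gradAlg E (Λ : Set (Vertex d))) _
      (fun (φ : Config E d) (y : Λ.erase x) => φ y - φ x) (gradRefMeasure E Λ x) =
    Measure.pi fun _ => E.refMeasure := by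
  have hm : Measurable[gradAlg E (Λ : Set (Vertex d))]
      (fun (φ : Config E d) (y : Λ.erase x) => φ y - φ x) := by
    let := gradAlg E (Λ : Set (Vertex d))
    refine measurable_pi_iff.2 fun y => ?_
    exact measurable_config_iff.1 (measurable_id (α := Config E d)) x hx y
      (Finset.mem_of_mem_erase y.2)
  rw [gradRefMeasure, @Measure.map_map _ _ _ _ (gradAlg E (Λ : Set (Vertex d))) _ _ _ _ hm
    (measurable_extendZero _ _)]
  convert Measure.map_id using 2
  funext ψ y
  have h1 : (y : Vertex d) ≠ x ∧ (y : Vertex d) ∈ Λ := Finset.mem_erase.1 y.2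
  simp [extendZero, h1.1, h1.2]

/-- The free energy of `μ` in `Λ`, computed with reference vertex `x ∈ Λ`: the relative entropy,
on the sigma-algebra of the height differences in `Λ`, of `μ` with respect to the gradient
reference measure weighted by `exp (-H⁰_Λ)`. It does not depend on `x`. -/
def freeEnergy (Φ : GradPotential E d) (μ : Measure (Config E d)) (Λ : Finset (Vertex d))
    (x : Vertex d) : EReal :=
  @relEntropy _ (gradAlg E (Λ : Set (Vertex d))) (μ.trim (gradAlg_le _))
    (@Measure.withDensity _ (gradAlg E (Λ : Set (Vertex d))) (gradRefMeasure E Λ x)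
      fun φ => EReal.exp (-Φ.interiorHamiltonian Λ φ))

/-- The box `[0, n)^d`. -/
def box (d n : ℕ) : Finset (Vertex d) := Fintype.piFinset fun _ => Finset.Ico 0 (n : ℤ)

/-- `h` is the specific free energy of `μ`: the limit of the free energies per site in boxes. -/
def HasSpecificFreeEnergy (Φ : GradPotential E d) (μ : Measure (Config E d)) (h : EReal) :
    Prop :=
  Tendsto (fun n : ℕ => freeEnergy Φ μ (box d n) 0 / (((n : ℝ) ^ d : ℝ) : EReal)) atTop (𝓝 h)

/-- `μ` has finite slope, and its slope is `u`. -/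
structure HasSlope (L : AddSubgroup (Vertex d)) (μ : Measure (Config E d))
    (u : Module.Dual ℝ (Fin d → ℝ)) : Prop where
  integrable : ∀ x y, Integrable (fun φ : Config E d => E.toReal (φ y - φ x)) μ
  eq_integral : ∀ x ∈ L, u (fun i => (x i : ℝ)) = ∫ φ, E.toReal (φ x - φ 0) ∂μ

/-- The surface tension at the slope `u`. -/
def surfaceTension (L : AddSubgroup (Vertex d)) (Φ : GradPotential E d)
    (u : Module.Dual ℝ (Fin d → ℝ)) : EReal :=
  sInf {h | ∃ ν : Measure (Config E d),
    IsInvariantProb L ν ∧ HasSlope L ν u ∧ HasSpecificFreeEnergy Φ ν h}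

/-- `μ` is a minimizer of the specific free energy: its specific free energy is finite and equals
the surface tension at its slope. -/
structure IsMinimizer (L : AddSubgroup (Vertex d)) (Φ : GradPotential E d)
    (μ : Measure (Config E d)) : Prop where
  invariant : IsInvariantProb L μ
  minimal : ∃ u h, HasSlope L μ u ∧ HasSpecificFreeEnergy Φ μ h ∧
    h = surfaceTension L Φ u ∧ h < ⊤

/-! ### Resampling the heights in a finite set -/

/-- The height function which is `ψ` on `Λ` and `φ` off `Λ`. -/
def glue (Λ : Finset (Vertex d)) (φ : Config E d) (ψ : Λ → E) : Config E d :=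
  ⟨fun y => if h : y ∈ Λ then ψ ⟨y, h⟩ else φ y⟩

theorem measurable_glue (Λ : Finset (Vertex d)) (φ : Config E d) : Measurable (glue Λ φ) := by
  have key : ∀ y, Measurable fun ψ : Λ → E => glue Λ φ ψ y := by
    intro y
    unfold glue
    by_cases h : y ∈ Λ
    · simpa [h] using measurable_pi_apply (⟨y, h⟩ : Λ)
    · simp [h]
  exact measurable_config_iff.2 fun x _ y _ => (key y).sub (key x)

/-- The gradient measure `μ π_{ℤ^d \ Λ} × λ^Λ`: sample `φ` from `μ`, keep its values off `Λ`, and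
let the values on `Λ` have the product reference measure. For gradient events this does not depend
on an additive constant in `φ`, because the reference measure is translation invariant. -/
def resample (μ : Measure (Config E d)) (Λ : Finset (Vertex d)) : Measure (Config E d) :=
  μ.bind fun φ => (Measure.pi fun _ : Λ => E.refMeasure).map (glue Λ φ)

theorem measurable_sub_const (c : E) :
    Measurable fun φ : Config E d => (⟨fun y => φ y - c⟩ : Config E d) :=
  measurable_config_iff.2 fun x _ y _ => by simpa using measurable_grad x y

theorem map_sub_const (ν : Measure (Config E d)) (c : E) :
    ν.map (fun φ : Config E d => (⟨fun y => φ y - c⟩ : Config E d)) = ν := by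
  ext A hA
  rw [Measure.map_apply (measurable_sub_const c) hA]
  obtain ⟨B, -, rfl⟩ := hA
  congr 1
  ext φ
  simp

/-- The kernel in the definition of `resample` is measurable for the gradient sigma-algebra. -/
theorem measurable_map_glue (Λ : Finset (Vertex d)) :
    Measurable fun φ : Config E d =>
      (Measure.pi fun _ : Λ => E.refMeasure).map (glue Λ φ) := by
  have hG : Measurable (fun p : (Vertex d → E) × (Λ → E) => glue Λ ⟨p.1⟩ p.2) := by
    have key : ∀ y, Measurable fun p : (Vertex d → E) × (Λ → E) => glue Λ ⟨p.1⟩ p.2 y := by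
      intro y
      unfold glue
      by_cases h : y ∈ Λ
      · simpa [h] using! (measurable_pi_apply (⟨y, h⟩ : Λ)).comp measurable_snd
      · simpa [h] using! (measurable_pi_apply y).comp measurable_fst
    exact measurable_config_iff.2 fun x _ y _ => (key y).sub (key x)
  have hN : Measurable (fun (φ : Config E d) (y : Vertex d) => φ y - φ 0) :=
    measurable_pi_iff.2 fun y => measurable_grad 0 y
  have heq : ∀ φ : Config E d, (Measure.pi fun _ : Λ => E.refMeasure).map (glue Λ φ) =
      (Measure.pi fun _ : Λ => E.refMeasure).map (glue Λ ⟨fun y => φ y - φ 0⟩) := by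
    intro φ
    have h1 : glue Λ ⟨fun y => φ y - φ 0⟩ =
        (fun χ : Config E d => (⟨fun y => χ y - φ 0⟩ : Config E d)) ∘ (glue Λ φ ∘
          (fun ψ : Λ → E => ψ + fun _ => φ 0)) := by
      funext ψ
      ext y
      by_cases h : y ∈ Λ <;> simp [glue, h]
    have hadd : Measurable (fun ψ : Λ → E => ψ + fun _ => φ 0) :=
      measurable_pi_iff.2 fun y => (measurable_pi_apply y).add measurable_const
    rw [h1, ← Measure.map_map (measurable_sub_const _) ((measurable_glue Λ φ).comp hadd),
      map_sub_const, ← Measure.map_map (measurable_glue Λ φ) hadd, map_add_right_eq_self]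
  refine Measure.measurable_of_measurable_coe _ fun A hA => ?_
  have h2 : (fun φ : Config E d => ((Measure.pi fun _ : Λ => E.refMeasure).map (glue Λ φ)) A) =
      (fun χ : Vertex d → E => (Measure.pi fun _ : Λ => E.refMeasure)
        (Prod.mk χ ⁻¹' ((fun p : (Vertex d → E) × (Λ → E) => glue Λ ⟨p.1⟩ p.2) ⁻¹' A))) ∘
        (fun (φ : Config E d) (y : Vertex d) => φ y - φ 0) := by
    funext φ
    rw [heq φ, Measure.map_apply (measurable_glue Λ _) hA]
    rfl
  rw [h2]
  exact (measurable_measure_prodMk_left (hG hA)).comp hN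

theorem resample_apply (μ : Measure (Config E d)) (Λ : Finset (Vertex d))
    {A : Set (Config E d)} (hA : MeasurableSet A) :
    resample μ Λ A =
      ∫⁻ φ, (Measure.pi fun _ : Λ => E.refMeasure) {ψ | glue Λ φ ψ ∈ A} ∂μ := by
  rw [resample, Measure.bind_apply hA (measurable_map_glue Λ).aemeasurable]
  refine lintegral_congr fun φ => ?_
  rw [Measure.map_apply (measurable_glue Λ φ) hA]
  rfl

end HeightModel

end

noncomputable section

namespace HeightModel

variable {E : HeightSpace} {d : ℕ}

section
/-! ### Relative entropies and densities -/

section Entropy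

variable {X : Type*} {mX : MeasurableSpace X}

/-! Suppose that `μ` is a minimizer and `μ T = 0`, while the resampling of `Λ` gives positive mass
to `T ∩ lipschitzSet E q`. The contradiction is a competitor with the same slope and a strictly
smaller specific free energy.

Single step. Finite specific free energy forces `μ` onto Lipschitz functions
(`IsSplit.isLipschitzMeasure`). Propose new heights on `Λ`, uniform in a huge ball around the height
at a vertex `b` outside `Λ`, and accept the proposal if it lies in a local event `S`. The event `S`
approximates `T` simultaneously under `μ` and under the law of the proposal, and is cut down so that
the strong energy near `Λ` is bounded on it. Hence the acceptance probability `a` is positive and `μ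
S ≤ a` (`IsSplit.exists_isEfficient`).

Why the free energy falls. By `gibbs_inequality`, `∫ log G ≤ ∫ log F + log c` as soon as `∫ G / F ≤
c`. On the product of the old law and the proposals, take for `G` the new density after the step,
and for `F` the old density, multiplied by `exp (-2)` on acceptance. Rejected proposals contribute
at most `1` to `∫ G / F`. Accepted ones contribute at most `exp 2 * k * 2a`, because the new law
gives `S` at most `2a`; here `k` is an energy factor times the volume of the admissible old heights,
divided by the volume of the proposal ball. A large ball makes this at most `a`. The net change is
at most `-2a + log (1 + a) ≤ -a` (`IsSplit.hasFreeEnergy_resampleStep`).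

Positive density. Do this at all points of `L` on a sparse grid. The windows are disjoint, so every
step sees the law of `μ` in its own window and gains `a` again
(`IsSplit.hasFreeEnergy_resampleAll`): the total gain is proportional to the volume. Averaging over
the offsets of the grid restores `L`-invariance, and convexity keeps the gain. Heights move by a
bounded amount only, so the slope cannot change (`HasSlope.of_bounded`).

The competitor has a specific free energy because free energies of Lipschitz measures are
superadditive up to an amenable error (`IsSplit.superadditive`), so that a Fekete argument along
boxes applies. Minimality is then violated (`IsSplit.not_isEfficient`). -/

/-- Jensen's inequality in the form of Gibbs: if `∫ G / F ∂ν ≤ c` then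
`∫ log G ∂ν ≤ ∫ log F ∂ν + log c`. -/
theorem gibbs_inequality {ν : Measure X} [IsProbabilityMeasure ν] {F G : X → ℝ≥0∞}
    (hFm : Measurable F) (hGm : Measurable G)
    (hF : ∀ᵐ x ∂ν, F x ≠ 0 ∧ F x ≠ ⊤) (hG : ∀ᵐ x ∂ν, G x ≠ 0 ∧ G x ≠ ⊤)
    {c : ℝ} (hc : 0 < c) (hle : ∫⁻ x, G x / F x ∂ν ≤ ENNReal.ofReal c)
    (hFi : Integrable (fun x => Real.log (F x).toReal) ν)
    (hGneg : ∫⁻ x, ENNReal.ofReal (-Real.log (G x).toReal) ∂ν ≠ ⊤) :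
    Integrable (fun x => Real.log (G x).toReal) ν ∧
      ∫ x, Real.log (G x).toReal ∂ν ≤ ∫ x, Real.log (F x).toReal ∂ν + Real.log c := by
  have hRm : Measurable fun x => G x / F x := hGm.div hFm
  have hRi : Integrable (fun x => (G x / F x).toReal) ν :=
    integrable_toReal_of_lintegral_ne_top hRm.aemeasurable
      (ne_top_of_le_ne_top ENNReal.ofReal_ne_top hle)
  have hRle : ∫ x, (G x / F x).toReal ∂ν ≤ c := by
    rw [integral_toReal hRm.aemeasurable]
    · exact ENNReal.toReal_le_of_le_ofReal hc.le hle
    · filter_upwards [hF, hG] with x h1 h2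
      exact ENNReal.div_lt_top h2.2 h1.1
  -- This is `log t ≤ t - 1` at `t = G / (c F)`.
  have hpt : ∀ᵐ x ∂ν, Real.log (G x).toReal ≤
      Real.log (F x).toReal + (Real.log c + (G x / F x).toReal / c - 1) := by
    filter_upwards [hF, hG] with x h1 h2
    have hf : 0 < (F x).toReal := ENNReal.toReal_pos h1.1 h1.2
    have hg : 0 < (G x).toReal := ENNReal.toReal_pos h2.1 h2.2
    have h3 := Real.log_le_sub_one_of_pos (show 0 < (G x).toReal / (F x).toReal / c by positivity)
    rw [Real.log_div (by positivity) hc.ne', Real.log_div hg.ne' hf.ne'] at h3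
    rw [ENNReal.toReal_div]
    linarith
  have hBi : Integrable (fun x => Real.log (F x).toReal +
      (Real.log c + (G x / F x).toReal / c - 1)) ν :=
    hFi.add (((integrable_const _).add (hRi.div_const c)).sub (integrable_const _))
  have hnegi : Integrable (fun x => max (-Real.log (G x).toReal) 0) ν := by
    have h := integrable_toReal_of_lintegral_ne_top (μ := ν)
      (f := fun x => ENNReal.ofReal (-Real.log (G x).toReal))
      (Real.measurable_log.comp hGm.ennreal_toReal).neg.ennreal_ofReal.aemeasurable hGneg
    refine h.congr (Eventually.of_forall fun x => ?_)
    simp [ENNReal.toReal_ofReal']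
  -- The positive part of `log G` is controlled by the integrable upper bound in `hpt`, the negative
  -- part by `hGneg`.
  have hGi : Integrable (fun x => Real.log (G x).toReal) ν := by
    refine Integrable.mono' (hBi.abs.add hnegi)
      (Real.measurable_log.comp hGm.ennreal_toReal).aestronglyMeasurable ?_
    filter_upwards [hpt] with x hx
    rw [Real.norm_eq_abs, Pi.add_apply]
    rcases le_total 0 (Real.log (G x).toReal) with h | h
    · rw [abs_of_nonneg h]
      have := le_max_right (-Real.log (G x).toReal) 0
      have := le_abs_self (Real.log (F x).toReal + (Real.log c + (G x / F x).toReal / c - 1))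
      linarith
    · rw [abs_of_nonpos h]
      have := le_max_left (-Real.log (G x).toReal) 0
      have := abs_nonneg (Real.log (F x).toReal + (Real.log c + (G x / F x).toReal / c - 1))
      linarith
  refine ⟨hGi, ?_⟩
  have h4 := integral_mono_ae hGi hBi hpt
  have h6 : ∫ x, (Real.log (F x).toReal + (Real.log c + (G x / F x).toReal / c - 1)) ∂ν =
      ∫ x, Real.log (F x).toReal ∂ν + (Real.log c + (∫ x, (G x / F x).toReal ∂ν) / c - 1) := by
    have h7 : Integrable (fun x => Real.log c + (G x / F x).toReal / c) ν :=
      (integrable_const _).add (hRi.div_const c)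
    have h8 : Integrable (fun x => Real.log c + (G x / F x).toReal / c - 1) ν :=
      h7.sub (integrable_const _)
    rw [integral_add hFi h8, integral_sub h7 (integrable_const _),
      integral_add (integrable_const _) (hRi.div_const c), integral_div]
    simp
  rw [h6] at h4
  have h5 : (∫ x, (G x / F x).toReal ∂ν) / c ≤ 1 := (div_le_one hc).2 hRle
  linarith

theorem density_ne {ν m : Measure X} [IsFiniteMeasure ν] {f : X → ℝ≥0∞} (hf : Measurable f)
    (h : ν = m.withDensity f) : ∀ᵐ x ∂ν, f x ≠ 0 ∧ f x ≠ ⊤ := by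
  have h1 : ∀ᵐ x ∂ν, f x ≠ 0 := by
    rw [h]
    exact (ae_withDensity_iff hf).2 (Eventually.of_forall fun x hx => hx)
  have h2 : ∀ᵐ x ∂ν, f x ≠ ⊤ := by
    have : ∫⁻ x, f x ∂m ≠ ⊤ := by
      rw [← setLIntegral_univ, ← withDensity_apply _ MeasurableSet.univ, ← h]
      exact measure_ne_top _ _
    have h3 := ae_lt_top hf this
    rw [h]
    exact (withDensity_absolutelyContinuous m f).ae_le (h3.mono fun x hx => hx.ne)
  filter_upwards [h1, h2] with x h3 h4 using ⟨h3, h4⟩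

/-- Integrability of the log-density excludes `∞ - ∞`, so positive and negative parts recombine to
an ordinary integral. -/
theorem relEntropy_withDensity {ν m : Measure X} [IsFiniteMeasure ν] [SigmaFinite m]
    {f : X → ℝ≥0∞} (hf : Measurable f) (h : ν = m.withDensity f)
    (hi : Integrable (fun x => Real.log (f x).toReal) ν) :
    relEntropy ν m = ((∫ x, Real.log (f x).toReal ∂ν : ℝ) : EReal) := by
  have hac : ν ≪ m := h ▸ withDensity_absolutelyContinuous m f
  have hllr : llr ν m =ᵐ[ν] fun x => Real.log (f x).toReal := by
    have h1 : ν.rnDeriv m =ᵐ[m] f := by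
      rw [h]
      exact Measure.rnDeriv_withDensity m hf
    filter_upwards [hac.ae_le h1] with x hx
    simp [llr_def, hx]
  have hi' : Integrable (llr ν m) ν := hi.congr hllr.symm
  have hp : ∫⁻ x, ENNReal.ofReal (llr ν m x) ∂ν ≠ ⊤ :=
    ne_top_of_le_ne_top hi'.2.ne (lintegral_mono fun x => Real.ofReal_le_enorm _)
  have hn : ∫⁻ x, ENNReal.ofReal (-llr ν m x) ∂ν ≠ ⊤ :=
    ne_top_of_le_ne_top hi'.neg.2.ne (lintegral_mono fun x => Real.ofReal_le_enorm _)
  rw [relEntropy, if_pos ⟨hac, hp⟩, ← integral_congr_ae hllr,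
    integral_eq_lintegral_pos_part_sub_lintegral_neg_part hi', EReal.coe_sub,
    EReal.coe_ennreal_toReal hp, EReal.coe_ennreal_toReal hn]

/-- Only the positive part of the log-density is controlled here; for Lipschitz measures the
negative part is handled by `IsSplit.lintegral_neg_log_ne_top`. -/
theorem exists_density_of_relEntropy_ne_top {ν m : Measure X} [IsFiniteMeasure ν]
    [SigmaFinite m] (h : relEntropy ν m ≠ ⊤) :
    ∃ f : X → ℝ≥0∞, Measurable f ∧ ν = m.withDensity f ∧
      ∫⁻ x, ENNReal.ofReal (Real.log (f x).toReal) ∂ν ≠ ⊤ := by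
  have h1 : ν ≪ m ∧ ∫⁻ x, ENNReal.ofReal (llr ν m x) ∂ν ≠ ⊤ := by
    by_contra h2
    exact h (by rw [relEntropy, if_neg h2])
  exact ⟨ν.rnDeriv m, Measure.measurable_rnDeriv _ _,
    (Measure.withDensity_rnDeriv_eq _ _ h1.1).symm, h1.2⟩

theorem integrable_of_lintegral_parts {ν : Measure X} {g : X → ℝ} (hg : Measurable g)
    (hp : ∫⁻ x, ENNReal.ofReal (g x) ∂ν ≠ ⊤) (hn : ∫⁻ x, ENNReal.ofReal (-g x) ∂ν ≠ ⊤) :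
    Integrable g ν := by
  refine ⟨hg.aestronglyMeasurable, ?_⟩
  refine lt_of_le_of_lt (lintegral_mono fun x => ?_ :
    ∫⁻ x, ‖g x‖ₑ ∂ν ≤ ∫⁻ x, (ENNReal.ofReal (g x) + ENNReal.ofReal (-g x)) ∂ν) ?_
  · rw [← ofReal_norm, Real.norm_eq_abs]
    rcases le_total 0 (g x) with h | h
    · rw [abs_of_nonneg h]; exact le_self_add
    · rw [abs_of_nonpos h]; exact le_add_self
  · rw [lintegral_add_left hg.ennreal_ofReal]
    exact ENNReal.add_lt_top.2 ⟨hp.lt_top, hn.lt_top⟩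

end Entropy

end

section
/-! ### Gradient functions and the gradient reference measure -/

theorem measurable_mk (S : Set (Vertex d)) :
    Measurable[MeasurableSpace.pi, gradAlg E S] fun ξ : Vertex d → E => (⟨ξ⟩ : Config E d) :=
  measurable_config_iff.2 fun x _ y _ => (measurable_pi_apply y).sub (measurable_pi_apply x)

theorem gradAlg_mono {S T : Set (Vertex d)} (h : S ⊆ T) : gradAlg E S ≤ gradAlg E T := by
  have h : Measurable[gradAlg E T, gradAlg E S] (id : Config E d → Config E d) :=
    (@measurable_config_iff E d _ (gradAlg E T) S _).2 fun x hx y hy =>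
      (@measurable_config_iff E d _ (gradAlg E T) T id).1 (@measurable_id _ (gradAlg E T))
        x (h hx) y (h hy)
  simpa using h.comap_le

/-- A function which is measurable for the height differences in `S` depends on nothing else. -/
theorem gradAlg_congr {S : Set (Vertex d)} {α : Type*} [MeasurableSpace α]
    [MeasurableSingletonClass α] {g : Config E d → α} (hg : Measurable[gradAlg E S] g)
    {φ χ : Config E d} (h : ∀ x ∈ S, ∀ y ∈ S, φ y - φ x = χ y - χ x) : g φ = g χ := by
  obtain ⟨B, -, hB⟩ := hg (measurableSet_singleton (g χ))
  have h1 : χ ∈ g ⁻¹' {g χ} := rfl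
  rw [← hB] at h1
  have h2 : φ ∈ g ⁻¹' {g χ} := by
    rw [← hB]
    have h3 : (fun p : S × S => φ p.2 - φ p.1) = fun p : S × S => χ p.2 - χ p.1 :=
      funext fun p => h _ p.1.2 _ p.2.2
    simpa only [Set.mem_preimage, h3] using h1
  exact h2

theorem gradAlg_congr_const {S : Set (Vertex d)} {α : Type*} [MeasurableSpace α]
    [MeasurableSingletonClass α] {g : Config E d → α} (hg : Measurable[gradAlg E S] g)
    {φ χ : Config E d} (c : E) (h : ∀ x ∈ S, φ x = χ x + c) : g φ = g χ :=
  gradAlg_congr hg fun x hx y hy => by rw [h x hx, h y hy]; abel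

instance (E : HeightSpace) : E.refMeasure.IsNegInvariant :=
  match E with
  | .int => inferInstanceAs ((Measure.count : Measure ℤ).IsNegInvariant)
  | .real => inferInstanceAs ((volume : Measure ℝ).IsNegInvariant)

instance (E : HeightSpace) : MeasurableNeg E :=
  match E with
  | .int => inferInstanceAs (MeasurableNeg ℤ)
  | .real => inferInstanceAs (MeasurableNeg ℝ)

/-- The integral of `F` over the heights in `s`, the other heights being given. -/
def integrateOut (s : Finset (Vertex d)) (F : Config E d → ℝ≥0∞) (φ : Config E d) : ℝ≥0∞ :=
  ∫⁻ ψ, F (glue s φ ψ) ∂Measure.pi fun _ : s => E.refMeasure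

/-- Through this identity, Fubini and the removal of single coordinates come from `lmarginal`. They
concern actual heights, whence `HeightMeasurable` in place of gradient measurability. -/
theorem integrateOut_eq_lmarginal (s : Finset (Vertex d)) (F : Config E d → ℝ≥0∞)
    (ξ : Vertex d → E) :
    integrateOut s F ⟨ξ⟩ = lmarginal (fun _ => E.refMeasure) s (fun ζ => F ⟨ζ⟩) ξ := rfl

/-- The heights, as opposed to the height differences, are measurable for this sigma-algebra. -/
def HeightMeasurable (F : Config E d → ℝ≥0∞) : Prop :=
  Measurable fun ξ : Vertex d → E => F ⟨ξ⟩

theorem heightMeasurable_of_gradAlg {S : Set (Vertex d)} {F : Config E d → ℝ≥0∞}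
    (hF : Measurable[gradAlg E S] F) : HeightMeasurable F :=
  hF.comp (measurable_mk S)

theorem HeightMeasurable.mul {F G : Config E d → ℝ≥0∞} (hF : HeightMeasurable F)
    (hG : HeightMeasurable G) : HeightMeasurable fun φ => F φ * G φ :=
  Measurable.mul hF hG

theorem HeightMeasurable.integrateOut {F : Config E d → ℝ≥0∞} (hF : HeightMeasurable F)
    (s : Finset (Vertex d)) : HeightMeasurable (integrateOut s F) :=
  Measurable.lmarginal (fun _ => E.refMeasure) hF

theorem integrateOut_union {s t : Finset (Vertex d)} (h : Disjoint s t) {F : Config E d → ℝ≥0∞}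
    (hF : HeightMeasurable F) (φ : Config E d) :
    integrateOut (s ∪ t) F φ = integrateOut s (integrateOut t F) φ := by
  obtain ⟨ξ⟩ := φ
  have h1 := congrFun (lmarginal_union (fun _ : Vertex d => E.refMeasure) _ hF h) ξ
  simpa only [integrateOut_eq_lmarginal] using h1

/-- The height function `φ` with its value at `x` replaced by `c`. -/
def setAt (φ : Config E d) (x : Vertex d) (c : E) : Config E d := ⟨Function.update φ.toFun x c⟩

theorem integrateOut_insert {s : Finset (Vertex d)} {x : Vertex d} (h : x ∉ s)
    {F : Config E d → ℝ≥0∞} (hF : HeightMeasurable F) (φ : Config E d) :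
    integrateOut (insert x s) F φ = ∫⁻ c, integrateOut s F (setAt φ x c) ∂E.refMeasure := by
  obtain ⟨ξ⟩ := φ
  exact lmarginal_insert (μ := fun _ : Vertex d => E.refMeasure) _ hF h ξ

theorem integrateOut_mono {s : Finset (Vertex d)} {F G : Config E d → ℝ≥0∞}
    (h : ∀ φ, F φ ≤ G φ) (φ : Config E d) : integrateOut s F φ ≤ integrateOut s G φ :=
  lintegral_mono fun _ => h _

theorem measurable_glue_height (s : Finset (Vertex d)) (φ : Config E d)
    {F : Config E d → ℝ≥0∞} (hF : HeightMeasurable F) :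
    Measurable fun ψ : s → E => F (glue s φ ψ) :=
  hF.comp (measurable_updateFinset (x := φ.toFun))

theorem integrateOut_mul_left {s : Finset (Vertex d)} {F G : Config E d → ℝ≥0∞}
    (hG : HeightMeasurable G) {φ : Config E d} (hF : ∀ ψ, F (glue s φ ψ) = F φ) :
    integrateOut s (fun φ => F φ * G φ) φ = F φ * integrateOut s G φ := by
  simp_rw [integrateOut, hF]
  exact lintegral_const_mul _ (measurable_glue_height s φ hG)

theorem integrateOut_const_mul {s : Finset (Vertex d)} {G : Config E d → ℝ≥0∞} (c : ℝ≥0∞)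
    (hG : HeightMeasurable G) (φ : Config E d) :
    integrateOut s (fun φ => c * G φ) φ = c * integrateOut s G φ :=
  lintegral_const_mul _ (measurable_glue_height s φ hG)

/-- Invariance of the reference measure under translations. -/
theorem integrateOut_add_const (s : Finset (Vertex d)) {F : Config E d → ℝ≥0∞}
    (φ : Config E d) (c : E) :
    integrateOut s F φ =
      ∫⁻ ψ, F (glue s φ fun y => ψ y + c) ∂Measure.pi fun _ : s => E.refMeasure :=
  (lintegral_add_right_eq_self (μ := Measure.pi fun _ : s => E.refMeasure)
    (fun ψ => F (glue s φ ψ)) (fun _ => c)).symm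

theorem glue_apply_mem {s : Finset (Vertex d)} (φ : Config E d) (ψ : s → E) {y : Vertex d}
    (h : y ∈ s) : glue s φ ψ y = ψ ⟨y, h⟩ := by simp [glue, h]

theorem glue_apply_notMem {s : Finset (Vertex d)} (φ : Config E d) (ψ : s → E) {y : Vertex d}
    (h : y ∉ s) : glue s φ ψ y = φ y := by simp [glue, h]

instance : Zero (Config E d) := ⟨⟨fun _ => 0⟩⟩

theorem zero_apply (y : Vertex d) : (0 : Config E d) y = 0 := rfl

/-- The integral of `g` for the gradient reference measure on `Λ` with reference vertex `x`. -/
def refIntegral (Λ : Finset (Vertex d)) (x : Vertex d) (g : Config E d → ℝ≥0∞) : ℝ≥0∞ :=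
  integrateOut (Λ.erase x) g 0

theorem lintegral_gradRefMeasure (Λ : Finset (Vertex d)) (x : Vertex d)
    {g : Config E d → ℝ≥0∞} (hg : Measurable[gradAlg E (Λ : Set (Vertex d))] g) :
    @lintegral _ (gradAlg E (Λ : Set (Vertex d))) (gradRefMeasure E Λ x) g =
      refIntegral Λ x g := by
  rw [gradRefMeasure, @lintegral_map _ _ _ (gradAlg E (Λ : Set (Vertex d))) _ _ _ hg
    (measurable_extendZero _ _)]
  rfl

/-- If `g` depends only on height differences in `Λ`, then integrating it over all heights but one
gives a constant. -/
theorem integrateOut_erase {Λ : Finset (Vertex d)} {x : Vertex d} (hx : x ∈ Λ)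
    {g : Config E d → ℝ≥0∞} (hg : Measurable[gradAlg E (Λ : Set (Vertex d))] g)
    (φ : Config E d) : integrateOut (Λ.erase x) g φ = refIntegral Λ x g := by
  -- Translate the integration variables by `φ x`: on `Λ` the configuration is then that of the
  -- reference integral plus the constant `φ x`.
  rw [integrateOut_add_const _ φ (φ x), refIntegral, integrateOut]
  refine lintegral_congr fun ψ => gradAlg_congr_const hg (φ x) fun y hy => ?_
  by_cases h : y = x
  · subst h
    rw [glue_apply_notMem _ _ (Finset.notMem_erase y Λ),
      glue_apply_notMem _ _ (Finset.notMem_erase y Λ), zero_apply, zero_add]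
  · have h1 : y ∈ Λ.erase x := Finset.mem_erase.2 ⟨h, hy⟩
    rw [glue_apply_mem _ _ h1, glue_apply_mem _ _ h1]

/-- With `x` pinned at `0` and `y` at `-c`, adding `c` everywhere pins `y` at `0` and `x` at `c`.
The reference measure is invariant under the reflection of `c` and the translation of the remaining
heights. -/
theorem refIntegral_base {Λ : Finset (Vertex d)} {x y : Vertex d} (hx : x ∈ Λ) (hy : y ∈ Λ)
    {g : Config E d → ℝ≥0∞} (hg : Measurable[gradAlg E (Λ : Set (Vertex d))] g) :
    refIntegral Λ x g = refIntegral Λ y g := by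
  by_cases hxy : x = y
  · rw [hxy]
  set t := (Λ.erase x).erase y with ht
  have hxt : x ∉ t := by simp [t]
  have hyt : y ∉ t := by simp [t]
  have h1 : Λ.erase x = insert y t :=
    (Finset.insert_erase (Finset.mem_erase.2 ⟨Ne.symm hxy, hy⟩)).symm
  have h2 : Λ.erase y = insert x t := by
    rw [ht, Finset.erase_right_comm,
      Finset.insert_erase (Finset.mem_erase.2 ⟨hxy, hx⟩)]
  have hgm := heightMeasurable_of_gradAlg hg
  rw [refIntegral, refIntegral, h1, h2, integrateOut_insert hyt hgm,
    integrateOut_insert hxt hgm, ← lintegral_neg_eq_self]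
  refine lintegral_congr fun c => ?_
  rw [integrateOut_add_const t _ (-c), integrateOut]
  refine lintegral_congr fun ψ => gradAlg_congr_const hg (-c) fun z hz => ?_
  by_cases hzt : z ∈ t
  · rw [glue_apply_mem _ _ hzt, glue_apply_mem _ _ hzt]
  · rw [glue_apply_notMem _ _ hzt, glue_apply_notMem _ _ hzt]
    have h3 : z = x ∨ z = y := by
      by_contra! h4
      exact hzt (Finset.mem_erase.2 ⟨h4.2, Finset.mem_erase.2 ⟨h4.1, hz⟩⟩)
    rcases h3 with rfl | rfl
    · simp [setAt, hxy, zero_apply]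
    · simp [setAt, Ne.symm hxy, zero_apply]

theorem gradRefMeasure_base {Λ : Finset (Vertex d)} {x y : Vertex d} (hx : x ∈ Λ) (hy : y ∈ Λ) :
    gradRefMeasure E Λ x = gradRefMeasure E Λ y := by
  let m := gradAlg E (Λ : Set (Vertex d))
  refine Measure.ext fun A hA => ?_
  have hm : Measurable[m] (A.indicator (1 : Config E d → ℝ≥0∞)) :=
    Measurable.indicator measurable_const hA
  rw [← lintegral_indicator_one hA, ← lintegral_indicator_one hA, lintegral_gradRefMeasure _ _ hm,
    lintegral_gradRefMeasure _ _ hm, refIntegral_base hx hy hm]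

theorem sigmaFinite_gradRefMeasure {Λ : Finset (Vertex d)} {x : Vertex d} (hx : x ∈ Λ) :
    @SigmaFinite _ (gradAlg E (Λ : Set (Vertex d))) (gradRefMeasure E Λ x) := by
  let := gradAlg E (Λ : Set (Vertex d))
  have hm : Measurable (fun (φ : Config E d) (y : Λ.erase x) => φ y - φ x) :=
    measurable_pi_iff.2 fun y =>
      measurable_config_iff.1 (measurable_id (α := Config E d)) x hx y
        (Finset.mem_of_mem_erase y.2)
  refine SigmaFinite.of_map _ hm.aemeasurable ?_
  rw [map_gradRefMeasure Λ x hx]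
  infer_instance

/-- Factorization of the gradient reference measure on a disjoint union. -/
theorem refIntegral_union {Λ Δ : Finset (Vertex d)} (hd : Disjoint Λ Δ) {x b y : Vertex d}
    (hx : x ∈ Λ) (hb : b ∈ Λ) (hy : y ∈ Δ) {g h : Config E d → ℝ≥0∞}
    (hg : Measurable[gradAlg E (Λ : Set (Vertex d))] g)
    (hh : Measurable[gradAlg E (Δ : Set (Vertex d))] h)
    {k : E → ℝ≥0∞} (hk : Measurable k) :
    refIntegral (Λ ∪ Δ) x (fun φ => g φ * (k (φ y - φ b) * h φ)) =
      refIntegral Λ x g * (refIntegral Δ y h * ∫⁻ t, k t ∂E.refMeasure) := by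
  have hxΔ : x ∉ Δ := Finset.disjoint_left.1 hd hx
  have hbΔ : b ∉ Δ := Finset.disjoint_left.1 hd hb
  have hgm := heightMeasurable_of_gradAlg hg
  have hhm := heightMeasurable_of_gradAlg hh
  have hkm : HeightMeasurable fun φ : Config E d => k (φ y - φ b) :=
    hk.comp ((measurable_pi_apply y).sub (measurable_pi_apply b))
  have e1 : (Λ ∪ Δ).erase x = Λ.erase x ∪ Δ := by
    rw [Finset.erase_union_distrib, Finset.erase_eq_of_notMem hxΔ]
  have hd' : Disjoint (Λ.erase x) Δ := Finset.disjoint_of_subset_left (Finset.erase_subset _ _) hd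
  -- Integrate the height at `y` last. The other heights of `Δ` enter `h` only relative to it and
  -- yield a constant; the remaining integral of `k (c - φ b)` over `c` is translation invariant.
  have inner : ∀ φ : Config E d, integrateOut Δ (fun φ => k (φ y - φ b) * h φ) φ =
      refIntegral Δ y h * ∫⁻ t, k t ∂E.refMeasure := by
    intro φ
    have h2 : insert y (Δ.erase y) = Δ := Finset.insert_erase hy
    have h3 : integrateOut Δ (fun φ => k (φ y - φ b) * h φ) φ =
        integrateOut (insert y (Δ.erase y)) (fun φ => k (φ y - φ b) * h φ) φ := by rw [h2]
    have hby : b ≠ y := fun e => hbΔ (e ▸ hy)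
    rw [h3, integrateOut_insert (Finset.notMem_erase y Δ) (hkm.mul hhm)]
    have h4 : ∀ c : E, integrateOut (Δ.erase y) (fun φ => k (φ y - φ b) * h φ) (setAt φ y c) =
        refIntegral Δ y h * k (c - φ b) := by
      intro c
      rw [integrateOut_mul_left (F := fun φ : Config E d => k (φ y - φ b)) hhm, integrateOut_erase hy hh,
        mul_comm]
      · simp [setAt, hby]
      · intro ψ
        rw [glue_apply_notMem _ _ (Finset.notMem_erase y Δ),
          glue_apply_notMem _ _ (fun h => hbΔ (Finset.mem_of_mem_erase h))]
    simp_rw [h4]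
    rw [lintegral_const_mul _ (show Measurable fun c => k (c - φ b) from
      hk.comp (measurable_id.sub measurable_const))]
    congr 1
    simp_rw [sub_eq_add_neg]
    exact lintegral_add_right_eq_self k (-φ b)
  rw [refIntegral, e1, integrateOut_union hd' (hgm.mul (hkm.mul hhm))]
  have h5 : ∀ φ : Config E d, integrateOut Δ (fun φ => g φ * (k (φ y - φ b) * h φ)) φ =
      (refIntegral Δ y h * ∫⁻ t, k t ∂E.refMeasure) * g φ := by
    intro φ
    rw [integrateOut_mul_left (hkm.mul hhm), inner, mul_comm]
    intro ψ
    refine gradAlg_congr_const hg 0 fun z hz => ?_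
    rw [glue_apply_notMem _ _ (Finset.disjoint_left.1 hd hz), add_zero]
  rw [funext h5, integrateOut_const_mul _ hgm, mul_comm]
  rfl

theorem refIntegral_mono {Λ : Finset (Vertex d)} {x : Vertex d} {g h : Config E d → ℝ≥0∞}
    (hgh : ∀ φ, g φ ≤ h φ) : refIntegral Λ x g ≤ refIntegral Λ x h :=
  integrateOut_mono hgh 0

theorem refIntegral_const_mul {Λ : Finset (Vertex d)} {x : Vertex d} {g : Config E d → ℝ≥0∞}
    (hg : HeightMeasurable g) (c : ℝ≥0∞) :
    refIntegral Λ x (fun φ => c * g φ) = c * refIntegral Λ x g :=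
  integrateOut_const_mul c hg 0

end

section
/-! ### Boltzmann weights -/

/-- `Φ` is the sum of the strong interaction `Ψ` and the weak interaction `Ξ`, and `C` bounds the
total weak interaction of a vertex. -/
structure IsSplit (L : AddSubgroup (Vertex d)) (A : SimpleGraph (Vertex d))
    (q : Vertex d → Vertex d → ℝ) (Φ Ψ Ξ : GradPotential E d) (C : ℝ) : Prop where
  strong : IsStrong L A q Ψ
  weak : IsWeak L Ξ
  eq_add : ∀ Λ φ, Φ Λ φ = Ψ Λ φ + Ξ Λ φ
  nonneg : 0 ≤ C
  bound : ∀ x φ, ∑' Λ : {Λ : Finset (Vertex d) // x ∈ Λ}, (Ξ Λ φ).abs ≤ ENNReal.ofReal C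

theorem IsStrongPlusWeak.exists_isSplit {L : AddSubgroup (Vertex d)}
    {A : SimpleGraph (Vertex d)} {q : Vertex d → Vertex d → ℝ} {Φ : GradPotential E d}
    (h : IsStrongPlusWeak L A q Φ) : ∃ Ψ Ξ C, IsSplit L A q Φ Ψ Ξ C := by
  obtain ⟨Ψ, Ξ, h1, h2, h3⟩ := h
  refine ⟨Ψ, Ξ, (⨆ (x : Vertex d) (φ : Config E d),
    ∑' Λ : {Λ : Finset (Vertex d) // x ∈ Λ}, (Ξ Λ φ).abs).toReal, h1, h2, h3,
    ENNReal.toReal_nonneg, fun x φ => ?_⟩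
  rw [ENNReal.ofReal_toReal h2.summable.ne]
  exact le_iSup₂ (f := fun (x : Vertex d) (φ : Config E d) =>
    ∑' Λ : {Λ : Finset (Vertex d) // x ∈ Λ}, (Ξ Λ φ).abs) x φ

/-- The nonempty subsets of `Λ`. -/
def subsets (Λ : Finset (Vertex d)) : Finset (Finset (Vertex d)) :=
  Λ.powerset.filter fun Γ => Γ.Nonempty

theorem mem_subsets {Λ Γ : Finset (Vertex d)} : Γ ∈ subsets Λ ↔ Γ ⊆ Λ ∧ Γ.Nonempty := by
  simp [subsets]

/-- The Boltzmann weight of the interior Hamiltonian. -/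
def weight (Φ : GradPotential E d) (Λ : Finset (Vertex d)) (φ : Config E d) : ℝ≥0∞ :=
  EReal.exp (-Φ.interiorHamiltonian Λ φ)

theorem measurable_weight (Φ : GradPotential E d) (Λ : Finset (Vertex d)) :
    Measurable[gradAlg E (Λ : Set (Vertex d))] (weight Φ Λ) := by
  let m := gradAlg E (Λ : Set (Vertex d))
  have h : Measurable[m] (Φ.interiorHamiltonian Λ) := by
    refine Finset.measurable_fun_sum _ fun Γ hΓ => ?_
    have h1 : (Γ : Set (Vertex d)) ⊆ Λ := by exact_mod_cast (mem_subsets.1 hΓ).1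
    exact (Φ.measurable Γ).mono (gradAlg_mono h1) le_rfl
  exact h.neg.ereal_exp

/-- The part of the Hamiltonian which comes from the strong interaction. -/
def strongPart (Ψ : GradPotential E d) (s : Finset (Finset (Vertex d))) (φ : Config E d) : ℝ≥0∞ :=
  ∑ Γ ∈ s, (Ψ Γ φ).toENNReal

/-- The part of the Hamiltonian which comes from the weak interaction. -/
def weakPart (Ξ : GradPotential E d) (s : Finset (Finset (Vertex d))) (φ : Config E d) : ℝ :=
  ∑ Γ ∈ s, (Ξ Γ φ).toReal

theorem EReal_exp_neg_antitone {a b : ℝ≥0∞} (h : a ≤ b) :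
    EReal.exp (-(b : EReal)) ≤ EReal.exp (-(a : EReal)) :=
  EReal.exp_monotone (EReal.neg_le_neg_iff.2 (EReal.coe_ennreal_le_coe_ennreal_iff.2 h))

theorem EReal_exp_neg_add (a b : ℝ≥0∞) :
    EReal.exp (-((a + b : ℝ≥0∞) : EReal)) = EReal.exp (-(a : EReal)) * EReal.exp (-(b : EReal)) := by
  rw [← EReal.exp_add, EReal.coe_ennreal_add, EReal.neg_add (.inl (EReal.coe_ennreal_ne_bot _))
    (.inr (EReal.coe_ennreal_ne_bot _)), sub_eq_add_neg]

theorem EReal_exp_neg_ofReal {c : ℝ} (hc : 0 ≤ c) :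
    EReal.exp (-((ENNReal.ofReal c : ℝ≥0∞) : EReal)) = ENNReal.ofReal (Real.exp (-c)) := by
  rw [EReal.coe_ennreal_ofReal, max_eq_left hc, ← EReal.coe_neg, EReal.exp_coe]

theorem sum_le_tsum_subtype {α : Type*} (f : α → ℝ≥0∞) {p : α → Prop} (s : Finset α)
    (h : ∀ a ∈ s, p a) : ∑ a ∈ s, f a ≤ ∑' a : {a // p a}, f a := by
  classical
  have h1 : ∑ a ∈ s, f a = ∑ a ∈ s.subtype p, f a := by
    rw [Finset.sum_subtype_of_mem f h]
  rw [h1]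
  exact ENNReal.sum_le_tsum (f := fun a : {a // p a} => f a) _

theorem abs_weakPart_le (Ξ : GradPotential E d) (s : Finset (Finset (Vertex d)))
    (φ : Config E d) {c : ℝ} (hc : 0 ≤ c) (h : ∑ Γ ∈ s, (Ξ Γ φ).abs ≤ ENNReal.ofReal c) :
    |weakPart Ξ s φ| ≤ c := by
  have h1 : ∀ Γ ∈ s, (Ξ Γ φ).abs ≠ ⊤ := fun Γ hΓ =>
    ne_top_of_le_ne_top ENNReal.ofReal_ne_top
      ((Finset.single_le_sum (f := fun Γ => (Ξ Γ φ).abs) (fun _ _ => zero_le) hΓ).trans h)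
  have h2 : ∀ Γ ∈ s, ENNReal.ofReal |(Ξ Γ φ).toReal| = (Ξ Γ φ).abs := by
    intro Γ hΓ
    have h3 := h1 Γ hΓ
    generalize Ξ Γ φ = a at h3
    induction a with
    | bot => simp at h3
    | top => simp at h3
    | coe a => rw [EReal.abs_def, EReal.toReal_coe]
  refine (Finset.abs_sum_le_sum_abs _ _).trans ?_
  rw [← ENNReal.ofReal_le_ofReal_iff hc, ENNReal.ofReal_sum_of_nonneg fun _ _ => abs_nonneg _,
    Finset.sum_congr rfl h2]
  exact h

namespace IsSplit

variable {L : AddSubgroup (Vertex d)} {A : SimpleGraph (Vertex d)} {q : Vertex d → Vertex d → ℝ}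
  {Φ Ψ Ξ : GradPotential E d} {C : ℝ}

/-- The bound `C` is attached to a vertex, so it says something about `Γ` only if `Γ` contains one.
-/
theorem abs_ne_top (H : IsSplit L A q Φ Ψ Ξ C) {Γ : Finset (Vertex d)} (hΓ : Γ.Nonempty)
    (φ : Config E d) : (Ξ Γ φ).abs ≠ ⊤ := by
  obtain ⟨x, hx⟩ := hΓ
  refine ne_top_of_le_ne_top ENNReal.ofReal_ne_top (le_trans ?_ (H.bound x φ))
  exact ENNReal.le_tsum (f := fun Λ : {Λ : Finset (Vertex d) // x ∈ Λ} => (Ξ Λ φ).abs) ⟨Γ, hx⟩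

/-- The infinities of the Hamiltonian all sit in the nonnegative strong part, the weak part being a
real number; the sum in `EReal` is therefore unambiguous. -/
theorem interiorHamiltonian_eq (H : IsSplit L A q Φ Ψ Ξ C) (Λ : Finset (Vertex d))
    (φ : Config E d) : Φ.interiorHamiltonian Λ φ =
      ((strongPart Ψ (subsets Λ) φ : ℝ≥0∞) : EReal) +
        ((weakPart Ξ (subsets Λ) φ : ℝ) : EReal) := by
  have key : ∀ s : Finset (Finset (Vertex d)), (∀ Γ ∈ s, Γ.Nonempty) →
      ∑ Γ ∈ s, Φ Γ φ = ((strongPart Ψ s φ : ℝ≥0∞) : EReal) + ((weakPart Ξ s φ : ℝ) : EReal) := by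
    intro s
    induction s using Finset.induction_on with
    | empty => intro; simp [strongPart, weakPart]
    | insert Γ s hΓ ih =>
      intro hs
      have h1 : ((Ξ Γ φ).toReal : EReal) = Ξ Γ φ := by
        have h3 := H.abs_ne_top (hs Γ (Finset.mem_insert_self _ _)) φ
        refine EReal.coe_toReal ?_ ?_ <;> intro h4 <;> simp [h4] at h3
      have h2 : ((Ψ Γ φ).toENNReal : EReal) = Ψ Γ φ := EReal.coe_toENNReal (H.strong.nonneg Γ φ)
      rw [Finset.sum_insert hΓ, ih fun Γ' h => hs Γ' (Finset.mem_insert_of_mem h), H.eq_add,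
        strongPart, strongPart, weakPart, weakPart, Finset.sum_insert hΓ, Finset.sum_insert hΓ,
        EReal.coe_ennreal_add, EReal.coe_add, h1, h2]
      exact add_add_add_comm _ _ _ _
  exact key _ fun Γ hΓ => (mem_subsets.1 hΓ).2

theorem weight_eq (H : IsSplit L A q Φ Ψ Ξ C) (Λ : Finset (Vertex d)) (φ : Config E d) :
    weight Φ Λ φ = EReal.exp (-(strongPart Ψ (subsets Λ) φ : EReal)) *
      ENNReal.ofReal (Real.exp (-weakPart Ξ (subsets Λ) φ)) := by
  rw [weight, H.interiorHamiltonian_eq, EReal.neg_add (.inr (EReal.coe_ne_top _))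
    (.inr (EReal.coe_ne_bot _)), sub_eq_add_neg, EReal.exp_add, ← EReal.coe_neg, EReal.exp_coe]

theorem weight_ne_top (H : IsSplit L A q Φ Ψ Ξ C) (Λ : Finset (Vertex d)) (φ : Config E d) :
    weight Φ Λ φ ≠ ⊤ := by
  rw [H.weight_eq]
  refine ENNReal.mul_ne_top ?_ ENNReal.ofReal_ne_top
  rw [Ne, EReal.exp_eq_top_iff]
  simp

/-- The weak interactions of the sets that meet `Δ`. -/
theorem sum_abs_le (H : IsSplit L A q Φ Ψ Ξ C) (Δ : Finset (Vertex d))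
    (s : Finset (Finset (Vertex d))) (hs : ∀ Γ ∈ s, ∃ x ∈ Γ, x ∈ Δ) (φ : Config E d) :
    ∑ Γ ∈ s, (Ξ Γ φ).abs ≤ ENNReal.ofReal (C * Δ.card) := by
  calc ∑ Γ ∈ s, (Ξ Γ φ).abs
      ≤ ∑ Γ ∈ s, ∑ x ∈ Δ, if x ∈ Γ then (Ξ Γ φ).abs else 0 := by
        refine Finset.sum_le_sum fun Γ hΓ => ?_
        obtain ⟨x, hx, hxΔ⟩ := hs Γ hΓ
        refine le_trans ?_ (Finset.single_le_sum
          (f := fun x => if x ∈ Γ then (Ξ Γ φ).abs else 0) (fun _ _ => zero_le) hxΔ)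
        simp [hx]
    _ = ∑ x ∈ Δ, ∑ Γ ∈ s with x ∈ Γ, (Ξ Γ φ).abs := by
        rw [Finset.sum_comm]
        simp_rw [Finset.sum_filter]
    _ ≤ ∑ x ∈ Δ, ENNReal.ofReal C := by
        refine Finset.sum_le_sum fun x _ => le_trans ?_ (H.bound x φ)
        exact sum_le_tsum_subtype (fun Γ => (Ξ Γ φ).abs) _ fun Γ hΓ => (Finset.mem_filter.1 hΓ).2
    _ = ENNReal.ofReal (C * Δ.card) := by
        rw [Finset.sum_const, nsmul_eq_mul, mul_comm, ENNReal.ofReal_mul H.nonneg,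
          ENNReal.ofReal_natCast]

/-- The strong energy is nonnegative, and the weak energy is at least `-C` per vertex. -/
theorem weight_le (H : IsSplit L A q Φ Ψ Ξ C) (Λ : Finset (Vertex d)) (φ : Config E d) :
    weight Φ Λ φ ≤ ENNReal.ofReal (Real.exp (C * Λ.card)) := by
  have h1 : |weakPart Ξ (subsets Λ) φ| ≤ C * Λ.card :=
    abs_weakPart_le _ _ _ (mul_nonneg H.nonneg (Nat.cast_nonneg _)) (H.sum_abs_le Λ _ (fun Γ hΓ => by
      obtain ⟨h1, x, hx⟩ := mem_subsets.1 hΓ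
      exact ⟨x, hx, h1 hx⟩) φ)
  rw [H.weight_eq]
  refine (mul_le_mul' (EReal_exp_neg_antitone (zero_le (a := _))) (ENNReal.ofReal_le_ofReal
    (Real.exp_le_exp.2 (neg_le.1 (abs_le.1 h1).1)))).trans ?_
  simp

/-- A set inside `Λ ∪ Δ` that lies in neither piece meets both. For such sets the strong terms are
nonnegative and can only lower the weight, and the weak terms are part of the sum that defines
`lowerExteriorBound Ξ Δ`. -/
theorem weight_union_le (H : IsSplit L A q Φ Ψ Ξ C) {Λ Δ : Finset (Vertex d)}
    (hd : Disjoint Λ Δ) (φ : Config E d) :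
    weight Φ (Λ ∪ Δ) φ ≤ ENNReal.ofReal (Real.exp (lowerExteriorBound Ξ Δ).toReal) *
      (weight Φ Λ φ * weight Φ Δ φ) := by
  have hdis : Disjoint (subsets Λ) (subsets Δ) := by
    refine Finset.disjoint_left.2 fun Γ h1 h2 => ?_
    obtain ⟨h3, x, hx⟩ := mem_subsets.1 h1
    exact Finset.disjoint_left.1 hd (h3 hx) ((mem_subsets.1 h2).1 hx)
  set P := subsets Λ ∪ subsets Δ with hP
  have hsub : P ⊆ subsets (Λ ∪ Δ) := by
    intro Γ hΓ
    rw [mem_subsets]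
    rcases Finset.mem_union.1 hΓ with h | h
    · exact ⟨(mem_subsets.1 h).1.trans Finset.subset_union_left, (mem_subsets.1 h).2⟩
    · exact ⟨(mem_subsets.1 h).1.trans Finset.subset_union_right, (mem_subsets.1 h).2⟩
  have hs : strongPart Ψ (subsets Λ) φ + strongPart Ψ (subsets Δ) φ ≤
      strongPart Ψ (subsets (Λ ∪ Δ)) φ := by
    rw [strongPart, strongPart, ← Finset.sum_union hdis]
    exact Finset.sum_le_sum_of_subset hsub
  have hw1 : weakPart Ξ (subsets (Λ ∪ Δ)) φ = weakPart Ξ (subsets (Λ ∪ Δ) \ P) φ +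
      (weakPart Ξ (subsets Λ) φ + weakPart Ξ (subsets Δ) φ) := by
    simp only [weakPart]
    rw [← Finset.sum_union hdis, Finset.sum_sdiff hsub]
  have hw2 : |weakPart Ξ (subsets (Λ ∪ Δ) \ P) φ| ≤ (lowerExteriorBound Ξ Δ).toReal := by
    refine abs_weakPart_le _ _ _ ENNReal.toReal_nonneg ?_
    rw [ENNReal.ofReal_toReal (H.weak.amenable.ne_top Δ)]
    refine le_trans ?_ (le_iSup (fun φ : Config E d =>
      ∑' Γ : {Γ : Finset (Vertex d) // (∃ x ∈ Γ, x ∈ Δ) ∧ ∃ x ∈ Γ, x ∉ Δ}, (Ξ Γ φ).abs) φ)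
    refine sum_le_tsum_subtype (fun Γ => (Ξ Γ φ).abs) _ fun Γ hΓ => ?_
    obtain ⟨h1, h2⟩ := Finset.mem_sdiff.1 hΓ
    obtain ⟨h3, h4⟩ := mem_subsets.1 h1
    rw [hP, Finset.mem_union, mem_subsets, mem_subsets] at h2
    constructor
    · by_contra! h5
      refine h2 (.inl ⟨fun x hx => ?_, h4⟩)
      exact (Finset.mem_union.1 (h3 hx)).resolve_right (h5 x hx)
    · by_contra! h5
      exact h2 (.inr ⟨h5, h4⟩)
  rw [H.weight_eq, H.weight_eq, H.weight_eq]
  calc EReal.exp (-(strongPart Ψ (subsets (Λ ∪ Δ)) φ : EReal)) *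
        ENNReal.ofReal (Real.exp (-weakPart Ξ (subsets (Λ ∪ Δ)) φ))
      ≤ EReal.exp (-((strongPart Ψ (subsets Λ) φ + strongPart Ψ (subsets Δ) φ : ℝ≥0∞) : EReal)) *
        ENNReal.ofReal (Real.exp ((lowerExteriorBound Ξ Δ).toReal +
          (-weakPart Ξ (subsets Λ) φ + -weakPart Ξ (subsets Δ) φ))) := by
        refine mul_le_mul' (EReal_exp_neg_antitone hs)
          (ENNReal.ofReal_le_ofReal (Real.exp_le_exp.2 ?_))
        have := (abs_le.1 hw2).1
        linarith
    _ = _ := by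
        rw [EReal_exp_neg_add, Real.exp_add, Real.exp_add,
          ENNReal.ofReal_mul (Real.exp_nonneg _), ENNReal.ofReal_mul (Real.exp_nonneg _)]
        ring

/-- The cost of changing the heights in `Δ`. -/
theorem weight_le_of_eq_off (H : IsSplit L A q Φ Ψ Ξ C) {Λ Δ : Finset (Vertex d)}
    {φ χ : Config E d} (hφ : ∀ y ∉ Δ, φ y = χ y) {c : ℝ} (hc : 0 ≤ c)
    (hχ : strongPart Ψ ((subsets Λ).filter fun Γ => ∃ x ∈ Γ, x ∈ Δ) χ ≤ ENNReal.ofReal c) :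
    weight Φ Λ φ ≤ ENNReal.ofReal (Real.exp (c + 2 * (C * Δ.card))) * weight Φ Λ χ := by
  set P := (subsets Λ).filter fun Γ => ∃ x ∈ Γ, x ∈ Δ with hP
  set Q := (subsets Λ).filter fun Γ => ¬ ∃ x ∈ Γ, x ∈ Δ with hQ
  have hloc : ∀ (Θ : GradPotential E d), ∀ Γ ∈ Q, Θ Γ φ = Θ Γ χ := by
    intro Θ Γ hΓ
    refine gradAlg_congr_const (Θ.measurable Γ) 0 fun x hx => ?_
    rw [add_zero]
    exact hφ x fun hxΔ => (Finset.mem_filter.1 hΓ).2 ⟨x, hx, hxΔ⟩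
  have hs1 : ∀ ω : Config E d, strongPart Ψ (subsets Λ) ω = strongPart Ψ P ω + strongPart Ψ Q ω :=
    fun ω => (Finset.sum_filter_add_sum_filter_not _ _ _).symm
  have hw1 : ∀ ω : Config E d, weakPart Ξ (subsets Λ) ω = weakPart Ξ P ω + weakPart Ξ Q ω :=
    fun ω => (Finset.sum_filter_add_sum_filter_not _ _ _).symm
  have hs2 : strongPart Ψ Q φ = strongPart Ψ Q χ :=
    Finset.sum_congr rfl fun Γ hΓ => by rw [hloc Ψ Γ hΓ]
  have hw2 : weakPart Ξ Q φ = weakPart Ξ Q χ :=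
    Finset.sum_congr rfl fun Γ hΓ => by rw [hloc Ξ Γ hΓ]
  have hw3 : ∀ ω : Config E d, |weakPart Ξ P ω| ≤ C * Δ.card := fun ω =>
    abs_weakPart_le _ _ _ (mul_nonneg H.nonneg (Nat.cast_nonneg _))
      (H.sum_abs_le Δ _ (fun Γ hΓ => (Finset.mem_filter.1 hΓ).2) ω)
  -- Only the strong energy of `χ` near `Δ` needs an upper bound, since that of `φ` is nonnegative.
  -- The weak energy near `Δ` is paid for twice, once for `φ` and once for `χ`.
  have hs3 : strongPart Ψ (subsets Λ) χ ≤ ENNReal.ofReal c + strongPart Ψ (subsets Λ) φ := by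
    rw [hs1 χ, hs1 φ, hs2]
    exact add_le_add hχ le_add_self
  have h1 := EReal_exp_neg_antitone hs3
  rw [EReal_exp_neg_add, EReal_exp_neg_ofReal hc] at h1
  have h2 : EReal.exp (-(strongPart Ψ (subsets Λ) φ : EReal)) ≤
      ENNReal.ofReal (Real.exp c) * EReal.exp (-(strongPart Ψ (subsets Λ) χ : EReal)) := by
    refine le_trans (le_of_eq ?_) (mul_le_mul_right h1 _)
    rw [← mul_assoc, ← ENNReal.ofReal_mul (Real.exp_nonneg _), ← Real.exp_add, add_neg_cancel,
      Real.exp_zero, ENNReal.ofReal_one, one_mul]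
  rw [H.weight_eq, H.weight_eq]
  calc _ ≤ (ENNReal.ofReal (Real.exp c) * EReal.exp (-(strongPart Ψ (subsets Λ) χ : EReal))) *
        ENNReal.ofReal (Real.exp (2 * (C * Δ.card) + -weakPart Ξ (subsets Λ) χ)) := by
        refine mul_le_mul' h2 (ENNReal.ofReal_le_ofReal (Real.exp_le_exp.2 ?_))
        rw [hw1 φ, hw1 χ, hw2]
        have := (abs_le.1 (hw3 φ)).1
        have := (abs_le.1 (hw3 χ)).2
        linarith
    _ = _ := by
        rw [Real.exp_add, Real.exp_add, ENNReal.ofReal_mul (Real.exp_nonneg _),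
          ENNReal.ofReal_mul (Real.exp_nonneg _)]
        ring

theorem edge_of_strong_ne_top (H : IsSplit L A q Φ Ψ Ξ C) {φ : Config E d} {x y : Vertex d}
    (hA : A.Adj x y) (h : Ψ {x, y} φ ≠ ⊤) : E.toReal (φ y) - E.toReal (φ x) ≤ q x y := by
  by_contra! h1
  exact h ((H.strong.lipschitz _ _).2 ⟨x, y, hA, rfl, h1⟩)

/-- A violated edge inside `Λ` makes the strong energy infinite and kills the weight. -/
theorem edge_of_weight_ne_zero (H : IsSplit L A q Φ Ψ Ξ C) {Λ : Finset (Vertex d)}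
    {φ : Config E d} (h : weight Φ Λ φ ≠ 0) {x y : Vertex d} (hx : x ∈ Λ) (hy : y ∈ Λ)
    (hA : A.Adj x y) : E.toReal (φ y) - E.toReal (φ x) ≤ q x y := by
  refine H.edge_of_strong_ne_top hA fun h1 => h ?_
  have h2 : strongPart Ψ (subsets Λ) φ = ⊤ := by
    refine ENNReal.sum_eq_top.2 ⟨{x, y}, mem_subsets.2 ⟨?_, ⟨x, by simp⟩⟩, by simp [h1]⟩
    intro z hz
    rcases Finset.mem_insert.1 hz with rfl | h
    · exact hx
    · rwa [Finset.mem_singleton.1 h]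
  rw [H.weight_eq, h2]
  simp

end IsSplit

end

section
/-! ### Bounded height differences -/

theorem toReal_sub (a b : E) : E.toReal (a - b) = E.toReal a - E.toReal b :=
  match E, a, b with
  | .int, a, b => Int.cast_sub (R := ℝ) a b
  | .real, _, _ => rfl

theorem toReal_zero : E.toReal 0 = 0 := by
  have h := toReal_sub (0 : E) 0
  rwa [sub_zero, sub_self] at h

theorem toReal_neg (a : E) : E.toReal (-a) = -E.toReal a := by
  have h := toReal_sub (0 : E) a
  rwa [zero_sub, toReal_zero, zero_sub] at h

theorem toReal_add (a b : E) : E.toReal (a + b) = E.toReal a + E.toReal b := by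
  have h := toReal_sub a (-b)
  rwa [sub_neg_eq_add, toReal_neg, sub_neg_eq_add] at h

theorem measurable_toReal (E : HeightSpace) : Measurable E.toReal :=
  match E with
  | .int => measurable_from_top (α := ℤ)
  | .real => measurable_id

/-- The heights of absolute value at most `r`. -/
def heightBall (E : HeightSpace) (r : ℝ) : Set E := {t | |E.toReal t| ≤ r}

theorem measurableSet_heightBall (E : HeightSpace) (r : ℝ) : MeasurableSet (heightBall E r) :=
  measurableSet_le (continuous_abs.measurable.comp (measurable_toReal E)) measurable_const

theorem refMeasure_heightBall_lt_top (E : HeightSpace) (r : ℝ) :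
    E.refMeasure (heightBall E r) < ⊤ :=
  match E with
  | .int => by
    have h : ({t : ℤ | |(t : ℝ)| ≤ r}).Finite := by
      refine (Set.finite_Icc (-⌈r⌉) ⌈r⌉).subset fun t ht => ?_
      have h1 := abs_le.1 (show |(t : ℝ)| ≤ r from ht)
      have h2 := Int.le_ceil r
      constructor
      · have : (-⌈r⌉ : ℝ) ≤ t := by linarith
        exact_mod_cast this
      · have : (t : ℝ) ≤ ⌈r⌉ := by linarith
        exact_mod_cast this
    exact Measure.count_apply_lt_top.2 h
  | .real => by
    have h : heightBall .real r = Set.Icc (-r) r := by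
      ext t
      exact abs_le (G := ℝ)
    rw [h]
    exact (Real.volume_Icc (a := -r) (b := r)).symm ▸ ENNReal.ofReal_lt_top

/-- This is the source of arbitrarily spread-out proposals: the reference measure of balls is
unbounded. -/
theorem natCast_le_refMeasure_heightBall (E : HeightSpace) (n : ℕ) :
    (n : ℝ≥0∞) ≤ E.refMeasure (heightBall E n) :=
  match E with
  | .int => by
    have h : ((Finset.Ico (0 : ℤ) n : Finset ℤ) : Set ℤ) ⊆ heightBall .int n := by
      intro t ht
      have h1 := Finset.mem_Ico.1 (Finset.mem_coe.1 ht)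
      have h2 : (0 : ℝ) ≤ t := by exact_mod_cast h1.1
      have h3 : (t : ℝ) ≤ n := by exact_mod_cast h1.2.le
      exact (abs_of_nonneg h2).le.trans h3
    have h2 := measure_mono (μ := (Measure.count : Measure ℤ)) h
    rw [Measure.count_apply_finset] at h2
    refine le_trans (le_of_eq ?_) h2
    simp
  | .real => by
    have h : Set.Icc (0 : ℝ) n ⊆ heightBall .real n := fun t ht =>
      (abs_of_nonneg ht.1).le.trans ht.2
    have h2 := measure_mono (μ := (volume : Measure ℝ)) h
    rw [Real.volume_Icc] at h2
    refine le_trans (le_of_eq ?_) h2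
    simp

/-- A bound for the height difference between `x` and `y`. -/
def heightRange (q : Vertex d → Vertex d → ℝ) (x y : Vertex d) : ℝ := max (q x y) (q y x)

theorem sub_mem_heightBall {q : Vertex d → Vertex d → ℝ} {φ : Config E d}
    (h : φ ∈ lipschitzSet E q) (x y : Vertex d) : φ y - φ x ∈ heightBall E (heightRange q x y) := by
  rw [heightBall, Set.mem_ofPred_eq, toReal_sub, abs_le]
  have h1 := h x y
  have h2 := h y x
  have h3 := le_max_left (q x y) (q y x)
  have h4 := le_max_right (q x y) (q y x)
  rw [heightRange]
  constructor <;> linarith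

/-- The Lipschitz property follows from the constraint along the edges. -/
theorem lipschitz_of_edges {L : AddSubgroup (Vertex d)} {A : SimpleGraph (Vertex d)}
    {q : Vertex d → Vertex d → ℝ} (hq : IsLocalLipschitzConstraint L A q) {φ : Config E d}
    (h : ∀ x y, A.Adj x y → E.toReal (φ y) - E.toReal (φ x) ≤ q x y) :
    φ ∈ lipschitzSet E q := by
  set f : Vertex d → ℝ := fun x => E.toReal (φ x) with hf
  have hedge : ∀ x y, A.Adj x y → ∀ v : L, f (y + v) - f (x + v) ≤ q x y := by
    intro x y hA v
    rw [← hq.quasimetric.invariant v v.2]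
    exact h _ _ ((hq.graph.invariant v v.2 x y).2 hA)
  -- Add up the edge constraints along a path of `A`; by periodicity the resulting bound is the same
  -- for all translates of the path by `L`.
  have hbdd : ∀ x y, BddAbove (Set.range fun v : L => f (y + v) - f (x + v)) := by
    intro x y
    obtain ⟨w⟩ := hq.graph.connected.preconnected x y
    induction w with
    | nil => exact ⟨0, by rintro _ ⟨v, rfl⟩; simp⟩
    | @cons u v w hA _ ih =>
      obtain ⟨b, hb⟩ := ih
      refine ⟨q u v + b, ?_⟩
      rintro _ ⟨v, rfl⟩
      have h1 := hedge _ _ hA v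
      have h2 := hb ⟨v, rfl⟩
      simp only at h2 ⊢
      linarith
  set p : Vertex d → Vertex d → ℝ := fun x y => ⨆ v : L, (f (y + v) - f (x + v)) with hp
  have hle : ∀ x y (v : L), f (y + v) - f (x + v) ≤ p x y := fun x y v => le_ciSup (hbdd x y) v
  -- The supremum `p` over translates is an invariant quasimetric, but `p x y + p y x` may vanish.
  -- The maximum with `q` restores strict positivity and is still at most `q` on edges, so
  -- maximality of `q` applies to it.
  have hadm : IsAdmissibleQuasimetric L fun x y => max (q x y) (p x y) := by
    refine ⟨fun x => ?_, fun x y hxy => ?_, fun x y z => ?_, fun v hv x y => ?_⟩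
    · simp [hp, hq.quasimetric.self]
    · exact (hq.quasimetric.pos x y hxy).trans_le (add_le_add (le_max_left _ _) (le_max_left _ _))
    · refine max_le ((hq.quasimetric.triangle x y z).trans
        (add_le_add (le_max_left _ _) (le_max_left _ _))) ?_
      refine ciSup_le fun v => ?_
      have h1 := (hle x y v).trans (le_max_right (q x y) _)
      have h2 := (hle y z v).trans (le_max_right (q y z) _)
      linarith
    · have h1 : p (x + v) (y + v) = p x y := by
        have h2 := (Equiv.addLeft (⟨v, hv⟩ : L)).iSup_comp (g := fun w : L => f (y + w) - f (x + w))
        simp only [Equiv.coe_addLeft, AddSubgroup.coe_add, ← add_assoc] at h2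
        exact h2
      rw [h1, hq.quasimetric.invariant v hv]
  intro x y
  have h1 := hq.maximal _ hadm (fun x y hA => max_le le_rfl (ciSup_le fun v => hedge x y hA v)) x y
  have h2 := hle x y 0
  simp only [AddSubgroup.coe_zero, add_zero] at h2
  exact h2.trans ((le_max_right _ _).trans h1)

/-- A gradient probability measure which is supported on Lipschitz functions. -/
structure IsLipschitzMeasure (q : Vertex d → Vertex d → ℝ) (ν : Measure (Config E d)) : Prop where
  isProb : IsProbabilityMeasure ν
  ae_mem : ∀ᵐ φ ∂ν, φ ∈ lipschitzSet E q

/-! ### Densities -/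

/-- `f` is the density of `ν`, for the height differences in `Λ`, with respect to the gradient
reference measure weighted by the interior Hamiltonian. -/
structure HasDensity (Φ : GradPotential E d) (ν : Measure (Config E d)) (Λ : Finset (Vertex d))
    (f : Config E d → ℝ≥0∞) : Prop where
  measurable : Measurable[gradAlg E (Λ : Set (Vertex d))] f
  lintegral_eq : ∀ x ∈ Λ, ∀ g, Measurable[gradAlg E (Λ : Set (Vertex d))] g →
    ∫⁻ φ, g φ ∂ν = refIntegral Λ x fun φ => f φ * (weight Φ Λ φ * g φ)

/-- `h` is the free energy of `ν` in `Λ`, and it is finite. -/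
def HasFreeEnergy (Φ : GradPotential E d) (ν : Measure (Config E d)) (Λ : Finset (Vertex d))
    (h : ℝ) : Prop :=
  ∃ f, HasDensity Φ ν Λ f ∧ Integrable (fun φ => Real.log (f φ).toReal) ν ∧
    ∫ φ, Real.log (f φ).toReal ∂ν = h

section Density

variable {Φ : GradPotential E d} {ν : Measure (Config E d)} {Λ : Finset (Vertex d)}
  {f : Config E d → ℝ≥0∞}

theorem refIntegral_mul_eq_zero {x : Vertex d} {g h : Config E d → ℝ≥0∞}
    (hh : HeightMeasurable h) (h0 : refIntegral Λ x h = 0) :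
    refIntegral Λ x (fun φ => g φ * h φ) = 0 := by
  have h1 := (lintegral_eq_zero_iff (measurable_glue_height _ 0 hh)).1 h0
  refine (lintegral_congr_ae (g := fun _ => 0) ?_).trans lintegral_zero
  filter_upwards [h1] with ψ hψ
  rw [hψ, Pi.zero_apply, mul_zero]

/-- Together with `hasDensity_of_trim_eq` this translates between `HasDensity`, which tests against
gradient functions of `Λ` and hides the sub-sigma-algebra, and Radon–Nikodym densities of the
trimmed measure. -/
theorem HasDensity.trim_eq [IsProbabilityMeasure ν] (h : HasDensity Φ ν Λ f) {x : Vertex d}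
    (hx : x ∈ Λ) : ν.trim (gradAlg_le (Λ : Set (Vertex d))) =
      @Measure.withDensity _ (gradAlg E (Λ : Set (Vertex d)))
        (@Measure.withDensity _ (gradAlg E (Λ : Set (Vertex d))) (gradRefMeasure E Λ x)
          (weight Φ Λ)) f := by
  let m := gradAlg E (Λ : Set (Vertex d))
  refine @Measure.ext _ m _ _ fun S hS => ?_
  have hS1 : Measurable[m] (S.indicator (1 : Config E d → ℝ≥0∞)) :=
    Measurable.indicator measurable_const hS
  have hw := measurable_weight Φ Λ
  rw [trim_measurableSet_eq _ hS, ← lintegral_indicator_one (gradAlg_le _ S hS),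
    h.lintegral_eq x hx _ hS1, @withDensity_apply _ m _ _ _ hS,
    @setLIntegral_withDensity_eq_setLIntegral_mul _ m _ _ _ hw h.measurable _ hS,
    ← @lintegral_indicator _ m _ _ hS, lintegral_gradRefMeasure]
  · congr 1
    funext φ
    by_cases hφ : φ ∈ S <;> simp [hφ, mul_comm]
  · exact Measurable.indicator (Measurable.mul hw h.measurable) hS

theorem hasDensity_of_trim_eq {x : Vertex d} (hx : x ∈ Λ)
    (hf : Measurable[gradAlg E (Λ : Set (Vertex d))] f)
    (h : ν.trim (gradAlg_le (Λ : Set (Vertex d))) =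
      @Measure.withDensity _ (gradAlg E (Λ : Set (Vertex d)))
        (@Measure.withDensity _ (gradAlg E (Λ : Set (Vertex d))) (gradRefMeasure E Λ x)
          (weight Φ Λ)) f) : HasDensity Φ ν Λ f := by
  let m := gradAlg E (Λ : Set (Vertex d))
  refine ⟨hf, fun y hy g hg => ?_⟩
  have hw := measurable_weight Φ Λ
  rw [← lintegral_trim (gradAlg_le (Λ : Set (Vertex d))) hg, h, gradRefMeasure_base hx hy,
    @lintegral_withDensity_eq_lintegral_mul _ m _ _ hf _ hg,
    @lintegral_withDensity_eq_lintegral_mul _ m _ _ hw _ (Measurable.mul hf hg),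
    lintegral_gradRefMeasure _ _ (Measurable.mul hw (Measurable.mul hf hg))]
  congr 1
  funext φ
  simp only [Pi.mul_apply]
  ring

/-- Finiteness of the weight preserves sigma-finiteness, which the Radon–Nikodym theorem needs. -/
theorem sigmaFinite_weighted (hw : ∀ φ, weight Φ Λ φ ≠ ⊤) {x : Vertex d} (hx : x ∈ Λ) :
    @SigmaFinite _ (gradAlg E (Λ : Set (Vertex d)))
      (@Measure.withDensity _ (gradAlg E (Λ : Set (Vertex d))) (gradRefMeasure E Λ x)
        (weight Φ Λ)) := by
  let m := gradAlg E (Λ : Set (Vertex d))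
  have := sigmaFinite_gradRefMeasure (E := E) hx
  exact @SigmaFinite.withDensity_of_ne_top _ m _ _ _
    (Eventually.of_forall hw)

theorem HasDensity.freeEnergy_eq [IsProbabilityMeasure ν] (hw : ∀ φ, weight Φ Λ φ ≠ ⊤)
    (h : HasDensity Φ ν Λ f) {x : Vertex d} (hx : x ∈ Λ)
    (hi : Integrable (fun φ => Real.log (f φ).toReal) ν) :
    freeEnergy Φ ν Λ x = ((∫ φ, Real.log (f φ).toReal ∂ν : ℝ) : EReal) := by
  let m := gradAlg E (Λ : Set (Vertex d))
  have hlog : Measurable[m] fun φ => Real.log (f φ).toReal :=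
    Real.measurable_log.comp h.measurable.ennreal_toReal
  have := sigmaFinite_weighted hw hx
  have h1 := @relEntropy_withDensity _ m _ _ _ this f h.measurable (h.trim_eq hx)
    (hi.trim (gradAlg_le _) hlog.stronglyMeasurable)
  rw [← integral_trim (gradAlg_le _) hlog.stronglyMeasurable] at h1
  exact h1

theorem exists_hasDensity_of_freeEnergy_ne_top [IsProbabilityMeasure ν]
    (hw : ∀ φ, weight Φ Λ φ ≠ ⊤) {x : Vertex d} (hx : x ∈ Λ) (h : freeEnergy Φ ν Λ x ≠ ⊤) :
    ∃ f, HasDensity Φ ν Λ f ∧ ∫⁻ φ, ENNReal.ofReal (Real.log (f φ).toReal) ∂ν ≠ ⊤ := by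
  let m := gradAlg E (Λ : Set (Vertex d))
  have := sigmaFinite_weighted hw hx
  obtain ⟨f, hf, h1, h2⟩ := @exists_density_of_relEntropy_ne_top _ m _ _ _ this h
  have hlog : Measurable[m] fun φ => ENNReal.ofReal (Real.log (f φ).toReal) :=
    (Real.measurable_log.comp hf.ennreal_toReal).ennreal_ofReal
  rw [lintegral_trim (gradAlg_le _) hlog] at h2
  exact ⟨f, hasDensity_of_trim_eq hx hf h1, h2⟩

/-- This is the entry point for measures whose free energy is not yet known to be finite:
Radon–Nikodym needs only a comparison of null sets. -/
theorem exists_hasDensity [IsProbabilityMeasure ν] (hw : ∀ φ, weight Φ Λ φ ≠ ⊤) {x : Vertex d}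
    (hx : x ∈ Λ) (h : ∀ S, MeasurableSet[gradAlg E (Λ : Set (Vertex d))] S →
      refIntegral Λ x (fun φ => weight Φ Λ φ * S.indicator 1 φ) = 0 → ν S = 0) :
    ∃ f, HasDensity Φ ν Λ f := by
  let m := gradAlg E (Λ : Set (Vertex d))
  have := sigmaFinite_weighted hw hx
  have hw := measurable_weight Φ Λ
  have hac : @Measure.AbsolutelyContinuous _ m (ν.trim (gradAlg_le (Λ : Set (Vertex d))))
      (@Measure.withDensity _ m (gradRefMeasure E Λ x) (weight Φ Λ)) := by
    refine @Measure.AbsolutelyContinuous.mk _ m _ _ fun S hS h0 => ?_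
    rw [trim_measurableSet_eq _ hS]
    refine h S hS ?_
    have hS1 : Measurable[m] (S.indicator (1 : Config E d → ℝ≥0∞)) :=
      Measurable.indicator measurable_const hS
    rw [@withDensity_apply _ m _ _ _ hS, ← @lintegral_indicator _ m _ _ hS,
      lintegral_gradRefMeasure _ _ (Measurable.indicator hw hS)] at h0
    rw [← h0]
    congr 1
    funext φ
    by_cases hφ : φ ∈ S <;> simp [hφ]
  exact ⟨_, hasDensity_of_trim_eq hx (@Measure.measurable_rnDeriv _ m _ _)
    (@Measure.withDensity_rnDeriv_eq _ m _ _ inferInstance hac).symm⟩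

theorem HasDensity.ae_ne [IsProbabilityMeasure ν] (h : HasDensity Φ ν Λ f) {x : Vertex d}
    (hx : x ∈ Λ) : ∀ᵐ φ ∂ν, f φ ≠ 0 ∧ f φ ≠ ⊤ :=
  ae_of_ae_trim (gradAlg_le _) (@density_ne _ (gradAlg E (Λ : Set (Vertex d))) _ _ _ f h.measurable
    (h.trim_eq hx))

theorem HasDensity.ae_weight_ne_zero (h : HasDensity Φ ν Λ f) {x : Vertex d} (hx : x ∈ Λ) :
    ∀ᵐ φ ∂ν, weight Φ Λ φ ≠ 0 := by
  let m := gradAlg E (Λ : Set (Vertex d))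
  have hS : MeasurableSet[m] {φ | weight Φ Λ φ = 0} :=
    measurable_weight Φ Λ (measurableSet_singleton 0)
  have hS1 : Measurable[m] ({φ | weight Φ Λ φ = 0}.indicator (1 : Config E d → ℝ≥0∞)) :=
    Measurable.indicator measurable_const hS
  rw [ae_iff]
  simp only [not_not]
  rw [← lintegral_indicator_one (gradAlg_le _ _ hS), h.lintegral_eq x hx _ hS1, refIntegral]
  refine (lintegral_congr fun ψ => ?_).trans lintegral_zero
  by_cases hψ : weight Φ Λ (glue (Λ.erase x) 0 ψ) = 0 <;> simp [hψ]

/-- The gradient reference measure of the height functions with bounded differences. -/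
theorem refIntegral_heightBall_lt_top (Λ : Finset (Vertex d)) (x : Vertex d) (r : ℝ)
    {g : Config E d → ℝ≥0∞} (hg1 : ∀ φ, g φ ≤ 1)
    (hg : ∀ φ, g φ ≠ 0 → ∀ y ∈ Λ, φ y - φ x ∈ heightBall E r) :
    refIntegral Λ x g < ⊤ := by
  have h1 : refIntegral Λ x g ≤ (Measure.pi fun _ : (Λ.erase x : Finset (Vertex d)) => E.refMeasure)
      (Set.univ.pi fun _ => heightBall E r) := by
    rw [refIntegral, integrateOut, ← lintegral_indicator_one
      (MeasurableSet.univ_pi fun _ => measurableSet_heightBall E r)]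
    refine lintegral_mono fun ψ => ?_
    by_cases h : g (glue (Λ.erase x) 0 ψ) = 0
    · simp only [h, zero_le]
    · have h2 : ψ ∈ Set.univ.pi fun _ : (Λ.erase x : Finset (Vertex d)) => heightBall E r := by
        intro y _
        have h3 := hg _ h y (Finset.mem_of_mem_erase y.2)
        rwa [glue_apply_mem _ _ y.2, glue_apply_notMem _ _ (Finset.notMem_erase x Λ), zero_apply,
          sub_zero] at h3
      rw [Set.indicator_of_mem h2]
      exact hg1 _
  refine h1.trans_lt ?_
  rw [Measure.pi_pi]
  exact ENNReal.prod_lt_top fun _ _ => refMeasure_heightBall_lt_top E r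

end Density

end

section
/-! ### Superadditivity of the free energy -/

variable {L : AddSubgroup (Vertex d)} {A : SimpleGraph (Vertex d)} {q : Vertex d → Vertex d → ℝ}
  {Φ Ψ Ξ : GradPotential E d} {C : ℝ} {ν : Measure (Config E d)} {Λ Δ : Finset (Vertex d)}

theorem measurable_grad_of_mem {S : Set (Vertex d)} {x y : Vertex d} (hx : x ∈ S) (hy : y ∈ S) :
    Measurable[gradAlg E S] fun φ : Config E d => φ y - φ x :=
  (@measurable_config_iff E d _ (gradAlg E S) S id).1 (@measurable_id _ (gradAlg E S)) x hx y hy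

/-- The event that the heights in `Λ` differ from the height at `x` by at most `r`. -/
def boundedAt (E : HeightSpace) {d : ℕ} (Λ : Finset (Vertex d)) (x : Vertex d) (r : ℝ) :
    Set (Config E d) := {φ | ∀ y ∈ Λ, φ y - φ x ∈ heightBall E r}

theorem measurableSet_boundedAt {S : Set (Vertex d)} (hΛ : ∀ y ∈ Λ, y ∈ S) {x : Vertex d}
    (hx : x ∈ S) (r : ℝ) : MeasurableSet[gradAlg E S] (boundedAt E Λ x r) := by
  let m := gradAlg E S
  have h : boundedAt E Λ x r =
      ⋂ y ∈ Λ, (fun φ : Config E d => φ y - φ x) ⁻¹' heightBall E r := by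
    ext φ
    simp [boundedAt]
  rw [h]
  exact @Finset.measurableSet_biInter _ _ m _ Λ fun y hy =>
    (measurable_grad_of_mem hx (hΛ y hy)) (measurableSet_heightBall E r)

theorem heightBall_mono {r s : ℝ} (h : r ≤ s) : heightBall E r ⊆ heightBall E s :=
  fun _ ht => le_trans (show _ ≤ r from ht) h

theorem exists_forall_mem_boundedAt (E : HeightSpace) (q : Vertex d → Vertex d → ℝ)
    (Λ : Finset (Vertex d)) (x : Vertex d) :
    ∃ r, ∀ φ ∈ lipschitzSet E q, φ ∈ boundedAt E Λ x r := by
  refine ⟨∑ y ∈ Λ, |heightRange q x y|, fun φ hφ y hy => heightBall_mono ?_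
    (sub_mem_heightBall hφ x y)⟩
  exact (le_abs_self _).trans
    (Finset.single_le_sum (f := fun y => |heightRange q x y|) (fun _ _ => abs_nonneg _) hy)

/-- Since `-log f ≤ 1 / f`, and `∫ 1 / f ∂ν` over a bounded region is at most the weighted reference
mass of that region, the finite volume available to Lipschitz functions suffices. Hence free
energies are never `-∞`. -/
theorem IsSplit.lintegral_neg_log_ne_top (H : IsSplit L A q Φ Ψ Ξ C)
    (hν : IsLipschitzMeasure q ν) {f : Config E d → ℝ≥0∞} (h : HasDensity Φ ν Λ f)
    {x : Vertex d} (hx : x ∈ Λ) : ∫⁻ φ, ENNReal.ofReal (-Real.log (f φ).toReal) ∂ν ≠ ⊤ := by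
  let m := gradAlg E (Λ : Set (Vertex d))
  have := hν.isProb
  obtain ⟨r, hr⟩ := exists_forall_mem_boundedAt E q Λ x
  have hS : MeasurableSet[m] (boundedAt E Λ x r) := measurableSet_boundedAt (fun y hy => hy) hx r
  -- The Lipschitz set involves heights outside `Λ`; this event contains it and is measurable for
  -- the differences in `Λ`.
  set g : Config E d → ℝ≥0∞ := (boundedAt E Λ x r).indicator 1 with hg
  have hgm : Measurable[m] g := Measurable.indicator measurable_const hS
  have hgf : Measurable[m] fun φ => g φ / f φ := Measurable.div hgm h.measurable
  have h1 : ∫⁻ φ, ENNReal.ofReal (-Real.log (f φ).toReal) ∂ν ≤ ∫⁻ φ, g φ / f φ ∂ν := by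
    refine lintegral_mono_ae ?_
    filter_upwards [hν.ae_mem, h.ae_ne hx] with φ h2 h3
    have h4 : 0 < (f φ).toReal := ENNReal.toReal_pos h3.1 h3.2
    have h5 := Real.log_le_sub_one_of_pos (inv_pos.2 h4)
    rw [Real.log_inv] at h5
    rw [hg, Set.indicator_of_mem (hr φ h2), Pi.one_apply, one_div]
    refine ENNReal.ofReal_le_of_le_toReal ?_
    rw [ENNReal.toReal_inv]
    linarith
  refine ne_top_of_le_ne_top ?_ h1
  rw [h.lintegral_eq x hx _ hgf]
  have h6 : refIntegral Λ x (fun φ => f φ * (weight Φ Λ φ * (g φ / f φ))) ≤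
      refIntegral Λ x (fun φ => ENNReal.ofReal (Real.exp (C * Λ.card)) * g φ) := by
    refine refIntegral_mono fun φ => ?_
    calc f φ * (weight Φ Λ φ * (g φ / f φ)) = weight Φ Λ φ * (f φ * (g φ / f φ)) := by ring
      _ ≤ _ := mul_le_mul' (H.weight_le Λ φ) ENNReal.mul_div_le
  refine ne_top_of_le_ne_top ?_ h6
  rw [refIntegral_const_mul (heightMeasurable_of_gradAlg hgm)]
  refine ENNReal.mul_ne_top ENNReal.ofReal_ne_top
    (refIntegral_heightBall_lt_top Λ x r (fun φ => ?_) fun φ hφ => ?_).ne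
  · exact Set.indicator_le_self' (f := (1 : Config E d → ℝ≥0∞)) (fun _ _ => zero_le) φ
  · have h7 : φ ∈ boundedAt E Λ x r := by
      by_contra h7
      exact hφ (Set.indicator_of_notMem h7 _)
    exact h7

/-- The entropic cost of attaching `y` to `b`. -/
def attachCost (E : HeightSpace) (q : Vertex d → Vertex d → ℝ) (b y : Vertex d) : ℝ :=
  Real.log ((E.refMeasure (heightBall E (heightRange q b y))).toReal + 1)

/-- The `+ 1` in `attachCost` serves this purpose: a finite sum of costs then dominates each of its
terms. -/
theorem attachCost_nonneg (b y : Vertex d) : 0 ≤ attachCost E q b y :=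
  Real.log_nonneg (by linarith [ENNReal.toReal_nonneg (a :=
    E.refMeasure (heightBall E (heightRange q b y)))])

theorem HasDensity.refIntegral_eq_one [IsProbabilityMeasure ν] {f : Config E d → ℝ≥0∞}
    (h : HasDensity Φ ν Λ f) {x : Vertex d} (hx : x ∈ Λ) :
    refIntegral Λ x (fun φ => f φ * weight Φ Λ φ) = 1 := by
  have h1 := h.lintegral_eq x hx (fun _ => 1) measurable_const
  simp only [mul_one, lintegral_const, measure_univ] at h1
  exact h1.symm

/-- By `weight_union_le` and the factorization of the reference measure, a null event for the
weighted reference measure of one piece remains null on the union, where the density `f` is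
available. -/
theorem IsSplit.exists_hasDensity_left (H : IsSplit L A q Φ Ψ Ξ C) [IsProbabilityMeasure ν]
    (hd : Disjoint Λ Δ) {b y : Vertex d} (hb : b ∈ Λ) (hy : y ∈ Δ) {f : Config E d → ℝ≥0∞}
    (hf : HasDensity Φ ν (Λ ∪ Δ) f) :
    (∃ g, HasDensity Φ ν Λ g) ∧ ∃ g, HasDensity Φ ν Δ g := by
  have hsubΛ : (Λ : Set (Vertex d)) ⊆ (Λ ∪ Δ : Finset (Vertex d)) := by
    simp [Set.subset_union_left]
  have hsubΔ : (Δ : Set (Vertex d)) ⊆ (Λ ∪ Δ : Finset (Vertex d)) := by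
    simp [Set.subset_union_right]
  have key : ∀ u v : Config E d → ℝ≥0∞,
      Measurable[gradAlg E (Λ : Set (Vertex d))] u → Measurable[gradAlg E (Δ : Set (Vertex d))] v →
      (refIntegral Λ b (fun φ => weight Φ Λ φ * u φ) = 0 ∨
        refIntegral Δ y (fun φ => weight Φ Δ φ * v φ) = 0) →
      ∫⁻ φ, u φ * v φ ∂ν = 0 := by
    intro u v hu hv h0
    have hw : Measurable[gradAlg E ((Λ ∪ Δ : Finset (Vertex d)) : Set (Vertex d))]
        fun φ => u φ * v φ :=
      Measurable.mul (hu.mono (gradAlg_mono hsubΛ) le_rfl) (hv.mono (gradAlg_mono hsubΔ) le_rfl)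
    rw [hf.lintegral_eq b (Finset.mem_union_left _ hb) _ hw]
    refine refIntegral_mul_eq_zero (heightMeasurable_of_gradAlg
      (Measurable.mul (measurable_weight Φ _) hw)) ?_
    have hu' := Measurable.mul (measurable_weight Φ Λ) hu
    have hv' := Measurable.mul (measurable_weight Φ Δ) hv
    -- With `k = 1` the integral over the connecting difference is infinite; this is harmless,
    -- because one of the other factors vanishes.
    have h1 := refIntegral_union hd hb hb hy hu' hv' (k := fun _ => 1) measurable_const
    have h2 : refIntegral (Λ ∪ Δ) b (fun φ => (weight Φ Λ * u) φ * (1 * (weight Φ Δ * v) φ)) = 0 := by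
      rw [h1]
      rcases h0 with h0 | h0
      · rw [show refIntegral Λ b (weight Φ Λ * u) = 0 from h0, zero_mul]
      · rw [show refIntegral Δ y (weight Φ Δ * v) = 0 from h0, zero_mul, mul_zero]
    have hm : HeightMeasurable fun φ => (weight Φ Λ * u) φ * (1 * (weight Φ Δ * v) φ) := by
      simp only [one_mul]
      exact (heightMeasurable_of_gradAlg hu').mul (heightMeasurable_of_gradAlg hv')
    refine le_antisymm ?_ (zero_le)
    refine (refIntegral_mono fun φ => ?_).trans (refIntegral_mul_eq_zero (x := b)
      (g := fun _ => ENNReal.ofReal (Real.exp (lowerExteriorBound Ξ Δ).toReal)) hm h2).le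
    calc weight Φ (Λ ∪ Δ) φ * (u φ * v φ) ≤ _ := mul_le_mul_left (H.weight_union_le hd φ) _
      _ = _ := by simp only [Pi.mul_apply]; ring
  constructor
  · refine exists_hasDensity (H.weight_ne_top Λ) hb fun S hS h0 => ?_
    have hS1 : Measurable[gradAlg E (Λ : Set (Vertex d))] (S.indicator (1 : Config E d → ℝ≥0∞)) :=
      Measurable.indicator measurable_const hS
    have h1 := key _ (fun _ => 1) hS1 measurable_const (.inl h0)
    simp only [mul_one] at h1
    rwa [lintegral_indicator_one (gradAlg_le _ S hS)] at h1
  · refine exists_hasDensity (H.weight_ne_top Δ) hy fun S hS h0 => ?_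
    have hS1 : Measurable[gradAlg E (Δ : Set (Vertex d))] (S.indicator (1 : Config E d → ℝ≥0∞)) :=
      Measurable.indicator measurable_const hS
    have h1 := key (fun _ => 1) _ measurable_const hS1 (.inr h0)
    simp only [one_mul] at h1
    rwa [lintegral_indicator_one (gradAlg_le _ S hS)] at h1

/-- Gibbs' inequality compares the joint density `f` with the product of the marginal densities,
glued by a height difference from `b` to `y` that is confined to the range allowed by `q`. The total
mass of the glued density is at most the exponential of the exterior bound times the volume of that
range. -/
theorem IsSplit.superadditive (H : IsSplit L A q Φ Ψ Ξ C) (hν : IsLipschitzMeasure q ν)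
    (hd : Disjoint Λ Δ) {b y : Vertex d} (hb : b ∈ Λ) (hy : y ∈ Δ) {h : ℝ}
    (hF : HasFreeEnergy Φ ν (Λ ∪ Δ) h) :
    ∃ h₁ h₂, HasFreeEnergy Φ ν Λ h₁ ∧ HasFreeEnergy Φ ν Δ h₂ ∧
      h₁ + h₂ ≤ h + ((lowerExteriorBound Ξ Δ).toReal + attachCost E q b y) := by
  have := hν.isProb
  obtain ⟨f, hf, hfi, rfl⟩ := hF
  obtain ⟨⟨f₁, hf₁⟩, f₂, hf₂⟩ := H.exists_hasDensity_left hd hb hy hf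
  have hsubΛ : (Λ : Set (Vertex d)) ⊆ (Λ ∪ Δ : Finset (Vertex d)) := by
    simp [Set.subset_union_left]
  have hsubΔ : (Δ : Set (Vertex d)) ⊆ (Λ ∪ Δ : Finset (Vertex d)) := by
    simp [Set.subset_union_right]
  have hbU : b ∈ ((Λ ∪ Δ : Finset (Vertex d)) : Set (Vertex d)) := hsubΛ hb
  have hyU : y ∈ ((Λ ∪ Δ : Finset (Vertex d)) : Set (Vertex d)) := hsubΔ hy
  set k : E → ℝ≥0∞ := (heightBall E (heightRange q b y)).indicator 1 with hk
  have hkm : Measurable k := measurable_const.indicator (measurableSet_heightBall E _)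
  -- The factor `k` makes the total mass finite and equals `1` almost surely for a Lipschitz
  -- measure, so it does not contribute to `log G`.
  set G : Config E d → ℝ≥0∞ := fun φ => f₁ φ * (k (φ y - φ b) * f₂ φ) with hG
  have hGm : Measurable[gradAlg E ((Λ ∪ Δ : Finset (Vertex d)) : Set (Vertex d))] G :=
    Measurable.mul (hf₁.measurable.mono (gradAlg_mono hsubΛ) le_rfl)
      (Measurable.mul (hkm.comp (measurable_grad_of_mem hbU hyU))
        (hf₂.measurable.mono (gradAlg_mono hsubΔ) le_rfl))
  have hG1 : ∀ᵐ φ ∂ν, G φ = f₁ φ * f₂ φ := by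
    filter_upwards [hν.ae_mem] with φ hφ
    simp only [hG, hk]
    rw [Set.indicator_of_mem (sub_mem_heightBall hφ b y), Pi.one_apply, one_mul]
  have hG2 : ∀ᵐ φ ∂ν, G φ ≠ 0 ∧ G φ ≠ ⊤ := by
    filter_upwards [hG1, hf₁.ae_ne hb, hf₂.ae_ne hy] with φ h1 h2 h3
    rw [h1]
    exact ⟨mul_ne_zero h2.1 h3.1, ENNReal.mul_ne_top h2.2 h3.2⟩
  have hlog : ∀ᵐ φ ∂ν, Real.log (G φ).toReal =
      Real.log (f₁ φ).toReal + Real.log (f₂ φ).toReal := by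
    filter_upwards [hG1, hf₁.ae_ne hb, hf₂.ae_ne hy] with φ h1 h2 h3
    rw [h1, ENNReal.toReal_mul, Real.log_mul (ENNReal.toReal_pos h2.1 h2.2).ne'
      (ENNReal.toReal_pos h3.1 h3.2).ne']
  have hn₁ := H.lintegral_neg_log_ne_top hν hf₁ hb
  have hn₂ := H.lintegral_neg_log_ne_top hν hf₂ hy
  have hm₁ : Measurable fun φ => Real.log (f₁ φ).toReal :=
    Real.measurable_log.comp (hf₁.measurable.mono (gradAlg_le _) le_rfl).ennreal_toReal
  have hm₂ : Measurable fun φ => Real.log (f₂ φ).toReal :=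
    Real.measurable_log.comp (hf₂.measurable.mono (gradAlg_le _) le_rfl).ennreal_toReal
  have hGneg : ∫⁻ φ, ENNReal.ofReal (-Real.log (G φ).toReal) ∂ν ≠ ⊤ := by
    refine ne_top_of_le_ne_top (ENNReal.add_ne_top.2 ⟨hn₁, hn₂⟩) ?_
    rw [← lintegral_add_left (show Measurable fun φ => ENNReal.ofReal (-Real.log (f₁ φ).toReal)
      from hm₁.neg.ennreal_ofReal)]
    refine lintegral_mono_ae ?_
    filter_upwards [hlog] with φ h1
    rw [h1, neg_add]
    exact ENNReal.ofReal_add_le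
  set V := (E.refMeasure (heightBall E (heightRange q b y))).toReal with hV
  set e := (lowerExteriorBound Ξ Δ).toReal with he
  have hV0 : 0 ≤ V := ENNReal.toReal_nonneg
  have hle : ∫⁻ φ, G φ / f φ ∂ν ≤ ENNReal.ofReal (Real.exp e * (V + 1)) := by
    rw [hf.lintegral_eq b (Finset.mem_union_left _ hb) _ (show Measurable[gradAlg E _]
      fun φ => G φ / f φ from Measurable.div hGm hf.measurable)]
    have hw₁ := Measurable.mul hf₁.measurable (measurable_weight Φ Λ)
    have hw₂ := Measurable.mul hf₂.measurable (measurable_weight Φ Δ)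
    have h1 := refIntegral_union hd hb hb hy hw₁ hw₂ hkm
    rw [show refIntegral Λ b (f₁ * weight Φ Λ) = 1 from hf₁.refIntegral_eq_one hb,
      show refIntegral Δ y (f₂ * weight Φ Δ) = 1 from hf₂.refIntegral_eq_one hy, one_mul,
      one_mul, hk, lintegral_indicator_one (measurableSet_heightBall E _), ← hk] at h1
    have hm : HeightMeasurable fun φ => (f₁ * weight Φ Λ) φ * (k (φ y - φ b) * (f₂ * weight Φ Δ) φ) :=
      (heightMeasurable_of_gradAlg hw₁).mul (HeightMeasurable.mul
        (hkm.comp ((measurable_pi_apply y).sub (measurable_pi_apply b)))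
        (heightMeasurable_of_gradAlg hw₂))
    calc refIntegral (Λ ∪ Δ) b (fun φ => f φ * (weight Φ (Λ ∪ Δ) φ * (G φ / f φ)))
        ≤ refIntegral (Λ ∪ Δ) b (fun φ => ENNReal.ofReal (Real.exp e) *
          ((f₁ * weight Φ Λ) φ * (k (φ y - φ b) * (f₂ * weight Φ Δ) φ))) := by
          refine refIntegral_mono fun φ => ?_
          calc f φ * (weight Φ (Λ ∪ Δ) φ * (G φ / f φ))
              = weight Φ (Λ ∪ Δ) φ * (f φ * (G φ / f φ)) := by ring
            _ ≤ (ENNReal.ofReal (Real.exp e) * (weight Φ Λ φ * weight Φ Δ φ)) * G φ :=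
                mul_le_mul' (H.weight_union_le hd φ) ENNReal.mul_div_le
            _ = _ := by simp only [hG, Pi.mul_apply]; ring
      _ = ENNReal.ofReal (Real.exp e) * E.refMeasure (heightBall E (heightRange q b y)) := by
          rw [refIntegral_const_mul hm, h1]
      _ ≤ _ := by
          rw [ENNReal.ofReal_mul (Real.exp_nonneg _)]
          refine mul_le_mul_right ?_ _
          rw [← ENNReal.ofReal_toReal (refMeasure_heightBall_lt_top E _).ne]
          exact ENNReal.ofReal_le_ofReal (by linarith)
  obtain ⟨hGi, hGle⟩ := gibbs_inequality (hf.measurable.mono (gradAlg_le _) le_rfl)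
    (hGm.mono (gradAlg_le _) le_rfl) (hf.ae_ne (Finset.mem_union_left _ hb)) hG2
    (mul_pos (Real.exp_pos _) (by linarith)) hle hfi hGneg
  rw [Real.log_mul (Real.exp_pos _).ne' (by linarith), Real.log_exp] at hGle
  have hsum : Integrable (fun φ => Real.log (f₁ φ).toReal + Real.log (f₂ φ).toReal) ν :=
    hGi.congr hlog
  -- An integrable sum whose summands both have integrable negative parts has integrable summands.
  have hparts : ∀ u v : Config E d → ℝ, Measurable u → Measurable v →
      Integrable (fun φ => u φ + v φ) ν → ∫⁻ φ, ENNReal.ofReal (-u φ) ∂ν ≠ ⊤ →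
      ∫⁻ φ, ENNReal.ofReal (-v φ) ∂ν ≠ ⊤ → Integrable u ν := by
    intro u v hu hv huv hnu hnv
    refine integrable_of_lintegral_parts hu ?_ hnu
    have h1 : ∫⁻ φ, ENNReal.ofReal (u φ + v φ) ∂ν ≠ ⊤ :=
      ne_top_of_le_ne_top huv.2.ne (lintegral_mono fun x => Real.ofReal_le_enorm _)
    refine ne_top_of_le_ne_top (ENNReal.add_ne_top.2 ⟨h1, hnv⟩) ?_
    rw [← lintegral_add_left (show Measurable fun φ => ENNReal.ofReal (u φ + v φ) from
      (hu.add hv).ennreal_ofReal)]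
    refine lintegral_mono fun φ => ?_
    refine le_trans (le_of_eq ?_) ENNReal.ofReal_add_le
    congr 1
    ring
  have hi₁ := hparts _ _ hm₁ hm₂ hsum hn₁ hn₂
  have hi₂ := hparts _ _ hm₂ hm₁ (by simpa only [add_comm] using hsum) hn₂ hn₁
  refine ⟨_, _, ⟨f₁, hf₁, hi₁, rfl⟩, ⟨f₂, hf₂, hi₂, rfl⟩, ?_⟩
  rw [← integral_add hi₁ hi₂, ← integral_congr_ae hlog, attachCost, ← hV]
  linarith

theorem HasFreeEnergy.freeEnergy_eq (H : IsSplit L A q Φ Ψ Ξ C) [IsProbabilityMeasure ν] {h : ℝ}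
    (hF : HasFreeEnergy Φ ν Λ h) {x : Vertex d} (hx : x ∈ Λ) : freeEnergy Φ ν Λ x = (h : EReal) := by
  obtain ⟨f, hf, hfi, rfl⟩ := hF
  exact hf.freeEnergy_eq (H.weight_ne_top Λ) hx hfi

theorem HasFreeEnergy.unique (H : IsSplit L A q Φ Ψ Ξ C) [IsProbabilityMeasure ν] {h h' : ℝ}
    (hF : HasFreeEnergy Φ ν Λ h) (hF' : HasFreeEnergy Φ ν Λ h') (hΛ : Λ.Nonempty) : h = h' := by
  obtain ⟨x, hx⟩ := hΛ
  have h1 := hF.freeEnergy_eq H hx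
  rw [hF'.freeEnergy_eq H hx] at h1
  exact (EReal.coe_injective h1).symm

theorem IsSplit.exists_hasFreeEnergy (H : IsSplit L A q Φ Ψ Ξ C) (hν : IsLipschitzMeasure q ν)
    {x : Vertex d} (hx : x ∈ Λ) (h : freeEnergy Φ ν Λ x ≠ ⊤) : ∃ h, HasFreeEnergy Φ ν Λ h := by
  have := hν.isProb
  obtain ⟨f, hf, h1⟩ := exists_hasDensity_of_freeEnergy_ne_top (H.weight_ne_top Λ) hx h
  exact ⟨_, f, hf, integrable_of_lintegral_parts
    (Real.measurable_log.comp (hf.measurable.mono (gradAlg_le _) le_rfl).ennreal_toReal) h1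
    (H.lintegral_neg_log_ne_top hν hf hx), rfl⟩

theorem weight_singleton (Φ : GradPotential E d) (v : Vertex d) (φ : Config E d) :
    weight Φ {v} φ = 1 := by
  have h : Φ.interiorHamiltonian {v} φ = 0 := by
    refine Finset.sum_eq_zero fun Γ hΓ => Φ.zero_of_card_le_one Γ ?_ φ
    exact Finset.card_le_card (mem_subsets.1 hΓ).1
  rw [weight, h]
  simp

theorem hasFreeEnergy_singleton [IsProbabilityMeasure ν] (v : Vertex d) :
    HasFreeEnergy Φ ν {v} 0 := by
  refine ⟨fun _ => 1, ⟨measurable_const, fun x hx g hg => ?_⟩, by simp, by simp⟩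
  have h1 : ∀ φ : Config E d, g φ = g 0 := fun φ => gradAlg_congr hg fun y hy z hz => by
    have hy' : y = v := by simpa using hy
    have hz' : z = v := by simpa using hz
    rw [hy', hz', sub_self, sub_self]
  simp_rw [weight_singleton, one_mul, h1, refIntegral, integrateOut]
  rw [Finset.mem_singleton.1 hx, Finset.erase_singleton]
  simp

/-- The cost of adding a vertex. -/
theorem IsSplit.superadditive_insert (H : IsSplit L A q Φ Ψ Ξ C) (hν : IsLipschitzMeasure q ν)
    {b y : Vertex d} (hb : b ∈ Λ) (hy : y ∉ Λ) {h : ℝ} (hF : HasFreeEnergy Φ ν (insert y Λ) h) :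
    ∃ h₁, HasFreeEnergy Φ ν Λ h₁ ∧ h₁ ≤ h + (C + attachCost E q b y) := by
  have := hν.isProb
  have e1 : insert y Λ = Λ ∪ {y} := by rw [Finset.union_comm]; rfl
  rw [e1] at hF
  obtain ⟨h₁, h₂, hF₁, hF₂, hle⟩ := H.superadditive hν (Finset.disjoint_singleton_right.2 hy) hb
    (Finset.mem_singleton_self y) hF
  have h0 := hF₂.unique H (hasFreeEnergy_singleton y) (Finset.singleton_nonempty y)
  -- Every set that meets `{y}` contains `y`, so these sets occur in the sum bounded by `C`.
  have h3 : (lowerExteriorBound Ξ {y}).toReal ≤ C := by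
    refine ENNReal.toReal_le_of_le_ofReal H.nonneg (iSup_le fun φ => le_trans ?_ (H.bound y φ))
    have hmem : ∀ Γ : {Δ : Finset (Vertex d) // (∃ x ∈ Δ, x ∈ ({y} : Finset (Vertex d))) ∧
        ∃ x ∈ Δ, x ∉ ({y} : Finset (Vertex d))}, y ∈ Γ.1 := by
      rintro ⟨Γ, ⟨x, hx, hxy⟩, -⟩
      rwa [Finset.mem_singleton.1 hxy] at hx
    refine ENNReal.tsum_comp_le_tsum_of_injective (f := fun Γ : {Δ : Finset (Vertex d) //
        (∃ x ∈ Δ, x ∈ ({y} : Finset (Vertex d))) ∧ ∃ x ∈ Δ, x ∉ ({y} : Finset (Vertex d))} =>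
      (⟨Γ.1, hmem Γ⟩ : {Γ : Finset (Vertex d) // y ∈ Γ})) ?_ (fun Γ => (Ξ Γ φ).abs)
    intro Γ Γ' h
    exact Subtype.ext (by simpa using h)
  exact ⟨h₁, hF₁, by linarith⟩

/-- The free energy of a subset whose complement is within reach of it. -/
theorem IsSplit.hasFreeEnergy_subset (H : IsSplit L A q Φ Ψ Ξ C) (hν : IsLipschitzMeasure q ν)
    {K : ℝ} (hsub : Λ ⊆ Δ) (hK : ∀ y ∈ Δ, ∃ b ∈ Λ, attachCost E q b y ≤ K) {h : ℝ}
    (hF : HasFreeEnergy Φ ν Δ h) :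
    ∃ h₁, HasFreeEnergy Φ ν Λ h₁ ∧ h₁ ≤ h + (C + K) * ((Δ \ Λ).card : ℝ) := by
  induction hn : (Δ \ Λ).card generalizing Δ h with
  | zero =>
    have : Δ = Λ := (Finset.sdiff_eq_empty_iff_subset.1 (Finset.card_eq_zero.1 hn)).antisymm hsub
    subst this
    exact ⟨h, hF, by simp⟩
  | succ n ih =>
    obtain ⟨y, hy⟩ : (Δ \ Λ).Nonempty := Finset.card_pos.1 (by omega)
    obtain ⟨hyΔ, hyΛ⟩ := Finset.mem_sdiff.1 hy
    obtain ⟨b, hb, hbK⟩ := hK y hyΔ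
    have hsub' : Λ ⊆ Δ.erase y := fun z hz =>
      Finset.mem_erase.2 ⟨fun e => hyΛ (e ▸ hz), hsub hz⟩
    rw [← Finset.insert_erase hyΔ] at hF
    obtain ⟨h₂, hF₂, hle₂⟩ := H.superadditive_insert hν (hsub' hb) (Finset.notMem_erase y Δ) hF
    have hcard : (Δ.erase y \ Λ).card = n := by
      rw [Finset.erase_sdiff_comm, Finset.card_erase_of_mem hy, hn]
      rfl
    obtain ⟨h₁, hF₁, hle₁⟩ := ih hsub' (fun z hz => hK z (Finset.mem_of_mem_erase hz)) hF₂ hcard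
    refine ⟨h₁, hF₁, ?_⟩
    push_cast
    linarith

end

section
/-! ### Convergence of subadditive quantities along boxes -/

theorem tendsto_floor_mul_div (k : ℕ) (hk : 0 < k) :
    Tendsto (fun n : ℕ => ((n / k * k : ℕ) : ℝ) / n) atTop (𝓝 1) := by
  have h1 : Tendsto (fun n : ℕ => 1 - (k : ℝ) / n) atTop (𝓝 1) := by
    simpa using tendsto_const_nhds.sub (tendsto_const_div_atTop_nhds_zero_nat (k : ℝ))
  refine tendsto_of_tendsto_of_tendsto_of_le_of_le' h1 tendsto_const_nhds ?_ ?_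
  · filter_upwards [eventually_gt_atTop 0] with n hn
    have hn' : (0 : ℝ) < n := by exact_mod_cast hn
    rw [le_div_iff₀ hn', sub_mul, one_mul, div_mul_cancel₀ _ hn'.ne', sub_le_iff_le_add]
    have := Nat.div_add_mod n k
    have h2 := Nat.mod_lt n hk
    have h3 : n ≤ n / k * k + k := by rw [mul_comm]; omega
    exact_mod_cast h3
  · filter_upwards [eventually_gt_atTop 0] with n hn
    have hn' : (0 : ℝ) < n := by exact_mod_cast hn
    rw [div_le_one hn']
    exact_mod_cast Nat.div_mul_le_self n k

theorem tendsto_ceil_mul_div (p : ℕ) (hp : 0 < p) :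
    Tendsto (fun n : ℕ => (((n + (p - 1)) / p * p : ℕ) : ℝ) / n) atTop (𝓝 1) := by
  have h1 : Tendsto (fun n : ℕ => 1 + (p : ℝ) / n) atTop (𝓝 1) := by
    simpa using tendsto_const_nhds.add (tendsto_const_div_atTop_nhds_zero_nat (p : ℝ))
  refine tendsto_of_tendsto_of_tendsto_of_le_of_le' tendsto_const_nhds h1 ?_ ?_
  · filter_upwards [eventually_gt_atTop 0] with n hn
    have hn' : (0 : ℝ) < n := by exact_mod_cast hn
    rw [one_le_div hn']
    have := Nat.div_add_mod (n + (p - 1)) p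
    have h2 := Nat.mod_lt (n + (p - 1)) hp
    have h3 : n ≤ (n + (p - 1)) / p * p := by rw [mul_comm]; omega
    exact_mod_cast h3
  · filter_upwards [eventually_gt_atTop 0] with n hn
    have hn' : (0 : ℝ) < n := by exact_mod_cast hn
    rw [div_le_iff₀ hn', add_mul, one_mul, div_mul_cancel₀ _ hn'.ne']
    have h3 : (n + (p - 1)) / p * p ≤ n + p := (Nat.div_mul_le_self _ _).trans (by omega)
    exact_mod_cast h3

/-- Fekete's argument: the limit is the supremum of `(H k - e k) / k ^ d` over the positive
multiples `k` of `p`. Sides that are not multiples of `p` are compared with nearby multiples through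
`hmono`. An upper bound along a subsequence suffices, because the lower bounds hold eventually. -/
theorem exists_tendsto_of_superadditive {d p : ℕ} (hp : 0 < p) {H e : ℕ → ℝ}
    (hsuper : ∀ k, 0 < k → p ∣ k → ∀ a : ℕ, 0 < a →
      (a : ℝ) ^ d * H k ≤ H (a * k) + (a : ℝ) ^ d * e k)
    (hmono : ∀ R : ℕ, ∃ K : ℝ, ∀ m n : ℕ, 0 < m → m ≤ n → n ≤ m + R →
      H m ≤ H n + K * ((n : ℝ) ^ d - (m : ℝ) ^ d))
    (hbdd : ∃ B : ℝ, ∃ᶠ n : ℕ in atTop, H n ≤ B * (n : ℝ) ^ d)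
    (he : Tendsto (fun k => e k / (k : ℝ) ^ d) atTop (𝓝 0)) :
    ∃ l : ℝ, Tendsto (fun n => H n / (n : ℝ) ^ d) atTop (𝓝 l) := by
  -- Tile the largest box of side a multiple of `k` inside the box of side `n`; `hmono` with `R = k`
  -- accounts for the remaining layer.
  have hlow : ∀ k, 0 < k → p ∣ k → ∀ c < (H k - e k) / (k : ℝ) ^ d,
      ∀ᶠ n : ℕ in atTop, c < H n / (n : ℝ) ^ d := by
    intro k hk hpk c hc
    set s := (H k - e k) / (k : ℝ) ^ d with hs
    obtain ⟨K, hK⟩ := hmono k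
    have ht : Tendsto (fun n : ℕ => (((n / k * k : ℕ) : ℝ) / n) ^ d * s -
        K * (1 - (((n / k * k : ℕ) : ℝ) / n) ^ d)) atTop (𝓝 s) := by
      have h1 := (tendsto_floor_mul_div k hk).pow d
      have h2 := (h1.mul_const s).sub ((h1.const_sub 1).const_mul K)
      rw [one_pow, one_mul, sub_self, mul_zero, sub_zero] at h2
      exact h2
    filter_upwards [ht.eventually_const_lt hc, eventually_ge_atTop k] with n hn hkn
    refine hn.trans_le ?_
    have hn0 : 0 < n := hk.trans_le hkn
    have hn' : (0 : ℝ) < (n : ℝ) ^ d := by positivity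
    have hk' : (0 : ℝ) < (k : ℝ) ^ d := by positivity
    have ha : 0 < n / k := Nat.div_pos hkn hk
    have h1 := hsuper k hk hpk (n / k) ha
    have h2 := hK (n / k * k) n (Nat.mul_pos ha hk) (Nat.div_mul_le_self n k) (by
      have := Nat.div_add_mod n k
      have h2 := Nat.mod_lt n hk
      rw [mul_comm] at this
      omega)
    rw [le_div_iff₀ hn']
    have h3 : (((n / k * k : ℕ) : ℝ) / n) ^ d * (n : ℝ) ^ d = ((n / k * k : ℕ) : ℝ) ^ d := by
      rw [← mul_pow, div_mul_cancel₀]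
      exact_mod_cast hn0.ne'
    have h4 : ((n / k * k : ℕ) : ℝ) ^ d * s = ((n / k : ℕ) : ℝ) ^ d * (H k - e k) := by
      rw [hs, Nat.cast_mul, mul_pow, mul_assoc, mul_div_cancel₀ _ hk'.ne']
    calc ((((n / k * k : ℕ) : ℝ) / n) ^ d * s - K * (1 - (((n / k * k : ℕ) : ℝ) / n) ^ d)) *
          (n : ℝ) ^ d
        = (((n / k * k : ℕ) : ℝ) / n) ^ d * (n : ℝ) ^ d * s - K * ((n : ℝ) ^ d -
          (((n / k * k : ℕ) : ℝ) / n) ^ d * (n : ℝ) ^ d) := by ring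
      _ ≤ H n := by
          rw [h3, h4]
          linarith
  obtain ⟨B, hB⟩ := hbdd
  set S : Set ℝ := {s | ∃ k, 0 < k ∧ p ∣ k ∧ s = (H k - e k) / (k : ℝ) ^ d} with hS
  have hSB : ∀ s ∈ S, s ≤ B := by
    rintro s ⟨k, hk, hpk, rfl⟩
    by_contra! h
    obtain ⟨n, h1, h2, hn⟩ := (hB.and_eventually
      ((hlow k hk hpk B h).and (eventually_gt_atTop 0))).exists
    have hn' : (0 : ℝ) < (n : ℝ) ^ d := by positivity
    rw [lt_div_iff₀ hn'] at h2
    linarith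
  have hSne : S.Nonempty := ⟨_, p, hp, dvd_rfl, rfl⟩
  have hSb : BddAbove S := ⟨B, hSB⟩
  refine ⟨sSup S, tendsto_order.2 ⟨fun c hc => ?_, fun c hc => ?_⟩⟩
  · obtain ⟨s, ⟨k, hk, hpk, rfl⟩, hs⟩ := exists_lt_of_lt_csSup hSne hc
    exact hlow k hk hpk c hs
  · obtain ⟨K, hK⟩ := hmono p
    -- For the upper bound, round `n` up to a multiple of `p`, where the definition of the supremum
    -- applies directly.
    set r : ℕ → ℕ := fun n => (n + (p - 1)) / p * p with hr
    have hrn : ∀ n, n ≤ r n ∧ r n ≤ n + p := by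
      intro n
      have := Nat.div_add_mod (n + (p - 1)) p
      have h2 := Nat.mod_lt (n + (p - 1)) hp
      rw [mul_comm] at this
      simp only [hr]
      omega
    have hrt : Tendsto r atTop atTop := tendsto_atTop_mono (fun n => (hrn n).1) tendsto_id
    have ht : Tendsto (fun n : ℕ => ((r n : ℝ) / n) ^ d * (sSup S + e (r n) / (r n : ℝ) ^ d) +
        K * (((r n : ℝ) / n) ^ d - 1)) atTop (𝓝 (sSup S)) := by
      have h1 := (tendsto_ceil_mul_div p hp).pow d
      have h2 := (h1.mul (tendsto_const_nhds.add (he.comp hrt) : Tendsto (fun n =>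
        sSup S + e (r n) / (r n : ℝ) ^ d) atTop (𝓝 (sSup S + 0)))).add ((h1.sub_const 1).const_mul K)
      rw [one_pow, one_mul, sub_self, mul_zero, add_zero, add_zero] at h2
      exact h2
    filter_upwards [ht.eventually_lt_const hc, eventually_gt_atTop 0] with n hn hn0
    refine lt_of_le_of_lt ?_ hn
    have hn' : (0 : ℝ) < (n : ℝ) ^ d := by positivity
    have hr0 : 0 < r n := hn0.trans_le (hrn n).1
    have hr' : (0 : ℝ) < (r n : ℝ) ^ d := by positivity
    have h1 : (H (r n) - e (r n)) / (r n : ℝ) ^ d ≤ sSup S :=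
      le_csSup hSb ⟨r n, hr0, Dvd.intro_left _ rfl, rfl⟩
    rw [div_le_iff₀ hr'] at h1
    have h2 := hK n (r n) hn0 (hrn n).1 (hrn n).2
    have h3 : ((r n : ℝ) / n) ^ d * (n : ℝ) ^ d = (r n : ℝ) ^ d := by
      rw [← mul_pow, div_mul_cancel₀]
      exact_mod_cast hn0.ne'
    rw [div_le_iff₀ hn']
    calc H n ≤ sSup S * (r n : ℝ) ^ d + e (r n) + K * ((r n : ℝ) ^ d - (n : ℝ) ^ d) := by linarith
      _ = ((r n : ℝ) / n) ^ d * (n : ℝ) ^ d * (sSup S + e (r n) / (r n : ℝ) ^ d) +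
          K * (((r n : ℝ) / n) ^ d * (n : ℝ) ^ d - (n : ℝ) ^ d) := by
          rw [h3, mul_add, mul_div_cancel₀ _ hr'.ne']
          ring
      _ = _ := by ring

/-! ### Translations -/

theorem mem_translate {v x : Vertex d} {Λ : Finset (Vertex d)} :
    x ∈ translate v Λ ↔ x - v ∈ Λ := by
  simp only [translate, Finset.mem_image]
  constructor
  · rintro ⟨y, hy, rfl⟩
    simpa using hy
  · intro h
    exact ⟨_, h, sub_add_cancel x v⟩

theorem add_mem_translate {v x : Vertex d} {Λ : Finset (Vertex d)} :
    x + v ∈ translate v Λ ↔ x ∈ Λ := by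
  rw [mem_translate, add_sub_cancel_right]

theorem card_translate (v : Vertex d) (Λ : Finset (Vertex d)) : (translate v Λ).card = Λ.card :=
  Finset.card_image_of_injective _ (add_left_injective v)

theorem translate_erase (v x : Vertex d) (Λ : Finset (Vertex d)) :
    (translate v Λ).erase (x + v) = translate v (Λ.erase x) := by
  ext y
  simp only [Finset.mem_erase, mem_translate, Ne, sub_eq_iff_eq_add]

theorem integrateOut_translate (v : Vertex d) (s : Finset (Vertex d)) {F : Config E d → ℝ≥0∞}
    (hF : HeightMeasurable F) (φ : Config E d) :
    integrateOut (translate v s) (fun χ => F (shift v χ)) φ = integrateOut s F (shift v φ) := by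
  obtain ⟨ξ⟩ := φ
  exact lmarginal_image (μ := fun _ : Vertex d => E.refMeasure) (e := fun y : Vertex d => y + v)
    (add_left_injective v) s hF ξ

theorem refIntegral_translate (v : Vertex d) (Λ : Finset (Vertex d)) (x : Vertex d)
    {F : Config E d → ℝ≥0∞} (hF : HeightMeasurable F) :
    refIntegral (translate v Λ) (x + v) (fun χ => F (shift v χ)) = refIntegral Λ x F := by
  rw [refIntegral, translate_erase, integrateOut_translate v _ hF]
  rfl

theorem measurable_shift_gradAlg (v : Vertex d) {S T : Set (Vertex d)} (h : ∀ x ∈ S, x + v ∈ T) :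
    Measurable[gradAlg E T, gradAlg E S] (shift v : Config E d → Config E d) :=
  (@measurable_config_iff E d _ (gradAlg E T) S _).2 fun x hx y hy =>
    measurable_grad_of_mem (h x hx) (h y hy)

theorem shift_shift (v w : Vertex d) (φ : Config E d) : shift v (shift w φ) = shift (v + w) φ := by
  ext y
  simp only [shift, add_assoc]

theorem shift_zero (φ : Config E d) : shift 0 φ = φ := by
  ext y
  simp only [shift, add_zero]

section Translate

variable {L : AddSubgroup (Vertex d)} {A : SimpleGraph (Vertex d)} {q : Vertex d → Vertex d → ℝ}
  {Φ Ψ Ξ : GradPotential E d} {C : ℝ} {ν : Measure (Config E d)} {Λ Δ : Finset (Vertex d)}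

theorem IsSplit.periodic (H : IsSplit L A q Φ Ψ Ξ C) : Φ.IsPeriodic L := fun x hx Λ φ => by
  rw [H.eq_add, H.eq_add, H.strong.periodic x hx, H.weak.periodic x hx]

theorem subsets_translate (v : Vertex d) (Λ : Finset (Vertex d)) :
    subsets (translate v Λ) = (subsets Λ).image (translate v) := by
  ext Γ
  simp only [Finset.mem_image, mem_subsets]
  constructor
  · rintro ⟨h1, h2⟩
    refine ⟨translate (-v) Γ, ⟨fun x hx => ?_, h2.image _⟩, ?_⟩
    · rw [mem_translate, sub_neg_eq_add] at hx
      exact add_mem_translate.1 (h1 hx)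
    · ext x
      simp [mem_translate]
  · rintro ⟨Γ, ⟨h1, h2⟩, rfl⟩
    exact ⟨Finset.image_subset_image h1, h2.image _⟩

theorem translate_injective (v : Vertex d) : Function.Injective (translate v : Finset (Vertex d) → _) :=
  Finset.image_injective (add_left_injective v)

theorem weight_translate (hΦ : Φ.IsPeriodic L) {v : Vertex d} (hv : v ∈ L)
    (Λ : Finset (Vertex d)) (φ : Config E d) :
    weight Φ (translate v Λ) φ = weight Φ Λ (shift v φ) := by
  have h : Φ.interiorHamiltonian (translate v Λ) φ = Φ.interiorHamiltonian Λ (shift v φ) := by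
    change ∑ Γ ∈ subsets (translate v Λ), Φ Γ φ = ∑ Γ ∈ subsets Λ, Φ Γ (shift v φ)
    rw [subsets_translate, Finset.sum_image fun _ _ _ _ h => translate_injective v h]
    exact Finset.sum_congr rfl fun Γ _ => hΦ v hv Γ φ
  rw [weight, h, weight]

/-- No invariance of `ν` is assumed, because this is applied to laws that have been resampled at
only some of the sites. -/
theorem HasFreeEnergy.of_map_shift (hΦ : Φ.IsPeriodic L) {v : Vertex d} (hv : v ∈ L) {h : ℝ}
    (hF : HasFreeEnergy Φ (ν.map (shift v)) Λ h) : HasFreeEnergy Φ ν (translate v Λ) h := by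
  obtain ⟨f, hf, hfi, rfl⟩ := hF
  have hfm : Measurable f := hf.measurable.mono (gradAlg_le _) le_rfl
  have hlog : Measurable fun φ => Real.log (f φ).toReal :=
    Real.measurable_log.comp hfm.ennreal_toReal
  have hmp : MeasurePreserving (shift v : Config E d → Config E d) ν (ν.map (shift v)) :=
    ⟨measurable_shift v, rfl⟩
  have hsh := measurable_shift_gradAlg (E := E) v
    (S := (Λ : Set (Vertex d))) (T := (HeightModel.translate v Λ : Set (Vertex d)))
    fun x hx => add_mem_translate.2 hx
  have hsh' := measurable_shift_gradAlg (E := E) (-v)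
    (S := (HeightModel.translate v Λ : Set (Vertex d))) (T := (Λ : Set (Vertex d)))
    fun x hx => by
      have := mem_translate.1 (Finset.mem_coe.1 hx)
      rwa [sub_eq_add_neg] at this
  refine ⟨fun φ => f (shift v φ), ⟨hf.measurable.comp hsh, fun x hx g hg => ?_⟩,
    hmp.integrable_comp_of_integrable hfi, ?_⟩
  · have hg' := hg.comp hsh'
    have h1 : ∀ φ, g φ = (g ∘ shift (-v)) (shift v φ) := fun φ => by
      rw [Function.comp_apply, shift_shift, neg_add_cancel, shift_zero]
    have h2 : ∫⁻ φ, g φ ∂ν = ∫⁻ φ, (g ∘ shift (-v)) φ ∂(ν.map (shift v)) := by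
      rw [← hmp.lintegral_comp (hg'.mono (gradAlg_le _) le_rfl)]
      exact lintegral_congr h1
    have hx' := mem_translate.1 hx
    have h3 := refIntegral_translate v Λ (x - v)
      (heightMeasurable_of_gradAlg (Measurable.mul hf.measurable
        (Measurable.mul (measurable_weight Φ Λ) hg')))
    rw [h2, hf.lintegral_eq _ hx' _ hg']
    refine h3.symm.trans ?_
    rw [sub_add_cancel]
    congr 1
    funext φ
    simp only [Pi.mul_apply]
    rw [weight_translate hΦ hv, ← h1]
  · have h3 := integral_map (μ := ν) (measurable_shift v).aemeasurable
      (f := fun φ => Real.log (f φ).toReal) hlog.aestronglyMeasurable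
    exact h3.symm

theorem HasFreeEnergy.translate (hΦ : Φ.IsPeriodic L) {v : Vertex d} (hv : v ∈ L)
    (hν : ν.map (shift v) = ν) {h : ℝ} (hF : HasFreeEnergy Φ ν Λ h) :
    HasFreeEnergy Φ ν (translate v Λ) h :=
  HasFreeEnergy.of_map_shift hΦ hv (hν.symm ▸ hF)

end Translate

end

section
/-! ### Boxes -/

theorem mem_box {n : ℕ} {x : Vertex d} : x ∈ box d n ↔ ∀ i, 0 ≤ x i ∧ x i < n := by
  simp [box, Fintype.mem_piFinset]

theorem zero_mem_box {n : ℕ} (hn : 0 < n) : (0 : Vertex d) ∈ box d n :=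
  mem_box.2 fun _ => ⟨le_rfl, by simpa using hn⟩

theorem card_box (d n : ℕ) : (box d n).card = n ^ d := by
  simp [box, Fintype.card_piFinset]

theorem box_subset_box {m n : ℕ} (h : m ≤ n) : box d m ⊆ box d n := fun x hx =>
  mem_box.2 fun i => ⟨(mem_box.1 hx i).1, (mem_box.1 hx i).2.trans_le (by exact_mod_cast h)⟩

theorem card_box_sdiff {m n : ℕ} (h : m ≤ n) :
    ((box d n \ box d m).card : ℝ) = (n : ℝ) ^ d - (m : ℝ) ^ d := by
  rw [Finset.card_sdiff_of_subset (box_subset_box h), Nat.cast_sub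
    (Finset.card_le_card (box_subset_box h)), card_box, card_box]
  push_cast
  rfl

/-- The block with index `j` in the partition into boxes of side `k`. -/
def block (k : ℕ) (j : Vertex d) : Finset (Vertex d) := translate (k • j) (box d k)

theorem nsmul_apply (k : ℕ) (j : Vertex d) (i : Fin d) : (k • j) i = k * j i := by
  rw [Pi.smul_apply, nsmul_eq_mul]

theorem mem_block {k : ℕ} {j x : Vertex d} :
    x ∈ block k j ↔ ∀ i, k * j i ≤ x i ∧ x i < k * j i + k := by
  rw [block, mem_translate, mem_box]
  refine forall_congr' fun i => ?_
  simp only [Pi.sub_apply, nsmul_apply]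
  constructor <;> rintro ⟨h1, h2⟩ <;> constructor <;> linarith

theorem mem_block_iff {k : ℕ} (hk : 0 < k) {j x : Vertex d} :
    x ∈ block k j ↔ ∀ i, x i / (k : ℤ) = j i := by
  rw [mem_block]
  refine forall_congr' fun i => ?_
  have hk' : (0 : ℤ) < k := by exact_mod_cast hk
  rw [Int.ediv_eq_iff_of_pos hk']
  constructor <;> rintro ⟨h1, h2⟩ <;> constructor <;> linarith

theorem block_disjoint {k : ℕ} (hk : 0 < k) {i j : Vertex d} (h : i ≠ j) :
    Disjoint (block k i) (block k j) := by
  refine Finset.disjoint_left.2 fun x hx hx' => h ?_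
  funext l
  rw [← (mem_block_iff hk).1 hx l, ← (mem_block_iff hk).1 hx' l]

theorem biUnion_block {k : ℕ} (hk : 0 < k) (a : ℕ) :
    (box d a).biUnion (block k) = box d (a * k) := by
  ext x
  have hk' : (0 : ℤ) < k := by exact_mod_cast hk
  simp only [Finset.mem_biUnion, mem_block_iff hk]
  constructor
  · rintro ⟨j, hj, hx⟩
    refine mem_box.2 fun i => ?_
    have h1 := mem_box.1 hj i
    rw [← hx i] at h1
    refine ⟨(Int.ediv_nonneg_iff_of_pos hk').1 h1.1, ?_⟩
    push_cast
    exact (Int.ediv_lt_iff_lt_mul hk').1 h1.2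
  · intro hx
    refine ⟨fun i => x i / k, mem_box.2 fun i => ?_, fun i => rfl⟩
    have h1 := mem_box.1 hx i
    push_cast at h1
    exact ⟨Int.ediv_nonneg h1.1 hk'.le, (Int.ediv_lt_iff_lt_mul hk').2 h1.2⟩

theorem exists_near_box {m n R : ℕ} (hm : 0 < m) (hn : n ≤ m + R) {y : Vertex d}
    (hy : y ∈ box d n) : ∃ b ∈ box d m, ∀ i, |y i - b i| ≤ R := by
  -- Truncate each coordinate to the smaller box.
  refine ⟨fun i => min (y i) (m - 1), mem_box.2 fun i => ?_, fun i => ?_⟩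
  · have := (mem_box.1 hy i).1
    have hm' : (1 : ℤ) ≤ m := by exact_mod_cast hm
    constructor
    · exact le_min this (by linarith)
    · exact (min_le_right _ _).trans_lt (by linarith)
  · have h1 := mem_box.1 hy i
    have hn' : (n : ℤ) ≤ m + R := by exact_mod_cast hn
    beta_reduce
    rcases le_total (y i) (m - 1) with h | h
    · rw [min_eq_left h]; simp
    · rw [min_eq_right h, abs_of_nonneg (by linarith)]
      linarith

theorem dist1_eq_one_abs_le {x y : Vertex d} (h : dist1 x y = 1) (i : Fin d) : |x i - y i| ≤ 1 := by
  have h1 : (x i - y i).natAbs ≤ dist1 x y :=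
    Finset.single_le_sum (f := fun i => (x i - y i).natAbs) (fun _ _ => Nat.zero_le _)
      (Finset.mem_univ i)
  rw [h] at h1
  rw [Int.abs_eq_natAbs]
  exact_mod_cast h1

theorem isVanHove_box (hd : 0 < d) : IsVanHove (box d) := by
  have hcard : ∀ n, (box d n).card = n ^ d := card_box d
  refine ⟨?_, ?_⟩
  · simp_rw [hcard]
    exact tendsto_pow_atTop hd.ne'
  · have hle : ∀ n, ((boundary (box d n)).ncard : ℝ) ≤ (n + 2 : ℝ) ^ d - (n : ℝ) ^ d := by
      intro n
      -- The box enlarged by one layer on every side contains the boundary.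
      set T : Finset (Vertex d) := translate (fun _ => -1) (box d (n + 2)) with hT
      have hbT : box d n ⊆ T := fun x hx => by
        rw [hT, mem_translate, mem_box]
        intro i
        have := mem_box.1 hx i
        simp only [Pi.sub_apply]
        push_cast
        constructor <;> linarith
      have hsub : boundary (box d n) ⊆ ((T \ box d n : Finset (Vertex d)) : Set (Vertex d)) := by
        rintro x ⟨hx, y, hy, hxy⟩
        rw [Finset.mem_coe, Finset.mem_sdiff]
        refine ⟨?_, hx⟩
        rw [hT, mem_translate, mem_box]
        intro i
        have h1 := mem_box.1 hy i
        have h2 := abs_le.1 (dist1_eq_one_abs_le hxy i)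
        simp only [Pi.sub_apply]
        push_cast
        constructor <;> linarith [h2.1, h2.2]
      have h1 := Set.ncard_le_ncard hsub (Finset.finite_toSet _)
      rw [Set.ncard_coe_finset, Finset.card_sdiff_of_subset hbT, hT, card_translate, hcard,
        hcard] at h1
      have h2 : n ^ d ≤ (n + 2) ^ d := Nat.pow_le_pow_left (by omega) d
      calc ((boundary (box d n)).ncard : ℝ) ≤ (((n + 2) ^ d - n ^ d : ℕ) : ℝ) := by
            exact_mod_cast h1
        _ = _ := by rw [Nat.cast_sub h2]; push_cast; rfl
    have ht : Tendsto (fun n : ℕ => (1 + (2 : ℝ) / n) ^ d - 1) atTop (𝓝 0) := by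
      have h1 := (((tendsto_const_div_atTop_nhds_zero_nat (2 : ℝ)).const_add 1).pow d).sub_const 1
      rw [add_zero, one_pow, sub_self] at h1
      exact h1
    refine tendsto_of_tendsto_of_tendsto_of_le_of_le' tendsto_const_nhds ht
      (Eventually.of_forall fun n => by positivity) ?_
    filter_upwards [eventually_gt_atTop 0] with n hn
    have hn' : (0 : ℝ) < n := by exact_mod_cast hn
    rw [hcard, Nat.cast_pow, div_le_iff₀ (by positivity)]
    refine (hle n).trans (le_of_eq ?_)
    rw [sub_mul, ← mul_pow, add_mul, one_mul, one_mul, div_mul_cancel₀ _ hn'.ne']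

/-! ### Superadditivity along blocks and existence of the specific free energy. -/

section Limit

variable {L : AddSubgroup (Vertex d)} {A : SimpleGraph (Vertex d)} {q : Vertex d → Vertex d → ℝ}
  {Φ Ψ Ξ : GradPotential E d} {C : ℝ} {ν : Measure (Config E d)} {Λ Δ : Finset (Vertex d)}

/-- The quotient by `L` is annihilated by its order, so blocks whose side is a multiple of the index
are `L`-translates of each other. -/
theorem index_smul_mem (L : AddSubgroup (Vertex d)) {k : ℕ} (hk : L.index ∣ k) (x : Vertex d) :
    k • x ∈ L := by
  obtain ⟨m, rfl⟩ := hk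
  rw [mul_comm, mul_smul]
  exact L.nsmul_mem (L.nsmul_index_mem x) m

theorem attachCost_translate (hq : IsAdmissibleQuasimetric L q) {v : Vertex d} (hv : v ∈ L)
    (b y : Vertex d) : attachCost E q (b + v) (y + v) = attachCost E q b y := by
  rw [attachCost, heightRange, hq.invariant v hv, hq.invariant v hv]
  rfl

/-- Translation by `L` moves `b` into the box of side `L.index`, after which only finitely many
pairs remain; the sum of their costs serves as a common bound. -/
theorem exists_attachCost_le (hL : L.FiniteIndex) (hq : IsAdmissibleQuasimetric L q) (R : ℕ) :
    ∃ K : ℝ, ∀ b y : Vertex d, (∀ i, |y i - b i| ≤ R) → attachCost E q b y ≤ K := by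
  set p := L.index with hp
  have hp0 : 0 < p := Nat.pos_of_ne_zero hL.index_ne_zero
  set T : Finset (Vertex d) := Fintype.piFinset fun _ => Finset.Icc (-(R : ℤ)) (p + R) with hT
  refine ⟨∑ b ∈ box d p, ∑ y ∈ T, attachCost E q b y, fun b y hby => ?_⟩
  set j : Vertex d := fun i => b i / p with hj
  have hv : p • j ∈ L := index_smul_mem L dvd_rfl j
  have hb : b ∈ block p j := (mem_block_iff hp0).2 fun i => rfl
  have hb' : b - p • j ∈ box d p := by rwa [block, mem_translate] at hb
  have hy' : y - p • j ∈ T := by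
    rw [hT, Fintype.mem_piFinset]
    intro i
    rw [Finset.mem_Icc]
    have h1 := mem_box.1 hb' i
    have h2 := abs_le.1 (hby i)
    simp only [Pi.sub_apply] at h1 ⊢
    constructor <;> linarith [h1.1, h1.2, h2.1, h2.2]
  have h1 := attachCost_translate (E := E) hq hv (b - p • j) (y - p • j)
  rw [sub_add_cancel, sub_add_cancel] at h1
  rw [h1]
  refine le_trans ?_ (Finset.single_le_sum (f := fun b => ∑ y ∈ T, attachCost E q b y)
    (fun _ _ => Finset.sum_nonneg fun _ _ => attachCost_nonneg _ _) hb')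
  exact Finset.single_le_sum (f := fun y => attachCost E q (b - p • j) y)
    (fun _ _ => attachCost_nonneg _ _) hy'

/-- The error term in the superadditivity along blocks. -/
def blockError (E : HeightSpace) (q : Vertex d → Vertex d → ℝ) (Ξ : GradPotential E d) (k : ℕ) : ℝ :=
  (lowerExteriorBound Ξ (box d k)).toReal + ∑ i, attachCost E q (-Pi.single i 1) 0

/-- Blocks are split off one at a time. Keeping the index set `J` a lower set guarantees that the
block split off always has a neighbour among the remaining ones, so each of the `n` splittings pays
only the cost of one nearest-neighbour link. -/
theorem IsSplit.superadditive_blocks (H : IsSplit L A q Φ Ψ Ξ C) (hν : IsLipschitzMeasure q ν)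
    (hinv : ∀ x ∈ L, ν.map (shift x) = ν) {k : ℕ} (hk : 0 < k) (hkL : L.index ∣ k) {h₀ : ℝ}
    (h0 : HasFreeEnergy Φ ν (box d k) h₀) (n : ℕ) (J : Finset (Vertex d)) (hcard : J.card = n + 1)
    (hJ0 : ∀ j ∈ J, 0 ≤ j) (hJ : ∀ j ∈ J, ∀ i, 0 ≤ i → i ≤ j → i ∈ J) {h : ℝ}
    (hF : HasFreeEnergy Φ ν (J.biUnion (block k)) h) :
    ((n : ℝ) + 1) * h₀ ≤ h + n * blockError E q Ξ k := by
  have := hν.isProb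
  have hblock : ∀ j, HasFreeEnergy Φ ν (block k j) h₀ := fun j =>
    h0.translate H.periodic (index_smul_mem L hkL j) (hinv _ (index_smul_mem L hkL j))
  have hne : ∀ j : Vertex d, k • j ∈ block k j := fun j => mem_block.2 fun i => by
    have hk' : (0 : ℤ) < k := by exact_mod_cast hk
    simp only [nsmul_apply]
    constructor <;> linarith
  induction n generalizing J h with
  | zero =>
    obtain ⟨j, rfl⟩ := Finset.card_eq_one.1 hcard
    rw [Finset.singleton_biUnion] at hF
    rw [hF.unique H (hblock j) ⟨_, hne j⟩]
    simp
  | succ n ih =>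
    have hJne : J.Nonempty := Finset.card_pos.1 (by omega)
    -- An index of maximal coordinate sum is maximal in the product order, so its removal leaves a
    -- lower set.
    obtain ⟨j, hj, hmax⟩ := Finset.exists_max_image J (fun j => ∑ i, j i) hJne
    have hJerase : (J.erase j).card = n + 1 := by
      rw [Finset.card_erase_of_mem hj, hcard]
      rfl
    have hlower : ∀ j' ∈ J.erase j, ∀ i, 0 ≤ i → i ≤ j' → i ∈ J.erase j := by
      intro j' hj' i hi hij
      obtain ⟨hne', hj''⟩ := Finset.mem_erase.1 hj'
      refine Finset.mem_erase.2 ⟨?_, hJ j' hj'' i hi hij⟩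
      rintro rfl
      have hlt : i < j' := lt_of_le_of_ne hij (Ne.symm hne')
      obtain ⟨h1, l, hl⟩ := Pi.lt_def.1 hlt
      have h2 := Finset.sum_lt_sum (fun i _ => h1 i) ⟨l, Finset.mem_univ l, hl⟩
      exact absurd (hmax j' hj'') (not_le.2 h2)
    have hjne : j ≠ 0 := by
      rintro rfl
      obtain ⟨j', hj'⟩ : (J.erase 0).Nonempty := Finset.card_pos.1 (by omega)
      obtain ⟨hne', hj'⟩ := Finset.mem_erase.1 hj'
      have hlt : 0 < j' := lt_of_le_of_ne (hJ0 j' hj') (Ne.symm hne')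
      obtain ⟨h1, l, hl⟩ := Pi.lt_def.1 hlt
      have h2 := Finset.sum_lt_sum (fun i _ => h1 i) ⟨l, Finset.mem_univ l, hl⟩
      exact absurd (hmax j' hj') (not_le.2 h2)
    obtain ⟨i, hi⟩ : ∃ i, j i ≠ 0 := Function.ne_iff.1 hjne
    have hi1 : 1 ≤ j i := Int.add_one_le_iff.2 (lt_of_le_of_ne (hJ0 j hj i) (Ne.symm hi))
    have hpred : j - Pi.single i 1 ∈ J.erase j := by
      refine Finset.mem_erase.2 ⟨fun h => ?_, hJ j hj _ ?_ ?_⟩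
      · have := congrFun h i
        simp at this
      · intro l
        by_cases hl : l = i
        · subst hl; simpa using hi1
        · simpa [hl] using hJ0 j hj l
      · intro l
        by_cases hl : l = i
        · subst hl; simp
        · simp [hl]
    -- The lower corner `k • j` of the last block is adjacent to this vertex of the preceding block
    -- in direction `i`.
    have hb : k • j - Pi.single i 1 ∈ (J.erase j).biUnion (block k) := by
      refine Finset.mem_biUnion.2 ⟨_, hpred, mem_block.2 fun l => ?_⟩
      have hk' : (1 : ℤ) ≤ k := by exact_mod_cast hk
      by_cases hl : l = i
      · subst hl
        simp only [Pi.sub_apply, nsmul_apply, Pi.single_eq_same, mul_sub, mul_one]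
        constructor <;> linarith
      · simp only [Pi.sub_apply, nsmul_apply, Pi.single_eq_of_ne hl, sub_zero]
        constructor <;> linarith
    have hdisj : Disjoint ((J.erase j).biUnion (block k)) (block k j) :=
      (Finset.disjoint_biUnion_left _ _ _).2 fun j' hj' =>
        block_disjoint hk (Finset.mem_erase.1 hj').1
    have hU : J.biUnion (block k) = (J.erase j).biUnion (block k) ∪ block k j := by
      conv_lhs => rw [← Finset.insert_erase hj, Finset.biUnion_insert, Finset.union_comm]
    rw [hU] at hF
    obtain ⟨h₁, h₂, hF₁, hF₂, hle⟩ := H.superadditive hν hdisj hb (hne j) hF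
    have h3 := hF₂.unique H (hblock j) ⟨_, hne j⟩
    have h4 := ih (J.erase j) hJerase (fun j' hj' => hJ0 j' (Finset.mem_of_mem_erase hj')) hlower hF₁
    -- By `L`-invariance the link may be moved to the origin; the sum over all directions removes
    -- the dependence on `i`.
    have h5 : attachCost E q (k • j - Pi.single i 1) (k • j) ≤
        ∑ i, attachCost E q (-Pi.single i 1) (0 : Vertex d) := by
      have h6 := attachCost_translate (E := E) H.strong.constraint.quasimetric
        (index_smul_mem L hkL j) (-Pi.single i 1) 0
      rw [zero_add, neg_add_eq_sub] at h6
      rw [h6]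
      exact Finset.single_le_sum (f := fun i => attachCost E q (-Pi.single i 1) (0 : Vertex d))
        (fun _ _ => attachCost_nonneg _ _) (Finset.mem_univ i)
    have h7 : lowerExteriorBound Ξ (block k j) = lowerExteriorBound Ξ (box d k) :=
      H.weak.amenable.invariant _ (index_smul_mem L hkL j) _
    rw [h7] at hle
    push_cast
    simp only [blockError] at h4 ⊢
    linarith

theorem IsSplit.hasFreeEnergy_box (H : IsSplit L A q Φ Ψ Ξ C) (hν : IsLipschitzMeasure q ν)
    (hL : L.FiniteIndex) (R : ℕ) :
    ∃ K : ℝ, ∀ m n : ℕ, 0 < m → m ≤ n → n ≤ m + R → ∀ h, HasFreeEnergy Φ ν (box d n) h →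
      ∃ h₁, HasFreeEnergy Φ ν (box d m) h₁ ∧ h₁ ≤ h + K * ((n : ℝ) ^ d - (m : ℝ) ^ d) := by
  obtain ⟨K, hK⟩ := exists_attachCost_le (E := E) hL H.strong.constraint.quasimetric R
  refine ⟨C + K, fun m n hm hmn hn h hF => ?_⟩
  have h1 := H.hasFreeEnergy_subset hν (K := K) (box_subset_box hmn) (fun y hy => by
    obtain ⟨b, hb, hby⟩ := exists_near_box hm hn hy
    exact ⟨b, hb, hK b y hby⟩) hF
  rwa [card_box_sdiff hmn] at h1

/-- The Fekete argument applies because blocks give superadditivity, a layer between two boxes costs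
a constant per vertex, and the block error is of lower order than the volume by amenability. -/
theorem IsSplit.exists_tendsto (H : IsSplit L A q Φ Ψ Ξ C) (hd : 0 < d) (hL : L.FiniteIndex)
    (hν : IsLipschitzMeasure q ν) (hinv : ∀ x ∈ L, ν.map (shift x) = ν) {h : ℕ → ℝ}
    (hh : ∀ n, 0 < n → HasFreeEnergy Φ ν (box d n) (h n))
    (hbdd : ∃ B : ℝ, ∃ᶠ n : ℕ in atTop, h n ≤ B * (n : ℝ) ^ d) :
    ∃ l : ℝ, Tendsto (fun n => h n / (n : ℝ) ^ d) atTop (𝓝 l) := by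
  have := hν.isProb
  have hp : 0 < L.index := Nat.pos_of_ne_zero hL.index_ne_zero
  refine exists_tendsto_of_superadditive hp (e := blockError E q Ξ) ?_ ?_ hbdd ?_
  · intro k hk hkL a ha
    have hF := hh (a * k) (Nat.mul_pos ha hk)
    rw [← biUnion_block hk] at hF
    have had : 0 < a ^ d := Nat.pow_pos ha
    have hcard : (box d a).card = (a ^ d - 1) + 1 := by
      rw [card_box]
      omega
    have h1 := H.superadditive_blocks hν hinv hk hkL (hh k hk) (a ^ d - 1) (box d a) hcard
      (fun j hj i => (mem_box.1 hj i).1) (fun j hj i hi hij => mem_box.2 fun l =>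
        ⟨hi l, (hij l).trans_lt (mem_box.1 hj l).2⟩) hF
    have h2 : ((a ^ d - 1 : ℕ) : ℝ) = (a : ℝ) ^ d - 1 := by
      rw [Nat.cast_sub had]
      push_cast
      rfl
    have h3 : 0 ≤ blockError E q Ξ k := add_nonneg ENNReal.toReal_nonneg
      (Finset.sum_nonneg fun _ _ => attachCost_nonneg _ _)
    rw [h2, sub_add_cancel] at h1
    linarith
  · intro R
    obtain ⟨K, hK⟩ := H.hasFreeEnergy_box hν hL R
    refine ⟨K, fun m n hm hmn hn => ?_⟩
    obtain ⟨h₁, hF₁, hle⟩ := hK m n hm hmn hn _ (hh n (hm.trans_le hmn))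
    rwa [(hh m hm).unique H hF₁ ⟨0, zero_mem_box hm⟩]
  · have h1 := (ENNReal.tendsto_toReal ENNReal.zero_ne_top).comp
      (H.weak.amenable.sublinear _ (isVanHove_box hd))
    have h2 : Tendsto (fun k : ℕ => (k : ℝ) ^ d) atTop atTop :=
      (tendsto_pow_atTop hd.ne').comp tendsto_natCast_atTop_atTop
    have h3 := h1.add (h2.const_div_atTop (∑ i, attachCost E q (-Pi.single i 1) (0 : Vertex d)))
    rw [ENNReal.toReal_zero, add_zero] at h3
    refine h3.congr fun k => ?_
    rw [blockError, add_div, Function.comp_apply, ENNReal.toReal_div, card_box]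
    simp

theorem hasSpecificFreeEnergy_of_tendsto (H : IsSplit L A q Φ Ψ Ξ C) [IsProbabilityMeasure ν]
    {h : ℕ → ℝ} (hh : ∀ n, 0 < n → HasFreeEnergy Φ ν (box d n) (h n)) {l : ℝ}
    (ht : Tendsto (fun n => h n / (n : ℝ) ^ d) atTop (𝓝 l)) : HasSpecificFreeEnergy Φ ν l := by
  have h1 := (continuous_coe_real_ereal.tendsto l).comp ht
  refine h1.congr' ?_
  filter_upwards [eventually_gt_atTop 0] with n hn
  rw [(hh n hn).freeEnergy_eq H (zero_mem_box hn), Function.comp_apply, EReal.coe_div]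

end Limit

end

section
/-! ### Resampling the heights in a finite set -/

/-- The height function with the heights in `Λ` replaced by `ψ`, relative to the height at `b`. -/
def propose (Λ : Finset (Vertex d)) (b : Vertex d) (φ : Config E d) (ψ : Λ → E) : Config E d :=
  glue Λ φ fun y => ψ y + φ b

/-- Relative to the height at `b`, each new height is a coordinate of the proposal or an old height
difference. Measuring the proposal from `b` thus keeps the operation within gradient events. -/
theorem measurable_propose {X : Type*} [MeasurableSpace X] (Λ : Finset (Vertex d)) {b : Vertex d}
    {S : Set (Vertex d)} (hb : b ∈ S) {f : X → Config E d} (hf : Measurable[_, gradAlg E S] f)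
    {g : X → Λ → E} (hg : Measurable g) :
    Measurable[_, gradAlg E S] fun a => propose Λ b (f a) (g a) := by
  have key : ∀ y ∈ S, Measurable fun a => propose Λ b (f a) (g a) y - f a b := by
    intro y hy
    by_cases h : y ∈ Λ
    · simp only [propose, glue_apply_mem _ _ h, add_sub_cancel_right]
      exact (measurable_pi_apply (⟨y, h⟩ : Λ)).comp hg
    · simp only [propose, glue_apply_notMem _ _ h]
      exact measurable_config_iff.1 hf b hb y hy
  refine measurable_config_iff.2 fun x hx y hy => ?_
  have e : (fun a => propose Λ b (f a) (g a) y - propose Λ b (f a) (g a) x) =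
      fun a => (propose Λ b (f a) (g a) y - f a b) - (propose Λ b (f a) (g a) x - f a b) := by
    funext a
    rw [sub_sub_sub_cancel_right]
  rw [e]
  exact (key y hy).sub (key x hx)

open Classical in
/-- The proposal is accepted if it is in `S`. -/
def resampleStep (Λ : Finset (Vertex d)) (b : Vertex d) (S : Set (Config E d)) (φ : Config E d)
    (ψ : Λ → E) : Config E d :=
  if propose Λ b φ ψ ∈ S then propose Λ b φ ψ else φ

theorem measurable_resampleStep (Λ : Finset (Vertex d)) (b : Vertex d) {S : Set (Config E d)}
    (hS : MeasurableSet S) :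
    Measurable fun p : Config E d × (Λ → E) => resampleStep Λ b S p.1 p.2 := by
  have h : Measurable fun p : Config E d × (Λ → E) => propose Λ b p.1 p.2 :=
    measurable_propose Λ (Set.mem_univ b) measurable_fst measurable_snd
  exact Measurable.ite (h hS) h measurable_fst

section Drop

variable {L : AddSubgroup (Vertex d)} {A : SimpleGraph (Vertex d)} {q : Vertex d → Vertex d → ℝ}
  {Φ Ψ Ξ : GradPotential E d} {C : ℝ} {ρ : Measure (Config E d)} {Λ D : Finset (Vertex d)}
  {b : Vertex d} {S : Set (Config E d)} {P : Measure (Λ → E)} {u : ℝ≥0∞}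

theorem lintegral_propose_le (hP : P ≤ u • Measure.pi fun _ : Λ => E.refMeasure)
    {F : Config E d → ℝ≥0∞} (φ : Config E d) :
    ∫⁻ ψ, F (propose Λ b φ ψ) ∂P ≤ u * integrateOut Λ F φ := by
  refine (lintegral_mono' hP le_rfl).trans ?_
  rw [lintegral_smul_measure, integrateOut_add_const Λ φ (φ b), smul_eq_mul]
  rfl

theorem measurable_lintegral_propose [SFinite P] (hb : b ∈ D) {F : Config E d → ℝ≥0∞}
    (hF : Measurable[gradAlg E (D : Set (Vertex d))] F) :
    Measurable[gradAlg E (D : Set (Vertex d))] fun φ => ∫⁻ ψ, F (propose Λ b φ ψ) ∂P := by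
  let m := gradAlg E (D : Set (Vertex d))
  have h := @measurable_propose E d _ (@Prod.instMeasurableSpace _ _ m _) Λ b D hb
    (fun p : Config E d × (Λ → E) => p.1) (@measurable_fst _ _ m _) (fun p => p.2)
    (@measurable_snd _ _ m _)
  exact @Measurable.lintegral_prod_right' _ _ m _ P _ _ (hF.comp h)

/-- The proposed heights take over the role of the old heights in `Λ`. Replacing the old weight by
that of the proposal costs the exponential; the old heights then survive only in the indicator of
`boundedAt`, and integrating them out gives the ball volume. The factor `u` is the density bound for
the proposals. -/
theorem IsSplit.refIntegral_propose_le (H : IsSplit L A q Φ Ψ Ξ C) (hΛD : Λ ⊆ D)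
    (hbΛ : b ∉ Λ) (hS : MeasurableSet[gradAlg E (D : Set (Vertex d))] S) {c r : ℝ} (hc : 0 ≤ c)
    (hSc : ∀ φ ∈ S, strongPart Ψ ((subsets D).filter fun Γ => ∃ x ∈ Γ, x ∈ Λ) φ ≤ ENNReal.ofReal c)
    (hP : P ≤ u • Measure.pi fun _ : Λ => E.refMeasure)
    {g : Config E d → ℝ≥0∞} (hg : Measurable[gradAlg E (D : Set (Vertex d))] g) :
    refIntegral D b (fun φ => (boundedAt E Λ b r).indicator 1 φ *
        (weight Φ D φ * ∫⁻ ψ, S.indicator g (propose Λ b φ ψ) ∂P)) ≤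
      (u * ENNReal.ofReal (Real.exp (c + 2 * (C * Λ.card))) *
        (Measure.pi fun _ : Λ => E.refMeasure) (Set.univ.pi fun _ => heightBall E r)) *
        refIntegral D b (fun φ => weight Φ D φ * S.indicator g φ) := by
  set B : Config E d → ℝ≥0∞ := (boundedAt E Λ b r).indicator 1 with hB
  set ec := ENNReal.ofReal (Real.exp (c + 2 * (C * Λ.card))) with hec
  set V := (Measure.pi fun _ : Λ => E.refMeasure) (Set.univ.pi fun _ => heightBall E r) with hV
  set F : Config E d → ℝ≥0∞ := fun φ => weight Φ D φ * S.indicator g φ with hF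
  have hFm : Measurable[gradAlg E (D : Set (Vertex d))] F :=
    Measurable.mul (measurable_weight Φ D) (Measurable.indicator hg hS)
  have hFh := heightMeasurable_of_gradAlg hFm
  have hBm : HeightMeasurable B := heightMeasurable_of_gradAlg (S := Set.univ)
    (Measurable.indicator measurable_const
      (measurableSet_boundedAt (fun _ _ => Set.mem_univ _) (Set.mem_univ b) r))
  -- On `S` the strong energy near `Λ` is at most `c`, so the weight of `φ` is bounded by a multiple
  -- of the weight of the proposal.
  have h1 : ∀ φ : Config E d, weight Φ D φ * ∫⁻ ψ, S.indicator g (propose Λ b φ ψ) ∂P ≤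
      u * ec * integrateOut Λ F φ := by
    intro φ
    have hSm : HeightMeasurable (S.indicator g) :=
      heightMeasurable_of_gradAlg (Measurable.indicator hg hS)
    calc weight Φ D φ * ∫⁻ ψ, S.indicator g (propose Λ b φ ψ) ∂P
        ≤ weight Φ D φ * (u * integrateOut Λ (S.indicator g) φ) :=
          mul_le_mul_right (lintegral_propose_le hP φ) _
      _ = u * (weight Φ D φ * integrateOut Λ (S.indicator g) φ) := by ring
      _ ≤ u * (ec * integrateOut Λ F φ) := by
          refine mul_le_mul_right ?_ _
          rw [integrateOut, integrateOut, ← lintegral_const_mul _ (measurable_glue_height Λ φ hSm),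
            ← lintegral_const_mul _ (measurable_glue_height Λ φ hFh)]
          refine lintegral_mono fun ψ => ?_
          by_cases hψ : glue Λ φ ψ ∈ S
          · simp only [hF]
            rw [← mul_assoc]
            refine mul_le_mul_left (H.weight_le_of_eq_off (Δ := Λ) (fun y hy => ?_) hc
              (hSc _ hψ)) _
            rw [glue_apply_notMem _ _ hy]
          · simp [Set.indicator_of_notMem hψ]
      _ = _ := by ring
  -- As `b ∉ Λ`, its height is fixed during the integration; translating by `φ b` turns the event
  -- into a product of balls.
  have h2 : ∀ φ : Config E d, integrateOut Λ B φ ≤ V := by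
    intro φ
    rw [integrateOut_add_const Λ φ (φ b), hV, ← lintegral_indicator_one
      (MeasurableSet.univ_pi fun _ => measurableSet_heightBall E r)]
    refine lintegral_mono fun ψ => ?_
    by_cases h : (glue Λ φ fun y => ψ y + φ b) ∈ boundedAt E Λ b r
    · have h3 : ψ ∈ Set.univ.pi fun _ : Λ => heightBall E r := fun y _ => by
        have h4 := h y y.2
        rwa [glue_apply_mem _ _ y.2, glue_apply_notMem _ _ hbΛ, add_sub_cancel_right] at h4
      rw [Set.indicator_of_mem h3]
      exact Set.indicator_le_self' (f := (1 : Config E d → ℝ≥0∞)) (fun _ _ => zero_le) _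
    · simp only [hB, Set.indicator_of_notMem h, zero_le]
  have hsplit : D.erase b = (D.erase b \ Λ) ∪ Λ := by
    rw [Finset.sdiff_union_of_subset]
    exact fun y hy => Finset.mem_erase.2 ⟨fun e => hbΛ (e ▸ hy), hΛD hy⟩
  have hIF : HeightMeasurable (integrateOut Λ F) := hFh.integrateOut Λ
  -- The inner integral no longer depends on the heights in `Λ`, so it comes out of the outer one.
  have h3 : ∀ φ : Config E d, integrateOut Λ (fun χ => integrateOut Λ F χ * B χ) φ ≤
      V * integrateOut Λ F φ := by
    intro φ
    rw [integrateOut_mul_left hBm, mul_comm]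
    · exact mul_le_mul_left (h2 φ) _
    · intro ψ
      exact lmarginal_congr (fun _ : Vertex d => E.refMeasure) (fun ξ : Vertex d → E => F ⟨ξ⟩)
        fun y hy => glue_apply_notMem φ ψ hy
  calc refIntegral D b (fun φ => B φ * (weight Φ D φ *
          ∫⁻ ψ, S.indicator g (propose Λ b φ ψ) ∂P))
      ≤ refIntegral D b (fun φ => (u * ec) * (integrateOut Λ F φ * B φ)) := by
        refine refIntegral_mono fun φ => ?_
        calc B φ * (weight Φ D φ * ∫⁻ ψ, S.indicator g (propose Λ b φ ψ) ∂P)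
            ≤ B φ * (u * ec * integrateOut Λ F φ) := mul_le_mul_right (h1 φ) _
          _ = _ := by ring
    _ = (u * ec) * refIntegral D b (fun φ => integrateOut Λ F φ * B φ) :=
        refIntegral_const_mul (hIF.mul hBm) _
    _ ≤ (u * ec) * (V * refIntegral D b F) := by
        refine mul_le_mul_right ?_ _
        rw [refIntegral, refIntegral, hsplit,
          integrateOut_union Finset.sdiff_disjoint (hIF.mul hBm),
          integrateOut_union Finset.sdiff_disjoint hFh, ← integrateOut_const_mul _ hIF]
        exact integrateOut_mono h3 0
    _ = _ := by ring

/-- Resampling lowers the free energy, if the proposals are spread out and if the event in which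
they are accepted is unlikely at the start. -/
theorem IsSplit.hasFreeEnergy_resampleStep (H : IsSplit L A q Φ Ψ Ξ C) (hΛD : Λ ⊆ D) (hbD : b ∈ D)
    (hbΛ : b ∉ Λ) (hS : MeasurableSet[gradAlg E (D : Set (Vertex d))] S) {c r : ℝ} (hc : 0 ≤ c)
    (hSc : ∀ φ ∈ S, strongPart Ψ ((subsets D).filter fun Γ => ∃ x ∈ Γ, x ∈ Λ) φ ≤ ENNReal.ofReal c)
    [IsProbabilityMeasure P] (hP : P ≤ u • Measure.pi fun _ : Λ => E.refMeasure)
    (hr : ∀ φ ∈ lipschitzSet E q, φ ∈ boundedAt E Λ b r)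
    (hu : 2 * (u * ENNReal.ofReal (Real.exp (c + 2 * (C * Λ.card))) *
      (Measure.pi fun _ : Λ => E.refMeasure) (Set.univ.pi fun _ => heightBall E r)) ≤
        ENNReal.ofReal (Real.exp (-2)))
    (hρ : IsLipschitzMeasure q ρ)
    (hρ' : IsLipschitzMeasure q ((ρ.prod P).map fun p => resampleStep Λ b S p.1 p.2))
    {a : ℝ} (ha : (ρ.prod P) {p | propose Λ b p.1 p.2 ∈ S} = ENNReal.ofReal a) (ha0 : 0 ≤ a)
    (hSa : ρ S ≤ ENNReal.ofReal a) {h : ℝ} (hF : HasFreeEnergy Φ ρ D h) :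
    ∃ h', HasFreeEnergy Φ ((ρ.prod P).map fun p => resampleStep Λ b S p.1 p.2) D h' ∧
      h' ≤ h - a := by
  have := hρ.isProb
  have := hρ'.isProb
  set ρ' := (ρ.prod P).map fun p => resampleStep Λ b S p.1 p.2 with hρdef
  set k := u * ENNReal.ofReal (Real.exp (c + 2 * (C * Λ.card))) *
    (Measure.pi fun _ : Λ => E.refMeasure) (Set.univ.pi fun _ => heightBall E r) with hk
  obtain ⟨f, hf, hfi, rfl⟩ := hF
  have hSu : MeasurableSet S := gradAlg_le _ _ hS
  have hprop : Measurable fun p : Config E d × (Λ → E) => propose Λ b p.1 p.2 :=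
    measurable_propose Λ (Set.mem_univ b) measurable_fst measurable_snd
  have hstep := measurable_resampleStep Λ b hSu
  have hacc : MeasurableSet {p : Config E d × (Λ → E) | propose Λ b p.1 p.2 ∈ S} := hprop hSu
  -- The indicator of `boundedAt` may be inserted because `ρ` is supported on Lipschitz functions;
  -- it is what makes the integral over the old heights finite.
  have key : ∀ v g : Config E d → ℝ≥0∞, Measurable[gradAlg E (D : Set (Vertex d))] v →
      Measurable[gradAlg E (D : Set (Vertex d))] g →
      ∫⁻ p, v p.1 * S.indicator g (propose Λ b p.1 p.2) ∂(ρ.prod P) =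
        refIntegral D b (fun φ => (f φ * v φ) * ((boundedAt E Λ b r).indicator 1 φ *
          (weight Φ D φ * ∫⁻ ψ, S.indicator g (propose Λ b φ ψ) ∂P))) := by
    intro v g hv hg
    have hg' : Measurable[gradAlg E (D : Set (Vertex d))] (S.indicator g) :=
      Measurable.indicator hg hS
    have hgu : Measurable (S.indicator g) := hg'.mono (gradAlg_le _) le_rfl
    have hvu : Measurable v := hv.mono (gradAlg_le _) le_rfl
    have hm : Measurable fun p : Config E d × (Λ → E) =>
        v p.1 * S.indicator g (propose Λ b p.1 p.2) :=
      (hvu.comp measurable_fst).mul (hgu.comp hprop)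
    rw [lintegral_prod _ hm.aemeasurable]
    have h1 : ∀ φ : Config E d, ∫⁻ ψ, v φ * S.indicator g (propose Λ b φ ψ) ∂P =
        v φ * ∫⁻ ψ, S.indicator g (propose Λ b φ ψ) ∂P := fun φ =>
      lintegral_const_mul _ (hgu.comp (hprop.comp measurable_prodMk_left))
    simp only [h1]
    have h2 : ∫⁻ φ, v φ * ∫⁻ ψ, S.indicator g (propose Λ b φ ψ) ∂P ∂ρ =
        ∫⁻ φ, (boundedAt E Λ b r).indicator 1 φ *
          (v φ * ∫⁻ ψ, S.indicator g (propose Λ b φ ψ) ∂P) ∂ρ := by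
      refine lintegral_congr_ae ?_
      filter_upwards [hρ.ae_mem] with φ hφ
      rw [Set.indicator_of_mem (hr φ hφ), Pi.one_apply, one_mul]
    have hBm : Measurable[gradAlg E (D : Set (Vertex d))]
        ((boundedAt E Λ b r).indicator (1 : Config E d → ℝ≥0∞)) :=
      Measurable.indicator measurable_const
        (measurableSet_boundedAt (fun y hy => Finset.mem_coe.2 (hΛD hy)) hbD r)
    have hm' : Measurable[gradAlg E (D : Set (Vertex d))] fun φ : Config E d =>
        (boundedAt E Λ b r).indicator (1 : Config E d → ℝ≥0∞) φ *
          (v φ * ∫⁻ ψ, S.indicator g (propose Λ b φ ψ) ∂P) :=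
      Measurable.mul hBm (Measurable.mul hv (measurable_lintegral_propose hbD hg'))
    rw [h2, hf.lintegral_eq b hbD _ hm']
    congr 1
    funext φ
    ring
  -- The new law charges `T` through rejected proposals, which leave `ρ` unchanged, or through
  -- accepted ones, which are dominated by the weighted reference measure. Both vanish when `T` is
  -- null for that measure.
  obtain ⟨f', hf'⟩ : ∃ f', HasDensity Φ ρ' D f' := by
    refine exists_hasDensity (H.weight_ne_top D) hbD fun T hT h0 => ?_
    have hTu : MeasurableSet T := gradAlg_le _ _ hT
    have hT1 : Measurable[gradAlg E (D : Set (Vertex d))] (T.indicator (1 : Config E d → ℝ≥0∞)) :=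
      Measurable.indicator measurable_const hT
    have hwT : HeightMeasurable fun φ => weight Φ D φ * T.indicator 1 φ :=
      heightMeasurable_of_gradAlg (Measurable.mul (measurable_weight Φ D) hT1)
    have h1 : ρ T = 0 := by
      rw [← lintegral_indicator_one hTu, hf.lintegral_eq b hbD _ hT1]
      exact refIntegral_mul_eq_zero hwT h0
    have h2 : (ρ.prod P) {p | propose Λ b p.1 p.2 ∈ S ∩ T} = 0 := by
      have h3 := key (fun _ => 1) _ measurable_const hT1
      have h4 : refIntegral D b (fun φ => weight Φ D φ * S.indicator (T.indicator 1) φ) = 0 := by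
        refine le_antisymm ((refIntegral_mono fun φ => ?_).trans h0.le) (zero_le)
        exact mul_le_mul_right (Set.indicator_le_self' (fun _ _ => zero_le) φ) _
      have h5 := H.refIntegral_propose_le hΛD hbΛ hS hc hSc (r := r) hP hT1
      rw [h4, mul_zero] at h5
      have hm : Measurable[gradAlg E (D : Set (Vertex d))] fun φ : Config E d =>
          (boundedAt E Λ b r).indicator (1 : Config E d → ℝ≥0∞) φ * (weight Φ D φ *
            ∫⁻ ψ, S.indicator (T.indicator 1) (propose Λ b φ ψ) ∂P) :=
        Measurable.mul (Measurable.indicator measurable_const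
          (measurableSet_boundedAt (fun y hy => Finset.mem_coe.2 (hΛD hy)) hbD r))
        (Measurable.mul (measurable_weight Φ D) (measurable_lintegral_propose hbD
          (Measurable.indicator hT1 hS)))
      rw [refIntegral_mul_eq_zero (heightMeasurable_of_gradAlg hm)
        (le_antisymm h5 zero_le)] at h3
      have hST : MeasurableSet {p : Config E d × (Λ → E) | propose Λ b p.1 p.2 ∈ S ∩ T} :=
        hprop (hSu.inter hTu)
      rw [← h3, ← lintegral_indicator_one hST]
      refine lintegral_congr fun p => ?_
      rw [one_mul, Set.indicator_indicator]
      rfl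
    rw [hρdef, Measure.map_apply hstep hTu]
    refine measure_mono_null (t := Prod.fst ⁻¹' T ∪ {p | propose Λ b p.1 p.2 ∈ S ∩ T}) ?_
      (measure_union_null ?_ h2)
    · intro p hp
      by_cases h : propose Λ b p.1 p.2 ∈ S
      · right
        rw [Set.mem_preimage, resampleStep, if_pos h] at hp
        exact ⟨h, hp⟩
      · left
        rwa [Set.mem_preimage, resampleStep, if_neg h] at hp
    · rw [← Measure.map_apply measurable_fst hTu, Measure.map_fst_prod, measure_univ, one_smul, h1]
  have hfu : Measurable f := hf.measurable.mono (gradAlg_le _) le_rfl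
  have hfu' : Measurable f' := hf'.measurable.mono (gradAlg_le _) le_rfl
  classical
  -- The old density times `w` is the comparison function in Gibbs' inequality. The value `exp (-2)`
  -- contributes `-2 * a` to its logarithmic integral, of which `a` will be spent on the
  -- normalization `1 + a`.
  set w : Config E d × (Λ → E) → ℝ≥0∞ := fun p =>
    if propose Λ b p.1 p.2 ∈ S then ENNReal.ofReal (Real.exp (-2)) else 1 with hw
  have hwm : Measurable w := Measurable.ite hacc measurable_const measurable_const
  have hw0 : ∀ p, w p ≠ 0 ∧ w p ≠ ⊤ := by
    intro p
    simp only [hw]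
    split_ifs
    · exact ⟨(ENNReal.ofReal_pos.2 (Real.exp_pos _)).ne', ENNReal.ofReal_ne_top⟩
    · simp
  have hfst : MeasurePreserving (Prod.fst : Config E d × (Λ → E) → Config E d) (ρ.prod P) ρ :=
    measurePreserving_fst
  have hmp : MeasurePreserving (fun p : Config E d × (Λ → E) => resampleStep Λ b S p.1 p.2)
      (ρ.prod P) ρ' := ⟨hstep, rfl⟩
  have hFae : ∀ᵐ p ∂(ρ.prod P), f p.1 ≠ 0 ∧ f p.1 ≠ ⊤ :=
    hfst.quasiMeasurePreserving.ae (hf.ae_ne hbD)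
  have hGae : ∀ᵐ p ∂(ρ.prod P), f' (resampleStep Λ b S p.1 p.2) ≠ 0 ∧
      f' (resampleStep Λ b S p.1 p.2) ≠ ⊤ :=
    hmp.quasiMeasurePreserving.ae (hf'.ae_ne hbD)
  have hlogw : ∀ p, Real.log (w p).toReal =
      {p : Config E d × (Λ → E) | propose Λ b p.1 p.2 ∈ S}.indicator (fun _ => (-2 : ℝ)) p := by
    intro p
    by_cases h : propose Λ b p.1 p.2 ∈ S
    · rw [Set.indicator_of_mem (show p ∈ {p | propose Λ b p.1 p.2 ∈ S} from h)]
      simp only [hw, if_pos h]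
      rw [ENNReal.toReal_ofReal (Real.exp_nonneg _), Real.log_exp]
    · rw [Set.indicator_of_notMem (show p ∉ {p | propose Λ b p.1 p.2 ∈ S} from h)]
      simp [hw, if_neg h]
  have hlogF : ∀ᵐ p ∂(ρ.prod P), Real.log (f p.1).toReal +
      {p : Config E d × (Λ → E) | propose Λ b p.1 p.2 ∈ S}.indicator (fun _ => (-2 : ℝ)) p =
        Real.log (f p.1 * w p).toReal := by
    filter_upwards [hFae] with p hp
    rw [ENNReal.toReal_mul, Real.log_mul (ENNReal.toReal_pos hp.1 hp.2).ne'
      (ENNReal.toReal_pos (hw0 p).1 (hw0 p).2).ne', hlogw]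
  have hi1 : Integrable (fun p : Config E d × (Λ → E) => Real.log (f p.1).toReal) (ρ.prod P) :=
    hfst.integrable_comp_of_integrable hfi
  have hi2 : Integrable ({p : Config E d × (Λ → E) | propose Λ b p.1 p.2 ∈ S}.indicator
      (fun _ => (-2 : ℝ))) (ρ.prod P) := (integrable_const _).indicator hacc
  have hint : ∫ p, Real.log (f p.1 * w p).toReal ∂(ρ.prod P) =
      ∫ φ, Real.log (f φ).toReal ∂ρ - 2 * a := by
    rw [← integral_congr_ae hlogF, integral_add hi1 hi2, integral_indicator_const _ hacc,
      Measure.real, ha, ENNReal.toReal_ofReal ha0]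
    have h1 := integral_map (μ := ρ.prod P) measurable_fst.aemeasurable
      (f := fun φ => Real.log (f φ).toReal) (by
        exact (Real.measurable_log.comp hfu.ennreal_toReal).aestronglyMeasurable)
    rw [hfst.map_eq] at h1
    rw [← h1, smul_eq_mul]
    ring
  have hneg : ∫⁻ p, ENNReal.ofReal (-Real.log (f' (resampleStep Λ b S p.1 p.2)).toReal)
      ∂(ρ.prod P) ≠ ⊤ := by
    have h1 := hmp.lintegral_comp (f := fun φ => ENNReal.ofReal (-Real.log (f' φ).toReal))
      (Real.measurable_log.comp hfu'.ennreal_toReal).neg.ennreal_ofReal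
    rw [h1]
    exact H.lintegral_neg_log_ne_top hρ' hf' hbD
  -- A result in `S` was there before, with probability at most `a`, or was accepted, with
  -- probability `a`. This is where `hSa` is essential.
  have hρS : ρ' S ≤ ENNReal.ofReal (2 * a) := by
    rw [hρdef, Measure.map_apply hstep hSu]
    calc (ρ.prod P) ((fun p => resampleStep Λ b S p.1 p.2) ⁻¹' S)
        ≤ (ρ.prod P) (Prod.fst ⁻¹' S ∪ {p | propose Λ b p.1 p.2 ∈ S}) := by
          refine measure_mono fun p hp => ?_
          by_cases h : propose Λ b p.1 p.2 ∈ S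
          · exact .inr h
          · left
            rwa [Set.mem_preimage, resampleStep, if_neg h] at hp
      _ ≤ (ρ.prod P) (Prod.fst ⁻¹' S) + (ρ.prod P) {p | propose Λ b p.1 p.2 ∈ S} :=
          measure_union_le _ _
      _ ≤ ENNReal.ofReal a + ENNReal.ofReal a := by
          rw [ha, hfst.measure_preimage hSu.nullMeasurableSet]
          exact add_le_add hSa le_rfl
      _ = _ := by rw [← ENNReal.ofReal_add ha0 ha0, two_mul]
  have hle : ∫⁻ p, f' (resampleStep Λ b S p.1 p.2) / (f p.1 * w p) ∂(ρ.prod P) ≤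
      ENNReal.ofReal (1 + a) := by
    have h1 : ∀ᵐ p ∂(ρ.prod P), f' (resampleStep Λ b S p.1 p.2) / (f p.1 * w p) ≤
        f' p.1 / f p.1 + (ENNReal.ofReal (Real.exp (-2)))⁻¹ *
          ((f p.1)⁻¹ * S.indicator f' (propose Λ b p.1 p.2)) := by
      filter_upwards [hFae] with p hp
      by_cases h : propose Λ b p.1 p.2 ∈ S
      · refine le_trans (le_of_eq ?_) le_add_self
        rw [resampleStep, if_pos h, Set.indicator_of_mem h]
        simp only [hw, if_pos h]
        rw [ENNReal.div_eq_inv_mul, ENNReal.mul_inv (.inl hp.1) (.inl hp.2)]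
        ring
      · refine le_trans (le_of_eq ?_) le_self_add
        rw [resampleStep, if_neg h]
        simp only [hw, if_neg h, mul_one]
    have hfi' : Measurable[gradAlg E (D : Set (Vertex d))] fun φ => (f φ)⁻¹ := hf.measurable.inv
    have h2 : ∫⁻ p, f' p.1 / f p.1 ∂(ρ.prod P) ≤ 1 := by
      have h3 := hfst.lintegral_comp (f := fun φ => f' φ / f φ) (hfu'.div hfu)
      rw [h3, hf.lintegral_eq b hbD _ (show Measurable[gradAlg E (D : Set (Vertex d))]
        fun φ => f' φ / f φ from Measurable.div hf'.measurable hf.measurable)]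
      have h4 := hf'.refIntegral_eq_one hbD
      rw [← h4]
      refine refIntegral_mono fun φ => ?_
      calc f φ * (weight Φ D φ * (f' φ / f φ)) = weight Φ D φ * (f φ * (f' φ / f φ)) := by ring
        _ ≤ weight Φ D φ * f' φ := mul_le_mul_right ENNReal.mul_div_le _
        _ = _ := mul_comm _ _
    -- The old density cancels against its inverse, and what is left of the new density is its mass
    -- on `S`, up to the factor `k`.
    have h5 : ∫⁻ p, (f p.1)⁻¹ * S.indicator f' (propose Λ b p.1 p.2) ∂(ρ.prod P) ≤
        k * ENNReal.ofReal (2 * a) := by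
      rw [key _ _ hfi' hf'.measurable]
      calc _ ≤ refIntegral D b (fun φ => (boundedAt E Λ b r).indicator 1 φ *
            (weight Φ D φ * ∫⁻ ψ, S.indicator f' (propose Λ b φ ψ) ∂P)) := by
            refine refIntegral_mono fun φ => ?_
            refine (mul_le_mul_left ?_ _).trans (one_mul _).le
            exact ENNReal.mul_inv_le_one _
        _ ≤ k * refIntegral D b (fun φ => weight Φ D φ * S.indicator f' φ) :=
            H.refIntegral_propose_le hΛD hbΛ hS hc hSc hP hf'.measurable
        _ ≤ k * ENNReal.ofReal (2 * a) := by
            refine mul_le_mul_right (le_trans (le_of_eq ?_) hρS) _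
            rw [← lintegral_indicator_one hSu, hf'.lintegral_eq b hbD _
              (show Measurable[gradAlg E (D : Set (Vertex d))]
                (S.indicator (1 : Config E d → ℝ≥0∞)) from
                Measurable.indicator measurable_const hS)]
            congr 1
            funext φ
            by_cases h : φ ∈ S <;> simp [h, mul_comm]
    have hm1 : Measurable fun p : Config E d × (Λ → E) => f' p.1 / f p.1 :=
      (hfu'.div hfu).comp measurable_fst
    have hm2 : Measurable fun p : Config E d × (Λ → E) =>
        (f p.1)⁻¹ * S.indicator f' (propose Λ b p.1 p.2) :=
      (hfu.inv.comp measurable_fst).mul ((hfu'.indicator hSu).comp hprop)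
    refine (lintegral_mono_ae h1).trans ?_
    rw [lintegral_add_left hm1, lintegral_const_mul _ hm2,
      ENNReal.ofReal_add zero_le_one ha0, ENNReal.ofReal_one]
    refine add_le_add h2 ?_
    calc (ENNReal.ofReal (Real.exp (-2)))⁻¹ * _
        ≤ (ENNReal.ofReal (Real.exp (-2)))⁻¹ * (k * ENNReal.ofReal (2 * a)) :=
          mul_le_mul_right h5 _
      _ = (ENNReal.ofReal (Real.exp (-2)))⁻¹ * (2 * k) * ENNReal.ofReal a := by
          rw [ENNReal.ofReal_mul zero_le_two, ENNReal.ofReal_ofNat]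
          ring
      _ ≤ (ENNReal.ofReal (Real.exp (-2)))⁻¹ * ENNReal.ofReal (Real.exp (-2)) *
            ENNReal.ofReal a := mul_le_mul_left (mul_le_mul_right hu _) _
      _ = ENNReal.ofReal a := by
          rw [ENNReal.inv_mul_cancel (ENNReal.ofReal_pos.2 (Real.exp_pos _)).ne'
            ENNReal.ofReal_ne_top, one_mul]
  obtain ⟨hGi, hGle⟩ := gibbs_inequality (ν := ρ.prod P) (F := fun p => f p.1 * w p)
    (G := fun p => f' (resampleStep Λ b S p.1 p.2)) ((hfu.comp measurable_fst).mul hwm)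
    (hfu'.comp hstep) (hFae.mono fun p hp => ⟨mul_ne_zero hp.1 (hw0 p).1,
      ENNReal.mul_ne_top hp.2 (hw0 p).2⟩) hGae (by linarith : 0 < 1 + a) hle
    ((hi1.add hi2).congr hlogF) hneg
  have hlogm : Measurable fun φ => Real.log (f' φ).toReal :=
    Real.measurable_log.comp hfu'.ennreal_toReal
  refine ⟨_, ⟨f', hf', ?_, rfl⟩, ?_⟩
  · rw [hρdef]
    exact (integrable_map_measure hlogm.aestronglyMeasurable hstep.aemeasurable).2 hGi
  · have h1 := integral_map (μ := ρ.prod P) hstep.aemeasurable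
      (f := fun φ => Real.log (f' φ).toReal) hlogm.aestronglyMeasurable
    rw [hρdef, h1]
    -- The balance is `-2a + log (1 + a) ≤ -a`.
    have h2 := Real.log_le_sub_one_of_pos (by linarith : 0 < 1 + a)
    rw [hint] at hGle
    linarith

end Drop

end

section
/-! ### Resampling at many sites -/

/-- The finite set `Λ` around the site `x` is resampled. -/
def siteStep (Λ : Finset (Vertex d)) (b : Vertex d) (S : Set (Config E d)) (x : Vertex d)
    (φ : Config E d) (ψ : Λ → E) : Config E d :=
  shift (-x) (resampleStep Λ b S (shift x φ) ψ)

open Classical in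
/-- The sets `Λ + x` with `x ∈ X` are resampled at once; `σ y` is the site which is responsible for
the vertex `y`. -/
def stepAll (Λ : Finset (Vertex d)) (b : Vertex d) (S : Set (Config E d))
    (σ : Vertex d → Vertex d) (X : Set (Vertex d)) (φ : Config E d) (U : Vertex d → Λ → E) :
    Config E d :=
  ⟨fun y => if σ y ∈ X then siteStep Λ b S (σ y) φ (U (σ y)) y else φ y⟩

/-- The gradient event `S` in the window `W` is suitable for the resampling of `Λ`. -/
structure IsLocalEvent (q : Vertex d → Vertex d → ℝ) (Λ W : Finset (Vertex d)) (b : Vertex d)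
    (S : Set (Config E d)) : Prop where
  subset : Λ ⊆ W
  base_mem : b ∈ W
  base_notMem : b ∉ Λ
  measurableSet : MeasurableSet[gradAlg E (W : Set (Vertex d))] S
  lipschitz : ∀ φ ∈ lipschitzSet E q, ∀ ψ : Λ → E, propose Λ b φ ψ ∈ S →
    propose Λ b φ ψ ∈ lipschitzSet E q

section Sites

variable {L : AddSubgroup (Vertex d)} {A : SimpleGraph (Vertex d)} {q : Vertex d → Vertex d → ℝ}
  {Λ W : Finset (Vertex d)} {b x : Vertex d} {S : Set (Config E d)} {σ : Vertex d → Vertex d}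
  {X Y : Set (Vertex d)} {φ χ : Config E d}

theorem mem_congr_of_gradAlg {T : Set (Vertex d)} (hS : MeasurableSet[gradAlg E T] S)
    (h : ∀ y ∈ T, φ y = χ y) : φ ∈ S ↔ χ ∈ S :=
  iff_of_eq <| gradAlg_congr (g := fun φ => φ ∈ S) ((@measurableSet_setOfPred _ (gradAlg E T) (· ∈ S)).1 hS)
    fun x hx y hy => by rw [h x hx, h y hy]

theorem resampleStep_apply_notMem (φ : Config E d) (ψ : Λ → E) {y : Vertex d} (hy : y ∉ Λ) :
    resampleStep Λ b S φ ψ y = φ y := by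
  unfold resampleStep
  split_ifs
  · exact glue_apply_notMem _ _ hy
  · rfl

/-- Both the proposal and the decision whether to accept it are determined inside the window, which
contains `b`, `Λ` and the support of `S`. -/
theorem IsLocalEvent.resampleStep_congr (h : IsLocalEvent q Λ W b S) (hφ : ∀ y ∈ W, φ y = χ y)
    (ψ : Λ → E) {y : Vertex d} (hy : y ∈ W) :
    resampleStep Λ b S φ ψ y = resampleStep Λ b S χ ψ y := by
  have h1 : ∀ y ∈ W, propose Λ b φ ψ y = propose Λ b χ ψ y := by
    intro y hy
    by_cases hyΛ : y ∈ Λ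
    · rw [propose, propose, glue_apply_mem _ _ hyΛ, glue_apply_mem _ _ hyΛ, hφ b h.base_mem]
    · rw [propose, propose, glue_apply_notMem _ _ hyΛ, glue_apply_notMem _ _ hyΛ, hφ y hy]
  have h2 := mem_congr_of_gradAlg h.measurableSet (φ := propose Λ b φ ψ) (χ := propose Λ b χ ψ) h1
  by_cases h3 : propose Λ b φ ψ ∈ S
  · rw [resampleStep, resampleStep, if_pos h3, if_pos (h2.1 h3), h1 y hy]
  · rw [resampleStep, resampleStep, if_neg h3, if_neg (fun h4 => h3 (h2.2 h4)), hφ y hy]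

theorem siteStep_apply_notMem (φ : Config E d) (ψ : Λ → E) {y : Vertex d} (hy : y - x ∉ Λ) :
    siteStep Λ b S x φ ψ y = φ y := by
  change resampleStep Λ b S (shift x φ) ψ (y + -x) = φ y
  rw [← sub_eq_add_neg, resampleStep_apply_notMem _ _ hy]
  change φ (y - x + x) = φ y
  rw [sub_add_cancel]

theorem IsLocalEvent.siteStep_congr (h : IsLocalEvent q Λ W b S)
    (hφ : ∀ y ∈ W, φ (y + x) = χ (y + x)) (ψ : Λ → E) {y : Vertex d} (hy : y - x ∈ W) :
    siteStep Λ b S x φ ψ y = siteStep Λ b S x χ ψ y := by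
  change resampleStep Λ b S (shift x φ) ψ (y + -x) = resampleStep Λ b S (shift x χ) ψ (y + -x)
  rw [← sub_eq_add_neg]
  exact h.resampleStep_congr (fun y hy => hφ y hy) ψ hy

theorem siteStep_shift (v : Vertex d) (φ : Config E d) (ψ : Λ → E) (y : Vertex d) :
    siteStep Λ b S x (shift v φ) ψ y = siteStep Λ b S (x + v) φ ψ (y + v) := by
  change resampleStep Λ b S (shift x (shift v φ)) ψ (y + -x) =
    resampleStep Λ b S (shift (x + v) φ) ψ (y + v + -(x + v))
  rw [shift_shift]
  congr 1
  abel

theorem shift_siteStep (φ : Config E d) (ψ : Λ → E) :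
    shift x (siteStep Λ b S x φ ψ) = resampleStep Λ b S (shift x φ) ψ := by
  rw [siteStep, shift_shift, add_neg_cancel, shift_zero]

theorem shift_mem_lipschitzSet (hq : IsAdmissibleQuasimetric L q) {v : Vertex d} (hv : v ∈ L)
    (h : φ ∈ lipschitzSet E q) : shift v φ ∈ lipschitzSet E q := fun x y => by
  rw [← hq.invariant v hv]
  exact h _ _

theorem IsLocalEvent.siteStep_mem (h : IsLocalEvent q Λ W b S) (hq : IsAdmissibleQuasimetric L q)
    (hx : x ∈ L) (hφ : φ ∈ lipschitzSet E q) (ψ : Λ → E) :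
    siteStep Λ b S x φ ψ ∈ lipschitzSet E q := by
  refine shift_mem_lipschitzSet hq (L.neg_mem hx) ?_
  have h1 := shift_mem_lipschitzSet hq hx hφ
  unfold resampleStep
  split_ifs with h2
  · exact h.lipschitz _ h1 _ h2
  · exact h1

theorem measurable_siteStep (hS : MeasurableSet S) (x : Vertex d) :
    Measurable fun p : Config E d × (Λ → E) => siteStep Λ b S x p.1 p.2 :=
  (measurable_shift _).comp ((measurable_resampleStep Λ b hS).comp
    (((measurable_shift x).comp measurable_fst).prodMk measurable_snd))

/-- A step at `σ y` leaves the height at `b + σ y` unchanged, since `b ∉ Λ`. Measured from there,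
the new height at `y` is a difference within one resampled configuration, and old differences supply
the rest. -/
theorem measurable_stepAll (hS : MeasurableSet S) (hb : b ∉ Λ) (σ : Vertex d → Vertex d)
    (X : Set (Vertex d)) : Measurable fun p : Config E d × (Vertex d → Λ → E) =>
      stepAll Λ b S σ X p.1 p.2 := by
  have key : ∀ y z, Measurable fun p : Config E d × (Vertex d → Λ → E) =>
      stepAll Λ b S σ X p.1 p.2 y - p.1 z := by
    intro y z
    by_cases h : σ y ∈ X
    · have e : (fun p : Config E d × (Vertex d → Λ → E) => stepAll Λ b S σ X p.1 p.2 y - p.1 z) =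
          fun p => (siteStep Λ b S (σ y) p.1 (p.2 (σ y)) y -
            siteStep Λ b S (σ y) p.1 (p.2 (σ y)) (b + σ y)) + (p.1 (b + σ y) - p.1 z) := by
        funext p
        rw [siteStep_apply_notMem (y := b + σ y) _ _ (by rwa [add_sub_cancel_right]),
          sub_add_sub_cancel]
        simp only [stepAll, if_pos h]
      rw [e]
      exact ((measurable_grad _ _).comp ((measurable_siteStep hS (σ y)).comp
        (measurable_fst.prodMk ((measurable_pi_apply (σ y)).comp measurable_snd)))).add
        ((measurable_grad _ _).comp measurable_fst)
    · simp only [stepAll, if_neg h]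
      exact (measurable_grad _ _).comp measurable_fst
  refine measurable_config_iff.2 fun x _ y _ => ?_
  have e : (fun p : Config E d × (Vertex d → Λ → E) =>
      stepAll Λ b S σ X p.1 p.2 y - stepAll Λ b S σ X p.1 p.2 x) = fun p =>
      (stepAll Λ b S σ X p.1 p.2 y - p.1 x) - (stepAll Λ b S σ X p.1 p.2 x - p.1 x) := by
    funext p
    rw [sub_sub_sub_cancel_right]
  rw [e]
  exact (key y x).sub (key x x)

theorem stepAll_apply_notMem (φ : Config E d) (U : Vertex d → Λ → E) {y : Vertex d}
    (hy : σ y ∉ X) : stepAll Λ b S σ X φ U y = φ y := if_neg hy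

theorem stepAll_apply_congr (φ : Config E d) (U : Vertex d → Λ → E) {y : Vertex d}
    (hy : σ y ∈ X ↔ σ y ∈ Y) : stepAll Λ b S σ X φ U y = stepAll Λ b S σ Y φ U y := by
  by_cases h : σ y ∈ X
  · simp only [stepAll, if_pos h, if_pos (hy.1 h)]
  · simp only [stepAll, if_neg h, if_neg (fun h' => h (hy.2 h'))]

theorem stepAll_empty (φ : Config E d) (U : Vertex d → Λ → E) :
    stepAll Λ b S σ ∅ φ U = φ := by
  ext y
  exact stepAll_apply_notMem _ _ (Set.notMem_empty _)

/-- Simultaneous resampling equals sequential resampling: every vertex of the window at `x` belongs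
to `x`, so the other steps neither influence the step at `x` nor touch its window. -/
theorem IsLocalEvent.stepAll_insert (h : IsLocalEvent q Λ W b S) (hσ : ∀ y ∈ W, σ (y + x) = x)
    (hx : x ∉ X) (φ : Config E d) (U : Vertex d → Λ → E) :
    stepAll Λ b S σ (insert x X) φ U = siteStep Λ b S x (stepAll Λ b S σ X φ U) (U x) := by
  ext y
  by_cases hy : σ y = x
  · have h1 : stepAll Λ b S σ (insert x X) φ U y = siteStep Λ b S x φ (U x) y := by
      have h2 : σ y ∈ insert x X := .inl hy
      simp only [stepAll, if_pos h2]
      rw [hy]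
    rw [h1]
    by_cases hyW : y - x ∈ W
    · refine h.siteStep_congr (fun z hz => ?_) _ hyW
      rw [stepAll_apply_notMem]
      rwa [hσ z hz]
    · have hyΛ : y - x ∉ Λ := fun h' => hyW (h.subset h')
      rw [siteStep_apply_notMem _ _ hyΛ, siteStep_apply_notMem _ _ hyΛ, stepAll_apply_notMem]
      rwa [hy]
  · rw [stepAll_apply_congr (Y := X) _ _ ⟨fun h' => h'.resolve_left hy, .inr⟩,
      siteStep_apply_notMem]
    intro h'
    have h2 := hσ _ (h.subset h')
    rw [sub_add_cancel] at h2
    exact hy h2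

theorem stepAll_update [DecidableEq (Vertex d)] (hx : x ∉ X) (φ : Config E d)
    (U : Vertex d → Λ → E) (ψ : Λ → E) :
    stepAll Λ b S σ X φ (Function.update U x ψ) = stepAll Λ b S σ X φ U := by
  ext y
  by_cases h : σ y ∈ X
  · simp only [stepAll, if_pos h]
    rw [Function.update_of_ne]
    rintro rfl
    exact hx h
  · simp only [stepAll, if_neg h]

/-- The Lipschitz property concerns two vertices at a time, and those depend on at most two sites.
Finitely many sequential steps, each of which preserves the property, therefore suffice even if `X`
is infinite. -/
theorem IsLocalEvent.stepAll_mem (h : IsLocalEvent q Λ W b S) (hq : IsAdmissibleQuasimetric L q)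
    (hXL : X ⊆ L) (hσ : ∀ x ∈ X, ∀ y ∈ W, σ (y + x) = x) (hφ : φ ∈ lipschitzSet E q)
    (U : Vertex d → Λ → E) : stepAll Λ b S σ X φ U ∈ lipschitzSet E q := by
  have key : ∀ F : Finset (Vertex d), (F : Set (Vertex d)) ⊆ X →
      stepAll Λ b S σ F φ U ∈ lipschitzSet E q := by
    intro F
    induction F using Finset.induction_on with
    | empty =>
      intro _
      rwa [Finset.coe_empty, stepAll_empty]
    | insert x F hx ih =>
      intro hF
      rw [Finset.coe_insert, Set.insert_subset_iff] at hF
      rw [Finset.coe_insert, h.stepAll_insert (hσ x hF.1) (fun h' => hx h')]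
      exact h.siteStep_mem hq (hXL hF.1) (ih hF.2) _
  classical
  intro y z
  have h1 := key (({σ y, σ z} : Finset (Vertex d)).filter (· ∈ X))
    (fun x hx => (Finset.mem_filter.1 (Finset.mem_coe.1 hx)).2) y z
  rwa [stepAll_apply_congr (Y := X) (y := y) _ _ (by simp),
    stepAll_apply_congr (Y := X) (y := z) _ _ (by simp)] at h1

/-! ### Laws of resampled height functions under independent proposals. -/

variable {μ : Measure (Config E d)} {P : Measure (Λ → E)} [IsProbabilityMeasure P]

theorem measurable_update_snd {ι : Type*} [DecidableEq ι] {Z : Type*} [MeasurableSpace Z] (x : ι) :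
    Measurable fun p : (ι → Z) × Z => Function.update p.1 x p.2 := by
  refine measurable_pi_iff.2 fun i => ?_
  by_cases h : i = x
  · subst h
    simpa using measurable_snd
  · simp only [Function.update_of_ne h]
    exact (measurable_pi_apply i).comp measurable_fst

/-- Replacing one coordinate by an independent copy preserves the product law; this exhibits the
proposal at `x` as independent of all the others. -/
theorem map_update_infinitePi {ι : Type*} [DecidableEq ι] {Z : Type*} [MeasurableSpace Z]
    (P : Measure Z) [IsProbabilityMeasure P] (x : ι) :
    ((Measure.infinitePi fun _ : ι => P).prod P).map (fun p => Function.update p.1 x p.2) =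
      Measure.infinitePi fun _ : ι => P := by
  refine Measure.eq_infinitePi _ fun s t ht => ?_
  have hm := measurable_update_snd (Z := Z) x
  rw [Measure.map_apply hm (MeasurableSet.pi s.countable_toSet fun i _ => ht i)]
  have e : (fun p : (ι → Z) × Z => Function.update p.1 x p.2) ⁻¹' (s : Set ι).pi t =
      (((s.erase x : Finset ι) : Set ι).pi t) ×ˢ {z | x ∈ s → z ∈ t x} := by
    ext p
    simp only [Set.mem_preimage, Set.mem_pi, Set.mem_prod, Finset.coe_erase]
    constructor
    · intro h
      refine ⟨fun i hi => ?_, fun hx => ?_⟩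
      · have := h i hi.1
        rwa [Function.update_of_ne hi.2] at this
      · have := h x hx
        rwa [Function.update_self] at this
    · rintro ⟨h1, h2⟩ i hi
      by_cases h : i = x
      · subst h
        rw [Function.update_self]
        exact h2 hi
      · rw [Function.update_of_ne h]
        exact h1 i ⟨hi, h⟩
  rw [e, Measure.prod_prod, Measure.infinitePi_pi _ fun i _ => ht i]
  by_cases hx : x ∈ s
  · have e2 : {z | x ∈ s → z ∈ t x} = t x := by
      ext z
      simp [hx]
    rw [e2, Finset.prod_erase_mul s (fun i => P (t i)) hx]
  · have e2 : {z | x ∈ s → z ∈ t x} = Set.univ := by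
      ext z
      simp [hx]
    rw [e2, measure_univ, mul_one, Finset.erase_eq_of_notMem hx]

/-- The law of the height function after the resampling at the sites in `X`. -/
def resampleAll (μ : Measure (Config E d)) (P : Measure (Λ → E)) (b : Vertex d)
    (S : Set (Config E d)) (σ : Vertex d → Vertex d) (X : Set (Vertex d)) :
    Measure (Config E d) :=
  (μ.prod (Measure.infinitePi fun _ : Vertex d => P)).map fun p => stepAll Λ b S σ X p.1 p.2

theorem resampleAll_empty [IsProbabilityMeasure μ] : resampleAll μ P b S σ ∅ = μ := by
  simp only [resampleAll, stepAll_empty]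
  rw [Measure.map_fst_prod, measure_univ, one_smul]

/-- The steps at `X` ignore the proposal at `x ∉ X`, which may therefore be drawn afresh afterwards.
-/
theorem IsLocalEvent.resampleAll_insert [IsProbabilityMeasure μ] (h : IsLocalEvent q Λ W b S)
    (hσ : ∀ y ∈ W, σ (y + x) = x) (hx : x ∉ X) :
    resampleAll μ P b S σ (insert x X) =
      ((resampleAll μ P b S σ X).prod P).map fun p => siteStep Λ b S x p.1 p.2 := by
  classical
  have hS : MeasurableSet S := gradAlg_le _ _ h.measurableSet
  have hT := fun X => measurable_stepAll (Λ := Λ) hS h.base_notMem σ X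
  set I := Measure.infinitePi fun _ : Vertex d => P with hI
  have hmp : MeasurePreserving (fun p : (Config E d × (Vertex d → Λ → E)) × (Λ → E) =>
      (p.1.1, Function.update p.1.2 x p.2)) ((μ.prod I).prod P) (μ.prod I) := by
    have h1 : MeasurePreserving (fun p : (Vertex d → Λ → E) × (Λ → E) =>
        Function.update p.1 x p.2) (I.prod P) I := ⟨measurable_update_snd x, map_update_infinitePi P x⟩
    have h2 := (MeasurePreserving.id μ).prod h1
    have h3 := measurePreserving_prodAssoc μ I P
    exact h2.comp h3
  have h1 : ((resampleAll μ P b S σ X).prod P) =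
      ((μ.prod I).prod P).map (Prod.map (fun p => stepAll Λ b S σ X p.1 p.2) id) := by
    have h2 := Measure.map_prod_map (μ.prod I) P (hT X) measurable_id
    rw [Measure.map_id] at h2
    exact h2
  rw [h1, Measure.map_map (measurable_siteStep hS x) ((hT X).prodMap measurable_id), resampleAll]
  conv_lhs => rw [← hI, ← hmp.map_eq]
  rw [Measure.map_map (hT _) hmp.measurable]
  congr 1
  funext p
  simp only [Function.comp_apply, Prod.map_fst, Prod.map_snd, id_eq]
  rw [h.stepAll_insert hσ hx, stepAll_update hx, Function.update_self]

theorem isProbabilityMeasure_resampleAll [IsProbabilityMeasure μ] (hS : MeasurableSet S)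
    (hb : b ∉ Λ) (σ : Vertex d → Vertex d) (X : Set (Vertex d)) :
    IsProbabilityMeasure (resampleAll μ P b S σ X) :=
  Measure.isProbabilityMeasure_map (measurable_stepAll hS hb σ X).aemeasurable

theorem measurableSet_lipschitzSet (E : HeightSpace) (q : Vertex d → Vertex d → ℝ) :
    MeasurableSet (lipschitzSet E q) := by
  have h : lipschitzSet E q = ⋂ (x : Vertex d) (y : Vertex d),
      {φ : Config E d | E.toReal (φ y - φ x) ≤ q x y} := by
    ext φ
    simp [lipschitzSet, toReal_sub]
  rw [h]
  exact MeasurableSet.iInter fun x => MeasurableSet.iInter fun y =>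
    measurableSet_le ((measurable_toReal E).comp (measurable_grad x y)) measurable_const

theorem IsLocalEvent.isLipschitzMeasure_resampleAll (h : IsLocalEvent q Λ W b S)
    (hq : IsAdmissibleQuasimetric L q) (hμ : IsLipschitzMeasure q μ)
    (hXL : X ⊆ L) (hσ : ∀ x ∈ X, ∀ y ∈ W, σ (y + x) = x) :
    IsLipschitzMeasure q (resampleAll μ P b S σ X) := by
  have := hμ.isProb
  have hS : MeasurableSet S := gradAlg_le _ _ h.measurableSet
  refine ⟨isProbabilityMeasure_resampleAll hS h.base_notMem σ X, ?_⟩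
  refine (ae_map_iff (measurable_stepAll hS h.base_notMem σ X).aemeasurable
    (measurableSet_lipschitzSet E q)).2 ?_
  have h1 : ∀ᵐ p ∂(μ.prod (Measure.infinitePi fun _ : Vertex d => P)), p.1 ∈ lipschitzSet E q :=
    measurePreserving_fst.quasiMeasurePreserving.ae hμ.ae_mem
  exact h1.mono fun p hp => h.stepAll_mem hq hXL hσ hp _

theorem IsLipschitzMeasure.map_shift (hq : IsAdmissibleQuasimetric L q)
    (hμ : IsLipschitzMeasure q μ) {v : Vertex d} (hv : v ∈ L) :
    IsLipschitzMeasure q (μ.map (shift v)) := by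
  have := hμ.isProb
  refine ⟨Measure.isProbabilityMeasure_map (measurable_shift v).aemeasurable, ?_⟩
  exact (ae_map_iff (measurable_shift v).aemeasurable (measurableSet_lipschitzSet E q)).2
    (hμ.ae_mem.mono fun φ hφ => shift_mem_lipschitzSet hq hv hφ)

end Sites

end

section
/-! ### The free energy after the resampling at finitely many sites -/

/-- The event `S` and the law `P` of the proposals are such that a resampling of `Λ` lowers the free
energy of `μ` by at least `a`. -/
structure IsEfficient (q : Vertex d → Vertex d → ℝ) (Ψ : GradPotential E d) (C : ℝ)
    (μ : Measure (Config E d)) (Λ W : Finset (Vertex d)) (b : Vertex d) (S : Set (Config E d))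
    (P : Measure (Λ → E)) (a : ℝ) : Prop where
  isLocalEvent : IsLocalEvent q Λ W b S
  nonneg : 0 ≤ a
  measure_propose : (μ.prod P) {p | propose Λ b p.1 p.2 ∈ S} = ENNReal.ofReal a
  measure_le : μ S ≤ ENNReal.ofReal a
  exists_cost : ∃ (c r : ℝ) (u : ℝ≥0∞), 0 ≤ c ∧
    (∀ D : Finset (Vertex d), ∀ φ ∈ S,
      strongPart Ψ ((subsets D).filter fun Γ => ∃ x ∈ Γ, x ∈ Λ) φ ≤ ENNReal.ofReal c) ∧
    (P ≤ u • Measure.pi fun _ : Λ => E.refMeasure) ∧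
    (∀ φ ∈ lipschitzSet E q, φ ∈ boundedAt E Λ b r) ∧
    2 * (u * ENNReal.ofReal (Real.exp (c + 2 * (C * Λ.card))) *
      (Measure.pi fun _ : Λ => E.refMeasure) (Set.univ.pi fun _ => heightBall E r)) ≤
        ENNReal.ofReal (Real.exp (-2))

section Finite

variable {L : AddSubgroup (Vertex d)} {A : SimpleGraph (Vertex d)} {q : Vertex d → Vertex d → ℝ}
  {Φ Ψ Ξ : GradPotential E d} {C : ℝ} {μ : Measure (Config E d)} {Λ W D : Finset (Vertex d)}
  {b : Vertex d} {S : Set (Config E d)} {P : Measure (Λ → E)} [IsProbabilityMeasure P]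
  {a : ℝ} {σ : Vertex d → Vertex d} {X : Set (Vertex d)}

/-- Heights at vertices whose site is not resampled are unchanged pointwise. -/
theorem IsLocalEvent.lintegral_resampleAll (h : IsLocalEvent q Λ W b S) [IsProbabilityMeasure μ]
    {T : Set (Vertex d)} (hT : ∀ y ∈ T, σ y ∉ X) {g : Config E d → ℝ≥0∞}
    (hg : Measurable[gradAlg E T] g) : ∫⁻ φ, g φ ∂(resampleAll μ P b S σ X) = ∫⁻ φ, g φ ∂μ := by
  have hS : MeasurableSet S := gradAlg_le _ _ h.measurableSet
  have hgu : Measurable g := hg.mono (gradAlg_le _) le_rfl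
  rw [resampleAll, lintegral_map hgu (measurable_stepAll hS h.base_notMem σ X),
    ← measurePreserving_fst.lintegral_comp
      (μ := μ.prod (Measure.infinitePi fun _ : Vertex d => P)) hgu]
  refine lintegral_congr fun p => gradAlg_congr hg fun x hx y hy => ?_
  rw [stepAll_apply_notMem _ _ (hT x hx), stepAll_apply_notMem _ _ (hT y hy)]

theorem measure_propose_eq {ρ : Measure (Config E d)} [SFinite ρ] (hS : MeasurableSet S) :
    (ρ.prod P) {p | propose Λ b p.1 p.2 ∈ S} =
      ∫⁻ φ, ∫⁻ ψ, S.indicator 1 (propose Λ b φ ψ) ∂P ∂ρ := by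
  have hprop : Measurable fun p : Config E d × (Λ → E) => propose Λ b p.1 p.2 :=
    measurable_propose Λ (Set.mem_univ b) measurable_fst measurable_snd
  have hm : MeasurableSet {p : Config E d × (Λ → E) | propose Λ b p.1 p.2 ∈ S} := hprop hS
  rw [← lintegral_indicator_one hm, lintegral_prod _ (measurable_one.indicator hm).aemeasurable]
  rfl

/-- When the turn of a site comes, its window is still untouched. Its law there is that of `μ`,
translated, so the acceptance probability and the bound on the probability of `S` are the original
ones, and each step gains `a`. -/
theorem IsSplit.hasFreeEnergy_resampleAll (H : IsSplit L A q Φ Ψ Ξ C)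
    (h : IsEfficient q Ψ C μ Λ W b S P a) (hμ : IsLipschitzMeasure q μ)
    (hinv : ∀ v ∈ L, μ.map (shift v) = μ) {e : ℝ} (he : HasFreeEnergy Φ μ D e)
    (F : Finset (Vertex d)) (hFL : ∀ x ∈ F, x ∈ L) (hσ : ∀ x ∈ F, ∀ y ∈ W, σ (y + x) = x)
    (hD : ∀ x ∈ F, translate x W ⊆ D) :
    ∃ e', HasFreeEnergy Φ (resampleAll μ P b S σ F) D e' ∧ e' ≤ e - F.card * a := by
  have := hμ.isProb
  have hq := H.strong.constraint.quasimetric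
  have hl := h.isLocalEvent
  have hS : MeasurableSet S := gradAlg_le _ _ hl.measurableSet
  obtain ⟨c, r, u, hc, hSc, hP, hr, hu⟩ := h.exists_cost
  induction F using Finset.induction_on with
  | empty =>
    refine ⟨e, ?_, by simp⟩
    rwa [Finset.coe_empty, resampleAll_empty]
  | insert x F hx ih =>
    obtain ⟨e', he', hle⟩ := ih (fun y hy => hFL y (Finset.mem_insert_of_mem hy))
      (fun y hy => hσ y (Finset.mem_insert_of_mem hy))
      (fun y hy => hD y (Finset.mem_insert_of_mem hy))
    have hxL := hFL x (Finset.mem_insert_self x F)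
    have hσx := hσ x (Finset.mem_insert_self x F)
    set ν := resampleAll μ P b S σ (F : Set (Vertex d)) with hν
    have hνl : IsLipschitzMeasure q ν := hl.isLipschitzMeasure_resampleAll hq hμ
      (fun y hy => hFL y (Finset.mem_insert_of_mem hy))
      (fun y hy => hσ y (Finset.mem_insert_of_mem hy))
    have := hνl.isProb
    -- Move the site `x` to the origin, so that the single-step estimate applies verbatim in the
    -- translated domain.
    set ρ := ν.map (shift x) with hρ
    have hρl : IsLipschitzMeasure q ρ := hνl.map_shift hq hxL
    have := hρl.isProb
    have hρF : HasFreeEnergy Φ ρ (translate (-x) D) e' := by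
      refine HasFreeEnergy.of_map_shift H.periodic (L.neg_mem hxL) ?_
      rw [hρ, Measure.map_map (measurable_shift _) (measurable_shift _)]
      have h1 : (shift (-x) ∘ shift x : Config E d → Config E d) = id := by
        funext φ
        rw [Function.comp_apply, shift_shift, neg_add_cancel, shift_zero, id]
      rwa [h1, Measure.map_id]
    have hloc : ∀ g : Config E d → ℝ≥0∞, Measurable[gradAlg E (W : Set (Vertex d))] g →
        ∫⁻ φ, g φ ∂ρ = ∫⁻ φ, g φ ∂μ := by
      intro g hg
      have hgu : Measurable g := hg.mono (gradAlg_le _) le_rfl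
      have h1 : Measurable[gradAlg E (translate x W : Set (Vertex d))] (g ∘ shift x) :=
        hg.comp (measurable_shift_gradAlg x fun y hy => add_mem_translate.2 hy)
      have h2 := hl.lintegral_resampleAll (μ := μ) (P := P) (σ := σ) (X := (F : Set (Vertex d)))
        (T := (translate x W : Set (Vertex d))) (fun y hy => by
          have h3 := hσx _ (mem_translate.1 (Finset.mem_coe.1 hy))
          rw [sub_add_cancel] at h3
          rw [h3]
          exact fun h' => hx h') h1
      rw [hρ, lintegral_map hgu (measurable_shift x)]
      refine h2.trans ?_
      conv_rhs => rw [← hinv x hxL, lintegral_map hgu (measurable_shift x)]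
      rfl
    have hS1 : Measurable[gradAlg E (W : Set (Vertex d))] (S.indicator (1 : Config E d → ℝ≥0∞)) :=
      Measurable.indicator measurable_const hl.measurableSet
    have hρS : ρ S ≤ ENNReal.ofReal a := by
      refine le_trans (le_of_eq ?_) h.measure_le
      rw [← lintegral_indicator_one hS, ← lintegral_indicator_one hS]
      exact hloc _ hS1
    have hρa : (ρ.prod P) {p | propose Λ b p.1 p.2 ∈ S} = ENNReal.ofReal a := by
      rw [← h.measure_propose, measure_propose_eq hS, measure_propose_eq hS]
      exact hloc _ (measurable_lintegral_propose hl.base_mem hS1)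
    have hWD : W ⊆ translate (-x) D := fun y hy => mem_translate.2 <| by
      rw [sub_neg_eq_add]
      exact hD x (Finset.mem_insert_self x F) (add_mem_translate.2 hy)
    have hstep : (resampleAll μ P b S σ (insert x F : Finset (Vertex d))).map (shift x) =
        (ρ.prod P).map fun p => resampleStep Λ b S p.1 p.2 := by
      have h1 : ρ.prod P = (ν.prod P).map (Prod.map (shift x) id) := by
        have h2 := Measure.map_prod_map ν P (measurable_shift (E := E) x) measurable_id
        rwa [Measure.map_id] at h2
      rw [Finset.coe_insert, hl.resampleAll_insert hσx (fun h' => hx h'),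
        Measure.map_map (measurable_shift x) (measurable_siteStep hS x), h1,
        Measure.map_map (measurable_resampleStep Λ b hS) ((measurable_shift x).prodMap measurable_id)]
      congr 1
      funext p
      exact shift_siteStep _ _
    have hl' : IsLipschitzMeasure q ((ρ.prod P).map fun p => resampleStep Λ b S p.1 p.2) := by
      rw [← hstep]
      exact (hl.isLipschitzMeasure_resampleAll hq hμ hFL hσ).map_shift hq hxL
    obtain ⟨e'', h1, h2⟩ := H.hasFreeEnergy_resampleStep (hl.subset.trans hWD) (hWD hl.base_mem)
      hl.base_notMem (gradAlg_mono (Finset.coe_subset.2 hWD) _ hl.measurableSet) hc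
      (hSc (translate (-x) D)) hP hr hu hρl hl' hρa h.nonneg hρS hρF
    refine ⟨e'', ?_, ?_⟩
    · rw [← hstep] at h1
      have h3 := HasFreeEnergy.of_map_shift H.periodic hxL h1
      have h4 : translate x (translate (-x) D) = D := by
        ext y
        rw [mem_translate, mem_translate, sub_neg_eq_add, sub_add_cancel]
      rwa [h4] at h3
    · rw [Finset.card_insert_of_notMem hx]
      push_cast
      linarith

end Finite

end

section
/-! ### Resampling along a sparse grid -/

/-- The element of `c + N ℤ^d` to which the vertex `y` belongs. -/
def gridSite (N w : ℕ) (c y : Vertex d) : Vertex d := fun i => y i + w - (y i + w - c i) % N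

/-- The elements of `L` in `c + N ℤ^d`. -/
def gridSites (L : AddSubgroup (Vertex d)) (N : ℕ) (c : Vertex d) : Set (Vertex d) :=
  {x | x ∈ L ∧ ∀ i, (N : ℤ) ∣ x i - c i}

section Grid

variable {L : AddSubgroup (Vertex d)} {A : SimpleGraph (Vertex d)} {q : Vertex d → Vertex d → ℝ}
  {Φ Ψ Ξ : GradPotential E d} {C : ℝ} {μ : Measure (Config E d)} {Λ W D : Finset (Vertex d)}
  {b : Vertex d} {S : Set (Config E d)} {P : Measure (Λ → E)}
  {a : ℝ} {N w : ℕ} {c x y : Vertex d}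

/-- The offset `w` places the cell of a grid point `x` at `[x - w, x - w + N)` in each coordinate,
leaving room for a window on both sides of `x`. -/
theorem gridSite_eq (hx : ∀ i, (N : ℤ) ∣ x i - c i)
    (hy : ∀ i, -(w : ℤ) ≤ y i - x i ∧ y i - x i < N - w) : gridSite N w c y = x := by
  funext i
  obtain ⟨k, hk⟩ := hx i
  have h1 : y i + w - c i = (y i + w - x i) + N * k := by linarith
  have h2 := hy i
  rw [gridSite, h1, Int.add_mul_emod_self_left, Int.emod_eq_of_lt (by linarith) (by linarith)]
  ring

theorem gridSite_dvd (i : Fin d) : (N : ℤ) ∣ gridSite N w c y i - c i := by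
  have h := Int.dvd_self_sub_emod (x := y i + w - c i) (m := N)
  have e : gridSite N w c y i - c i = y i + w - c i - (y i + w - c i) % N := by
    rw [gridSite]
    ring
  rwa [e]

theorem gridSite_bounds (hN : 0 < N) (i : Fin d) :
    -(w : ℤ) ≤ y i - gridSite N w c y i ∧ y i - gridSite N w c y i < N - w := by
  have hN' : (0 : ℤ) < N := by exact_mod_cast hN
  have h1 := Int.emod_nonneg (y i + w - c i) hN'.ne'
  have h2 := Int.emod_lt_of_pos (y i + w - c i) hN'
  simp only [gridSite]
  constructor <;> linarith

theorem gridSite_mem_iff : gridSite N w c y ∈ gridSites L N c ↔ gridSite N w c y ∈ L :=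
  ⟨fun h => h.1, fun h => ⟨h, gridSite_dvd⟩⟩

theorem gridSite_add (hW : ∀ y ∈ W, ∀ i, -(w : ℤ) ≤ y i ∧ y i < N - w) (hx : x ∈ gridSites L N c)
    (hy : y ∈ W) : gridSite N w c (y + x) = x :=
  gridSite_eq hx.2 fun i => by
    rw [Pi.add_apply, add_sub_cancel_right]
    exact hW y hy i

theorem gridSite_shift (v : Vertex d) :
    gridSite N w c (y + v) = gridSite N w (c - v) y + v := by
  funext i
  have e : y i + v i + w - c i = y i + w - (c i - v i) := by ring
  simp only [gridSite, Pi.add_apply, Pi.sub_apply]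
  rw [e]
  ring

theorem gridSite_congr {c' : Vertex d} (h : ∀ i, (N : ℤ) ∣ c i - c' i) :
    gridSite N w c y = gridSite N w c' y := by
  funext i
  obtain ⟨k, hk⟩ := h i
  have e : y i + w - c' i = (y i + w - c i) + N * k := by linarith
  simp only [gridSite]
  rw [e, Int.add_mul_emod_self_left]

theorem gridSites_congr {c' : Vertex d} (h : ∀ i, (N : ℤ) ∣ c i - c' i) :
    gridSites L N c = gridSites L N c' := by
  ext x
  refine and_congr_right fun _ => forall_congr' fun i => ?_
  have e : x i - c i = (x i - c' i) - (c i - c' i) := by ring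
  rw [e, dvd_sub_left (h i)]

/-- The law of the height function after the resampling along the grid `c + N ℤ^d`. -/
def resampleGrid (L : AddSubgroup (Vertex d)) (μ : Measure (Config E d)) (P : Measure (Λ → E))
    (b : Vertex d) (S : Set (Config E d)) (N w : ℕ) (c : Vertex d) : Measure (Config E d) :=
  resampleAll μ P b S (gridSite N w c) (gridSites L N c)

theorem resampleGrid_congr {c' : Vertex d} (h : ∀ i, (N : ℤ) ∣ c i - c' i) :
    resampleGrid L μ P b S N w c = resampleGrid L μ P b S N w c' := by
  have e : gridSite N w c = gridSite N w c' := funext fun y => gridSite_congr h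
  rw [resampleGrid, resampleGrid, gridSites_congr h, e]

variable [IsProbabilityMeasure P]

/-- The shift moves the grid by `-v` and relabels the proposals; `μ` and the law of the independent
proposals are invariant under this, and so is the restriction to `L`. -/
theorem map_shift_resampleGrid [IsProbabilityMeasure μ] (hS : MeasurableSet S) (hb : b ∉ Λ)
    {v : Vertex d} (hv : v ∈ L) (hinv : μ.map (shift v) = μ) (c : Vertex d) :
    (resampleGrid L μ P b S N w c).map (shift v) = resampleGrid L μ P b S N w (c - v) := by
  have hT := fun σ X => measurable_stepAll (Λ := Λ) hS hb σ X
  set I := Measure.infinitePi fun _ : Vertex d => P with hI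
  have h1 : MeasurePreserving (fun (U : Vertex d → Λ → E) y => U (y + v)) I I := by
    have hm : Measurable fun (U : Vertex d → Λ → E) y => U (y + v) :=
      measurable_pi_iff.2 fun y => measurable_pi_apply _
    refine ⟨hm, Measure.eq_infinitePi _ fun s t ht => ?_⟩
    rw [Measure.map_apply hm (MeasurableSet.pi s.countable_toSet fun i _ => ht i)]
    have e : (fun (U : Vertex d → Λ → E) y => U (y + v)) ⁻¹' (s : Set (Vertex d)).pi t =
        ((translate v s : Finset (Vertex d)) : Set (Vertex d)).pi fun y => t (y - v) := by
      ext U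
      simp only [Set.mem_preimage, Set.mem_pi, Finset.mem_coe]
      constructor
      · intro h y hy
        have := h _ (mem_translate.1 hy)
        rwa [sub_add_cancel] at this
      · intro h y hy
        have := h _ (add_mem_translate.2 hy)
        rwa [add_sub_cancel_right] at this
    rw [e, Measure.infinitePi_pi _ fun i _ => ht _, translate,
      Finset.prod_image fun _ _ _ _ h => add_right_cancel h]
    simp
  have hmp := (MeasurePreserving.mk (measurable_shift v) hinv).prod h1
  rw [resampleGrid, resampleGrid, resampleAll, resampleAll,
    Measure.map_map (measurable_shift v) (hT _ _)]
  conv_rhs => rw [← hI, ← hmp.map_eq]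
  rw [Measure.map_map (hT _ _) hmp.measurable]
  congr 1
  funext p
  ext y
  have h2 : gridSite N w (c - v) y + v ∈ gridSites L N c ↔
      gridSite N w (c - v) y ∈ gridSites L N (c - v) := by
    rw [← gridSite_shift, gridSite_mem_iff, gridSite_mem_iff, gridSite_shift]
    exact L.add_mem_cancel_right hv
  change stepAll Λ b S (gridSite N w c) (gridSites L N c) p.1 p.2 (y + v) =
    stepAll Λ b S (gridSite N w (c - v)) (gridSites L N (c - v)) (shift v p.1)
      (fun y => p.2 (y + v)) y
  simp only [stepAll]
  rw [gridSite_shift]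
  by_cases h3 : gridSite N w (c - v) y ∈ gridSites L N (c - v)
  · rw [if_pos h3, if_pos (h2.2 h3), siteStep_shift]
  · rw [if_neg h3, if_neg fun h4 => h3 (h2.1 h4)]
    rfl

/-- The free energy in `D` sees the measure only through the height differences in `D`. -/
theorem HasFreeEnergy.congr {ν ν' : Measure (Config E d)}
    (h : ∀ g : Config E d → ℝ≥0∞, Measurable[gradAlg E (D : Set (Vertex d))] g →
      ∫⁻ φ, g φ ∂ν = ∫⁻ φ, g φ ∂ν') {e : ℝ} (he : HasFreeEnergy Φ ν D e) :
    HasFreeEnergy Φ ν' D e := by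
  obtain ⟨f, hf, hfi, rfl⟩ := he
  have hle := gradAlg_le (E := E) (D : Set (Vertex d))
  have htrim : ν.trim hle = ν'.trim hle := by
    refine @Measure.ext _ (gradAlg E (D : Set (Vertex d))) _ _ fun T hT => ?_
    rw [trim_measurableSet_eq _ hT, trim_measurableSet_eq _ hT,
      ← lintegral_indicator_one (hle _ hT), ← lintegral_indicator_one (hle _ hT)]
    exact h _ (Measurable.indicator measurable_const hT)
  have hlog : Measurable[gradAlg E (D : Set (Vertex d))] fun φ => Real.log (f φ).toReal :=
    Real.measurable_log.comp hf.measurable.ennreal_toReal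
  refine ⟨f, ⟨hf.measurable, fun x hx g hg => (h g hg).symm.trans (hf.lintegral_eq x hx g hg)⟩,
    ?_, ?_⟩
  · have h1 := hfi.trim hle hlog.stronglyMeasurable
    rw [htrim] at h1
    exact integrable_of_integrable_trim hle h1
  · rw [integral_trim hle hlog.stronglyMeasurable, integral_trim hle hlog.stronglyMeasurable, htrim]

/-- The translated box is a union of whole cells. Its vertices are governed exactly by the finitely
many grid points of those cells. -/
theorem gridSite_mem_image_iff {s : Vertex d} (hN : 0 < N) (hs : s ∈ gridSites L N c)
    (hNL : L.index ∣ N) {n : ℕ}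
    (hy : y ∈ translate (s - fun _ => (w : ℤ)) (box d (n * N))) :
    gridSite N w c y ∈ gridSites L N c ↔
      gridSite N w c y ∈ (box d n).image fun j => s + N • j := by
  have hN' : (0 : ℤ) < N := by exact_mod_cast hN
  constructor
  · intro _
    have h1 : ∀ i, ∃ k, gridSite N w c y i - s i = N * k := fun i => by
      have e : gridSite N w c y i - s i = (gridSite N w c y i - c i) - (s i - c i) := by ring
      rw [e]
      exact dvd_sub (gridSite_dvd i) (hs.2 i)
    choose j hj using h1
    refine Finset.mem_image.2 ⟨j, mem_box.2 fun i => ?_, ?_⟩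
    · have h2 := mem_box.1 (mem_translate.1 hy) i
      have h3 := gridSite_bounds (w := w) (c := c) (y := y) hN i
      simp only [Pi.sub_apply] at h2
      push_cast at h2
      have h4 := hj i
      constructor
      · by_contra! h5
        have : (N : ℤ) * j i ≤ N * (-1) := mul_le_mul_of_nonneg_left (by omega) hN'.le
        linarith
      · by_contra! h5
        have : (N : ℤ) * n ≤ N * j i := mul_le_mul_of_nonneg_left h5 hN'.le
        linarith
    · funext i
      rw [Pi.add_apply, nsmul_apply, ← hj i]
      ring
  · intro h
    obtain ⟨j, -, hj⟩ := Finset.mem_image.1 h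
    rw [gridSite_mem_iff, ← hj]
    exact L.add_mem hs.1 (index_smul_mem L hNL j)

/-- On a union of whole cells the infinite grid acts as finitely many steps, each gaining `a`;
passing to the box inside costs a constant per vertex of the layer between them. The gain is
recorded only for `c ∈ L`, since the grid may miss `L` for other offsets. -/
theorem IsSplit.exists_hasFreeEnergy_resampleGrid (H : IsSplit L A q Φ Ψ Ξ C)
    (hL : L.FiniteIndex) (h : IsEfficient q Ψ C μ Λ W b S P a) (hμ : IsLipschitzMeasure q μ)
    (hinv : ∀ v ∈ L, μ.map (shift v) = μ) (hN : 0 < N) (hNL : L.index ∣ N) (hwL : L.index ∣ w)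
    (hW : ∀ y ∈ W, ∀ i, -(w : ℤ) ≤ y i ∧ y i < N - w) :
    ∃ K : ℝ, ∀ (c : Vertex d) (k : ℕ) (e : ℝ), 0 < k →
      HasFreeEnergy Φ μ (box d ((k + 1) * N)) e →
      ∃ e', HasFreeEnergy Φ (resampleGrid L μ P b S N w c) (box d (k * N)) e' ∧
        e' ≤ e + K * ((((k + 1) * N : ℕ) : ℝ) ^ d - ((k * N : ℕ) : ℝ) ^ d) ∧
        (c ∈ L → e' ≤ e + K * ((((k + 1) * N : ℕ) : ℝ) ^ d - ((k * N : ℕ) : ℝ) ^ d) -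
          (k + 1 : ℝ) ^ d * a) := by
  have := hμ.isProb
  have hq := H.strong.constraint.quasimetric
  have hN' : (0 : ℤ) < N := by exact_mod_cast hN
  have hl := h.isLocalEvent
  obtain ⟨K, hK⟩ := exists_attachCost_le (E := E) hL hq N
  refine ⟨C + K, fun c k e hk he => ?_⟩
  have hkN : 0 < k * N := Nat.mul_pos hk hN
  have hle : k * N ≤ (k + 1) * N := Nat.mul_le_mul_right _ (Nat.le_succ k)
  -- If the grid misses `L`, nothing is resampled. Otherwise `N ℤ^d ⊆ L` puts the whole grid inside
  -- `L`.
  by_cases hne : (gridSites L N c).Nonempty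
  · obtain ⟨s₀, hs₀⟩ := hne
    set s := gridSite N w c 0 with hsdef
    have hs : s ∈ gridSites L N c := by
      refine gridSite_mem_iff.2 ?_
      have h1 : ∀ i, ∃ k, s i - s₀ i = N * k := fun i => by
        have e : s i - s₀ i = (s i - c i) - (s₀ i - c i) := by ring
        rw [e]
        exact dvd_sub (gridSite_dvd i) (hs₀.2 i)
      choose j hj using h1
      have e : gridSite N w c 0 = s₀ + N • j := by
        funext i
        rw [Pi.add_apply, nsmul_apply, ← hj i]
        ring
      rw [e]
      exact L.add_mem hs₀.1 (index_smul_mem L hNL j)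
    have hsb : ∀ i, 0 ≤ w - s i ∧ w - s i < N := fun i => by
      have h1 := gridSite_bounds (w := w) (c := c) (y := (0 : Vertex d)) hN i
      rw [Pi.zero_apply] at h1
      constructor <;> linarith [h1.1, h1.2]
    -- The cell of `s` contains the origin, so a union of `k + 1` cells per direction starting there
    -- covers the box of side `k * N`. It is an `L`-translate of a box because `L.index` divides
    -- `w`.
    set D := translate (s - fun _ => (w : ℤ)) (box d ((k + 1) * N)) with hDdef
    have hwmem : (fun _ => (w : ℤ) : Vertex d) ∈ L := by
      have h1 := index_smul_mem L hwL (fun _ => (1 : ℤ))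
      have e : w • (fun _ => (1 : ℤ) : Vertex d) = fun _ => (w : ℤ) := by
        funext i
        rw [nsmul_apply, mul_one]
      rwa [e] at h1
    have hvL : (s - fun _ => (w : ℤ)) ∈ L := L.sub_mem hs.1 hwmem
    have heD : HasFreeEnergy Φ μ D e := he.translate H.periodic hvL (hinv _ hvL)
    set F := (box d (k + 1)).image fun j => s + N • j with hF
    have hinj : Function.Injective fun j : Vertex d => s + N • j := by
      intro i j hij
      have h1 : N • i = N • j := add_left_cancel hij
      funext l
      have h2 := congrFun h1 l
      rw [nsmul_apply, nsmul_apply] at h2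
      exact mul_left_cancel₀ hN'.ne' h2
    have hFs : ∀ x ∈ F, x ∈ gridSites L N c := by
      intro x hx
      obtain ⟨j, -, rfl⟩ := Finset.mem_image.1 hx
      refine ⟨L.add_mem hs.1 (index_smul_mem L hNL j), fun i => ?_⟩
      rw [Pi.add_apply, nsmul_apply, add_sub_right_comm]
      exact dvd_add (hs.2 i) (dvd_mul_right _ _)
    have hFD : ∀ x ∈ F, translate x W ⊆ D := by
      intro x hx y hy
      obtain ⟨j, hj, rfl⟩ := Finset.mem_image.1 hx
      refine mem_translate.2 (mem_box.2 fun i => ?_)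
      have h1 := hW _ (mem_translate.1 hy) i
      have h2 := mem_box.1 hj i
      simp only [Pi.sub_apply, Pi.add_apply, nsmul_apply] at h1 ⊢
      have h3 : 0 ≤ (N : ℤ) * j i := mul_nonneg hN'.le h2.1
      have h4 : (N : ℤ) * j i ≤ N * k := mul_le_mul_of_nonneg_left
        (by have := h2.2; push_cast at this; omega) hN'.le
      push_cast
      constructor <;> linarith [h1.1, h1.2]
    obtain ⟨e₁, he₁, hle₁⟩ := H.hasFreeEnergy_resampleAll (σ := gridSite N w c) h hμ hinv heD F
      (fun x hx => (hFs x hx).1) (fun x hx y hy => gridSite_add hW (hFs x hx) hy) hFD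
    have hS : MeasurableSet S := gradAlg_le _ _ hl.measurableSet
    have he₂ : HasFreeEnergy Φ (resampleGrid L μ P b S N w c) D e₁ := by
      refine he₁.congr fun g hg => ?_
      have hgu : Measurable g := hg.mono (gradAlg_le _) le_rfl
      rw [resampleGrid, resampleAll, resampleAll,
        lintegral_map hgu (measurable_stepAll hS hl.base_notMem _ _),
        lintegral_map hgu (measurable_stepAll hS hl.base_notMem _ _)]
      refine lintegral_congr fun p => gradAlg_congr hg fun x hx y hy => ?_
      rw [stepAll_apply_congr (y := x) _ _ (gridSite_mem_image_iff hN hs hNL hx).symm,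
        stepAll_apply_congr (y := y) _ _ (gridSite_mem_image_iff hN hs hNL hy).symm]
    have hνl : IsLipschitzMeasure q (resampleGrid L μ P b S N w c) :=
      hl.isLipschitzMeasure_resampleAll hq hμ (fun x hx => hx.1)
        fun x hx y hy => gridSite_add hW hx hy
    have hsub : box d (k * N) ⊆ D := by
      intro y hy
      refine mem_translate.2 (mem_box.2 fun i => ?_)
      have h1 := mem_box.1 hy i
      have h2 := hsb i
      simp only [Pi.sub_apply]
      push_cast at h1 ⊢
      constructor <;> linarith
    have hnear : ∀ y ∈ D, ∃ b ∈ box d (k * N), attachCost E q b y ≤ K := by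
      intro y hy
      have h1 : ∀ i, -(N : ℤ) < y i ∧ y i < k * N + N := fun i => by
        have h2 := mem_box.1 (mem_translate.1 hy) i
        have h3 := hsb i
        simp only [Pi.sub_apply] at h2
        push_cast at h2
        constructor <;> linarith
      have hkN' : (1 : ℤ) ≤ k * N := by exact_mod_cast hkN
      -- Clamp the coordinates of `y` to the box; none moves by more than `N`.
      refine ⟨fun i => max 0 (min (y i) (k * N - 1)), mem_box.2 fun i => ⟨le_max_left _ _, ?_⟩,
        hK _ _ fun i => ?_⟩
      · push_cast
        exact max_lt (by linarith) ((min_le_right _ _).trans_lt (by linarith))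
      · have h2 := h1 i
        generalize (k : ℤ) * N = M at *
        rw [abs_le]
        omega
    obtain ⟨e₃, he₃, hle₃⟩ := H.hasFreeEnergy_subset hνl hsub hnear he₂
    have hcard : ((D \ box d (k * N)).card : ℝ) =
        (((k + 1) * N : ℕ) : ℝ) ^ d - ((k * N : ℕ) : ℝ) ^ d := by
      rw [Finset.card_sdiff_of_subset hsub, hDdef, card_translate, card_box, card_box,
        Nat.cast_sub (Nat.pow_le_pow_left hle d)]
      push_cast
      rfl
    have hFcard : (F.card : ℝ) = (k + 1 : ℝ) ^ d := by
      rw [hF, Finset.card_image_of_injective _ hinj, card_box]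
      push_cast
      rfl
    rw [hcard] at hle₃
    rw [hFcard] at hle₁
    have h0 : 0 ≤ (k + 1 : ℝ) ^ d * a := mul_nonneg (by positivity) h.nonneg
    exact ⟨e₃, he₃, by linarith, fun _ => by linarith⟩
  · rw [Set.not_nonempty_iff_eq_empty] at hne
    obtain ⟨e₁, he₁, hle₁⟩ := H.hasFreeEnergy_subset hμ (K := K) (box_subset_box hle) (fun y hy => by
      obtain ⟨b, hb, hby⟩ := exists_near_box hkN (R := N) (by rw [add_mul, one_mul]) hy
      exact ⟨b, hb, hK b y hby⟩) he
    rw [card_box_sdiff hle] at hle₁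
    refine ⟨e₁, ?_, hle₁, fun hc => ?_⟩
    · rwa [resampleGrid, hne, resampleAll_empty]
    · have h1 : c ∈ gridSites L N c := ⟨hc, fun i => by simp⟩
      rw [hne] at h1
      exact absurd h1 (Set.notMem_empty _)

end Grid

end

section
/-! ### Averages of measures -/

/-- The average of finitely many measures. -/
def averageMeasure {ι : Type*} (s : Finset ι) (ν : ι → Measure (Config E d)) :
    Measure (Config E d) := (s.card : ℝ≥0∞)⁻¹ • ∑ i ∈ s, ν i

section Average

variable {L : AddSubgroup (Vertex d)} {A : SimpleGraph (Vertex d)} {q : Vertex d → Vertex d → ℝ}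
  {Φ Ψ Ξ : GradPotential E d} {C : ℝ} {D : Finset (Vertex d)} {ι : Type*} {s : Finset ι}
  {ν : ι → Measure (Config E d)}

theorem inv_card_ne_top (hs : s.Nonempty) : (s.card : ℝ≥0∞)⁻¹ ≠ ⊤ :=
  ENNReal.inv_ne_top.2 (Nat.cast_ne_zero.2 hs.card_pos.ne')

theorem averageMeasure_apply (T : Set (Config E d)) :
    averageMeasure s ν T = (s.card : ℝ≥0∞)⁻¹ * ∑ i ∈ s, ν i T := by
  rw [averageMeasure, Measure.smul_apply, Measure.finsetSum_apply, smul_eq_mul]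

theorem integral_averageMeasure (hs : s.Nonempty) {f : Config E d → ℝ}
    (hf : ∀ i ∈ s, Integrable f (ν i)) :
    Integrable f (averageMeasure s ν) ∧
      ∫ φ, f φ ∂(averageMeasure s ν) = (s.card : ℝ)⁻¹ * ∑ i ∈ s, ∫ φ, f φ ∂(ν i) := by
  refine ⟨(integrable_finsetSum_measure.2 hf).smul_measure (inv_card_ne_top hs), ?_⟩
  rw [averageMeasure, integral_smul_measure, integral_finsetSum_measure hf, ENNReal.toReal_inv,
    ENNReal.toReal_natCast, smul_eq_mul]

/-- This domination transfers null sets and negative-part bounds from the average to each of its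
terms. -/
theorem le_smul_averageMeasure {i : ι} (hi : i ∈ s) :
    ν i ≤ (s.card : ℝ≥0∞) • averageMeasure s ν := by
  have h0 : (s.card : ℝ≥0∞) ≠ 0 := Nat.cast_ne_zero.2 (Finset.card_pos.2 ⟨i, hi⟩).ne'
  refine Measure.le_iff.2 fun T _ => ?_
  rw [Measure.smul_apply, averageMeasure_apply, smul_eq_mul, ← mul_assoc,
    ENNReal.mul_inv_cancel h0 (ENNReal.natCast_ne_top _), one_mul]
  exact Finset.single_le_sum (f := fun i => ν i T) (fun _ _ => zero_le) hi

theorem isLipschitzMeasure_averageMeasure (hs : s.Nonempty)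
    (hν : ∀ i ∈ s, IsLipschitzMeasure q (ν i)) : IsLipschitzMeasure q (averageMeasure s ν) := by
  have h0 : (s.card : ℝ≥0∞) ≠ 0 := Nat.cast_ne_zero.2 hs.card_pos.ne'
  refine ⟨⟨?_⟩, ?_⟩
  · rw [averageMeasure_apply, Finset.sum_congr rfl fun i hi => (hν i hi).isProb.measure_univ,
      Finset.sum_const, nsmul_eq_mul, mul_one, ENNReal.inv_mul_cancel h0 (ENNReal.natCast_ne_top _)]
  · rw [ae_iff, averageMeasure_apply, Finset.sum_eq_zero, mul_zero]
    exact fun i hi => ae_iff.1 (hν i hi).ae_mem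

/-- Convexity of the free energy. -/
theorem IsSplit.hasFreeEnergy_averageMeasure (H : IsSplit L A q Φ Ψ Ξ C) (hs : s.Nonempty)
    (hν : ∀ i ∈ s, IsLipschitzMeasure q (ν i)) (hD : D.Nonempty) {e : ι → ℝ}
    (he : ∀ i ∈ s, HasFreeEnergy Φ (ν i) D (e i)) :
    ∃ e', HasFreeEnergy Φ (averageMeasure s ν) D e' ∧ e' ≤ (s.card : ℝ)⁻¹ * ∑ i ∈ s, e i := by
  have hl := isLipschitzMeasure_averageMeasure hs hν
  have := hl.isProb
  obtain ⟨b, hb⟩ := hD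
  obtain ⟨f, hf⟩ : ∃ f, HasDensity Φ (averageMeasure s ν) D f := by
    refine exists_hasDensity (H.weight_ne_top D) hb fun T hT h0 => ?_
    have hT1 : Measurable[gradAlg E (D : Set (Vertex d))] (T.indicator (1 : Config E d → ℝ≥0∞)) :=
      Measurable.indicator measurable_const hT
    have hwT : HeightMeasurable fun φ => weight Φ D φ * T.indicator 1 φ :=
      heightMeasurable_of_gradAlg (Measurable.mul (measurable_weight Φ D) hT1)
    rw [averageMeasure_apply, Finset.sum_eq_zero, mul_zero]
    intro i hi
    obtain ⟨g, hg, -⟩ := he i hi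
    rw [← lintegral_indicator_one (gradAlg_le _ _ hT), hg.lintegral_eq b hb _ hT1]
    exact refIntegral_mul_eq_zero hwT h0
  have hfu : Measurable f := hf.measurable.mono (gradAlg_le _) le_rfl
  have key : ∀ i ∈ s, Integrable (fun φ => Real.log (f φ).toReal) (ν i) ∧
      ∫ φ, Real.log (f φ).toReal ∂(ν i) ≤ e i := by
    intro i hi
    have := (hν i hi).isProb
    obtain ⟨g, hg, hgi, hge⟩ := he i hi
    have hgu : Measurable g := hg.measurable.mono (gradAlg_le _) le_rfl
    have hle := le_smul_averageMeasure (ν := ν) hi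
    have hac : ν i ≪ averageMeasure s ν :=
      (Measure.absolutelyContinuous_of_le hle).trans (Measure.smul_absolutelyContinuous)
    -- The quotient of the two densities has integral at most the total mass of the average. Gibbs'
    -- inequality then bounds `∫ log f ∂(ν i)` by `e i`, and averaging over `i` gives convexity.
    have h1 : ∫⁻ φ, f φ / g φ ∂(ν i) ≤ ENNReal.ofReal 1 := by
      rw [hg.lintegral_eq b hb _ (show Measurable[gradAlg E (D : Set (Vertex d))]
        fun φ => f φ / g φ from Measurable.div hf.measurable hg.measurable),
        ENNReal.ofReal_one, ← hf.refIntegral_eq_one hb]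
      refine refIntegral_mono fun φ => ?_
      calc g φ * (weight Φ D φ * (f φ / g φ)) = weight Φ D φ * (g φ * (f φ / g φ)) := by ring
        _ ≤ weight Φ D φ * f φ := mul_le_mul_right ENNReal.mul_div_le _
        _ = _ := mul_comm _ _
    have h2 : ∫⁻ φ, ENNReal.ofReal (-Real.log (f φ).toReal) ∂(ν i) ≠ ⊤ := by
      refine ne_top_of_le_ne_top ?_ (lintegral_mono' hle le_rfl)
      rw [lintegral_smul_measure]
      exact ENNReal.mul_ne_top (ENNReal.natCast_ne_top _) (H.lintegral_neg_log_ne_top hl hf hb)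
    obtain ⟨h3, h4⟩ := gibbs_inequality hgu hfu (hg.ae_ne hb) (hac.ae_le (hf.ae_ne hb)) one_pos h1
      hgi h2
    rw [Real.log_one, add_zero, hge] at h4
    exact ⟨h3, h4⟩
  obtain ⟨h1, h2⟩ := integral_averageMeasure hs fun i hi => (key i hi).1
  refine ⟨_, ⟨f, hf, h1, rfl⟩, ?_⟩
  rw [h2]
  exact mul_le_mul_of_nonneg_left (Finset.sum_le_sum fun i hi => (key i hi).2) (by positivity)

/-- A shift permutes the residue classes modulo `N`, of which the box is a set of representatives.
-/
theorem sum_box_periodic {β : Type*} [AddCommMonoid β] {N : ℕ} (hN : 0 < N) {f : Vertex d → β}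
    (hf : ∀ c c' : Vertex d, (∀ i, (N : ℤ) ∣ c i - c' i) → f c = f c') (v : Vertex d) :
    ∑ c ∈ box d N, f (c - v) = ∑ c ∈ box d N, f c := by
  have hN' : (0 : ℤ) < N := by exact_mod_cast hN
  have hmem : ∀ c : Vertex d, (fun i => c i % N) ∈ box d N := fun c => mem_box.2 fun i =>
    ⟨Int.emod_nonneg _ hN'.ne', Int.emod_lt_of_pos _ hN'⟩
  have hred : ∀ c ∈ box d N, (fun i => c i % N) = c := fun c hc => funext fun i =>
    Int.emod_eq_of_lt (mem_box.1 hc i).1 (mem_box.1 hc i).2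
  refine Finset.sum_bij' (fun c _ => fun i => (c - v) i % N) (fun c _ => fun i => (c + v) i % N)
    (fun c _ => hmem _) (fun c _ => hmem _) (fun c hc => ?_) (fun c hc => ?_) fun c _ => ?_
  · conv_rhs => rw [← hred c hc]
    funext i
    simp
  · conv_rhs => rw [← hred c hc]
    funext i
    simp
  · exact hf _ _ fun i => Int.dvd_self_sub_emod

end Average

/-! ### The slope -/

section Slope

variable {L : AddSubgroup (Vertex d)} {q : Vertex d → Vertex d → ℝ} {μ ν : Measure (Config E d)}

theorem IsLipschitzMeasure.integrable (hν : IsLipschitzMeasure q ν) (x y : Vertex d) :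
    Integrable (fun φ : Config E d => E.toReal (φ y - φ x)) ν := by
  have := hν.isProb
  refine Integrable.of_bound ((measurable_toReal E).comp
    (measurable_grad x y)).aestronglyMeasurable (heightRange q x y) ?_
  exact hν.ae_mem.mono fun φ hφ => sub_mem_heightBall hφ x y

theorem IsLipschitzMeasure.integral_nsmul (hν : IsLipschitzMeasure q ν)
    (hinv : ∀ v ∈ L, ν.map (shift v) = ν) {x : Vertex d} (hx : x ∈ L) (n : ℕ) :
    ∫ φ, E.toReal (φ (n • x) - φ 0) ∂ν = n * ∫ φ, E.toReal (φ x - φ 0) ∂ν := by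
  induction n with
  | zero => simp [toReal_zero]
  | succ n ih =>
    have h1 : ∫ φ, E.toReal (φ (x + n • x) - φ (n • x)) ∂ν = ∫ φ, E.toReal (φ x - φ 0) ∂ν := by
      have h2 := integral_map (μ := ν) (measurable_shift (n • x)).aemeasurable
        (f := fun φ : Config E d => E.toReal (φ x - φ 0))
        ((measurable_toReal E).comp (measurable_grad 0 x)).aestronglyMeasurable
      rw [hinv _ (L.nsmul_mem hx n)] at h2
      rw [h2]
      congr 1
      funext φ
      change _ = E.toReal (φ (x + n • x) - φ (0 + n • x))
      rw [zero_add]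
    have h3 : ∀ φ : Config E d, E.toReal (φ ((n + 1) • x) - φ 0) =
        E.toReal (φ (x + n • x) - φ (n • x)) + E.toReal (φ (n • x) - φ 0) := fun φ => by
      rw [← toReal_add, sub_add_sub_cancel, succ_nsmul']
    simp only [h3]
    rw [integral_add (hν.integrable _ _) (hν.integrable _ _), h1, ih]
    push_cast
    ring

/-- By invariance the mean height difference over `n • x` is `n` times that over `x`; a discrepancy
between the two measures would grow linearly and exceed `B`. -/
theorem HasSlope.of_bounded (hμ : IsLipschitzMeasure q μ) (hν : IsLipschitzMeasure q ν)
    (hμi : ∀ v ∈ L, μ.map (shift v) = μ) (hνi : ∀ v ∈ L, ν.map (shift v) = ν) {B : ℝ}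
    (hB : ∀ z : Vertex d, |∫ φ, E.toReal (φ z - φ 0) ∂ν - ∫ φ, E.toReal (φ z - φ 0) ∂μ| ≤ B)
    {u : Module.Dual ℝ (Fin d → ℝ)} (h : HasSlope L μ u) : HasSlope L ν u := by
  refine ⟨hν.integrable, fun x hx => (h.eq_integral x hx).trans ?_⟩
  by_contra hne
  have h1 : 0 < |∫ φ, E.toReal (φ x - φ 0) ∂ν - ∫ φ, E.toReal (φ x - φ 0) ∂μ| :=
    abs_pos.2 (sub_ne_zero.2 (Ne.symm hne))
  obtain ⟨n, hn⟩ := exists_nat_gt (B / |∫ φ, E.toReal (φ x - φ 0) ∂ν -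
    ∫ φ, E.toReal (φ x - φ 0) ∂μ|)
  rw [div_lt_iff₀ h1] at hn
  have h2 := hB (n • x)
  rw [hν.integral_nsmul hνi hx, hμ.integral_nsmul hμi hx, ← mul_sub, abs_mul, Nat.abs_cast] at h2
  linarith

/-! ### Bounded displacement of heights under resampling. -/

variable {Λ W : Finset (Vertex d)} {b : Vertex d} {S : Set (Config E d)}
  {σ : Vertex d → Vertex d} {X : Set (Vertex d)} {φ : Config E d}
  {P : Measure (Λ → E)} [IsProbabilityMeasure P]

/-- The height at `b + x` does not move, and both the old and the new heights in `Λ + x` are within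
the Lipschitz range of it; this gives the factor two. -/
theorem IsLocalEvent.abs_stepAll_sub_le (h : IsLocalEvent q Λ W b S)
    (hq : IsAdmissibleQuasimetric L q) (hXL : X ⊆ L)
    (hσ : ∀ x ∈ X, ∀ y ∈ W, σ (y + x) = x) (hφ : φ ∈ lipschitzSet E q) (U : Vertex d → Λ → E)
    (z : Vertex d) : |E.toReal (stepAll Λ b S σ X φ U z) - E.toReal (φ z)| ≤
      2 * ∑ y ∈ Λ, |heightRange q b y| := by
  have hm : ∀ y ∈ Λ, heightRange q b y ≤ ∑ y ∈ Λ, |heightRange q b y| := fun y hy =>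
    (le_abs_self _).trans (Finset.single_le_sum (f := fun y => |heightRange q b y|)
      (fun _ _ => abs_nonneg _) hy)
  have h0 : 0 ≤ ∑ y ∈ Λ, |heightRange q b y| := Finset.sum_nonneg fun _ _ => abs_nonneg _
  by_cases hz : σ z ∈ X
  · by_cases hzΛ : z - σ z ∈ Λ
    · have hT := h.stepAll_mem hq hXL hσ hφ U
      have hp : stepAll Λ b S σ X φ U (b + σ z) = φ (b + σ z) := by
        have h1 := hσ _ hz b h.base_mem
        have h2 : σ (b + σ z) ∈ X := by rwa [h1]
        simp only [stepAll, if_pos h2, h1]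
        exact siteStep_apply_notMem _ _ (by rw [add_sub_cancel_right]; exact h.base_notMem)
      have hr : heightRange q (b + σ z) z = heightRange q b (z - σ z) := by
        have h1 := hq.invariant _ (hXL hz) b (z - σ z)
        have h2 := hq.invariant _ (hXL hz) (z - σ z) b
        rw [sub_add_cancel] at h1 h2
        rw [heightRange, heightRange, h1, h2]
      have h3 := sub_mem_heightBall hT (b + σ z) z
      have h4 := sub_mem_heightBall hφ (b + σ z) z
      rw [heightBall, Set.mem_ofPred_eq, toReal_sub, hr] at h3 h4
      rw [hp] at h3
      have h5 := hm _ hzΛ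
      rw [abs_le] at h3 h4 ⊢
      constructor <;> linarith [h3.1, h3.2, h4.1, h4.2]
    · simp only [stepAll, if_pos hz]
      rw [siteStep_apply_notMem _ _ hzΛ, sub_self, abs_zero]
      linarith
  · rw [stepAll_apply_notMem _ _ hz, sub_self, abs_zero]
    linarith

theorem IsLocalEvent.abs_integral_sub_le (h : IsLocalEvent q Λ W b S)
    (hq : IsAdmissibleQuasimetric L q) (hμ : IsLipschitzMeasure q μ) (hXL : X ⊆ L)
    (hσ : ∀ x ∈ X, ∀ y ∈ W, σ (y + x) = x) (z : Vertex d) :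
    |∫ φ, E.toReal (φ z - φ 0) ∂(resampleAll μ P b S σ X) - ∫ φ, E.toReal (φ z - φ 0) ∂μ| ≤
      4 * ∑ y ∈ Λ, |heightRange q b y| := by
  have := hμ.isProb
  have hν : IsLipschitzMeasure q (resampleAll μ P b S σ X) :=
    h.isLipschitzMeasure_resampleAll hq hμ hXL hσ
  have hT := measurable_stepAll (Λ := Λ) (gradAlg_le _ _ h.measurableSet) h.base_notMem σ X
  set I := Measure.infinitePi fun _ : Vertex d => P with hI
  have hfst : MeasurePreserving (Prod.fst : Config E d × (Vertex d → Λ → E) → Config E d)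
      (μ.prod I) μ := measurePreserving_fst
  have hmp : MeasurePreserving (fun p : Config E d × (Vertex d → Λ → E) =>
      stepAll Λ b S σ X p.1 p.2) (μ.prod I) (resampleAll μ P b S σ X) := ⟨hT, rfl⟩
  have hg : Measurable fun φ : Config E d => E.toReal (φ z - φ 0) :=
    (measurable_toReal E).comp (measurable_grad 0 z)
  have h1 := integral_map (μ := μ.prod I) hT.aemeasurable hg.aestronglyMeasurable
  have h2 := integral_map (μ := μ.prod I) hfst.measurable.aemeasurable
    (f := fun φ : Config E d => E.toReal (φ z - φ 0)) hg.aestronglyMeasurable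
  rw [hfst.map_eq] at h2
  have hi1 := hmp.integrable_comp_of_integrable (hν.integrable 0 z)
  have hi2 := hfst.integrable_comp_of_integrable (hμ.integrable 0 z)
  rw [resampleAll, h1, h2]
  have h6 := integral_sub hi1 hi2
  simp only [Function.comp_apply] at h6
  rw [← h6]
  have hae : ∀ᵐ p ∂(μ.prod I), p.1 ∈ lipschitzSet E q :=
    hfst.quasiMeasurePreserving.ae hμ.ae_mem
  have h3 := norm_integral_le_of_norm_le_const (μ := μ.prod I)
    (f := fun p => E.toReal (stepAll Λ b S σ X p.1 p.2 z - stepAll Λ b S σ X p.1 p.2 0) -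
      E.toReal (p.1 z - p.1 0)) (C := 4 * ∑ y ∈ Λ, |heightRange q b y|)
    (hae.mono fun p hp => by
      have h4 := h.abs_stepAll_sub_le hq hXL hσ hp p.2 z
      have h5 := h.abs_stepAll_sub_le hq hXL hσ hp p.2 0
      rw [Real.norm_eq_abs, toReal_sub, toReal_sub]
      rw [abs_le] at h4 h5 ⊢
      constructor <;> linarith [h4.1, h4.2, h5.1, h5.2])
  rwa [probReal_univ, mul_one, Real.norm_eq_abs] at h3

end Slope

end

section
/-! ### Minimizers cannot be improved -/

section Minimal

variable {L : AddSubgroup (Vertex d)} {A : SimpleGraph (Vertex d)} {q : Vertex d → Vertex d → ℝ}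
  {Φ Ψ Ξ : GradPotential E d} {C : ℝ} {μ ν : Measure (Config E d)} {Λ W D : Finset (Vertex d)}
  {b : Vertex d} {S : Set (Config E d)} {P : Measure (Λ → E)} [IsProbabilityMeasure P] {a : ℝ}

theorem HasSpecificFreeEnergy.eventually_lt {h : EReal} (hh : HasSpecificFreeEnergy Φ μ h) {B : ℝ}
    (hB : h < B) : ∀ᶠ n : ℕ in atTop, freeEnergy Φ μ (box d n) 0 ≠ ⊤ ∧
      ∀ e : ℝ, freeEnergy Φ μ (box d n) 0 = e → e ≤ B * (n : ℝ) ^ d := by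
  filter_upwards [hh.eventually_lt_const hB, eventually_gt_atTop 0] with n hn hn0
  have hpos : (0 : ℝ) < (n : ℝ) ^ d := by positivity
  constructor
  · intro h
    rw [h, EReal.top_div_of_pos_ne_top (EReal.coe_pos.2 hpos) (EReal.coe_ne_top _)] at hn
    exact not_top_lt hn
  · intro e he
    rw [he, ← EReal.coe_div, EReal.coe_lt_coe_iff, div_lt_iff₀ hpos] at hn
    exact hn.le

/-- Finiteness of the free energy passes from a large box to every smaller one. -/
theorem IsSplit.hasFreeEnergy_box_of_frequently (H : IsSplit L A q Φ Ψ Ξ C) (hL : L.FiniteIndex)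
    (hν : IsLipschitzMeasure q ν)
    (h : ∃ᶠ n : ℕ in atTop, ∃ e, HasFreeEnergy Φ ν (box d n) e) {n : ℕ} (hn : 0 < n) :
    ∃ e, HasFreeEnergy Φ ν (box d n) e := by
  obtain ⟨m, hm, e, he⟩ := frequently_atTop.1 h n
  obtain ⟨K, hK⟩ := H.hasFreeEnergy_box hν hL (m - n)
  obtain ⟨e', he', -⟩ := hK n m hn hm (by omega) e he
  exact ⟨e', he'⟩

/-- The specific free energy of a Lipschitz measure, if it is not infinite. -/
theorem IsSplit.exists_specificFreeEnergy (H : IsSplit L A q Φ Ψ Ξ C) (hd : 0 < d)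
    (hL : L.FiniteIndex) (hμ : IsLipschitzMeasure q μ) (hinv : ∀ v ∈ L, μ.map (shift v) = μ)
    {h : EReal} (hh : HasSpecificFreeEnergy Φ μ h) (htop : h < ⊤) :
    ∃ (e : ℕ → ℝ) (l : ℝ), (∀ n, 0 < n → HasFreeEnergy Φ μ (box d n) (e n)) ∧
      Tendsto (fun n => e n / (n : ℝ) ^ d) atTop (𝓝 l) ∧ h = l := by
  have := hμ.isProb
  obtain ⟨B, hB, -⟩ := EReal.lt_iff_exists_real_btwn.1 htop
  have hev := hh.eventually_lt hB
  have h1 : ∀ n, ∃ e, 0 < n → HasFreeEnergy Φ μ (box d n) e := by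
    intro n
    by_cases hn : 0 < n
    · obtain ⟨e, he⟩ := H.hasFreeEnergy_box_of_frequently hL hμ (by
        refine Eventually.frequently ?_
        filter_upwards [hev, eventually_gt_atTop 0] with n hn hn0
        exact H.exists_hasFreeEnergy hμ (zero_mem_box hn0) hn.1) hn
      exact ⟨e, fun _ => he⟩
    · exact ⟨0, fun h => absurd h hn⟩
  choose e he using h1
  obtain ⟨l, hl⟩ := H.exists_tendsto hd hL hμ hinv he ⟨B, by
    refine Eventually.frequently ?_
    filter_upwards [hev, eventually_gt_atTop 0] with n hn hn0
    exact hn.2 _ ((he n hn0).freeEnergy_eq H (zero_mem_box hn0))⟩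
  -- The limit found by superadditivity is real, which also rules out the value `-∞` for `h`.
  exact ⟨e, l, he, hl, tendsto_nhds_unique hh (hasSpecificFreeEnergy_of_tendsto H he hl)⟩

theorem map_shift_averageMeasure [IsProbabilityMeasure μ] (hS : MeasurableSet S) (hb : b ∉ Λ)
    (hinv : ∀ v ∈ L, μ.map (shift v) = μ) {N w : ℕ} (hN : 0 < N) {v : Vertex d} (hv : v ∈ L) :
    (averageMeasure (box d N) (resampleGrid L μ P b S N w)).map (shift v) =
      averageMeasure (box d N) (resampleGrid L μ P b S N w) := by
  ext T hT
  rw [Measure.map_apply (measurable_shift v) hT, averageMeasure_apply, averageMeasure_apply]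
  congr 1
  rw [← sum_box_periodic hN (f := fun c => resampleGrid L μ P b S N w c T) (fun c c' h => by
    rw [resampleGrid_congr h]) v]
  refine Finset.sum_congr rfl fun c _ => ?_
  rw [← map_shift_resampleGrid hS hb hv (hinv v hv), Measure.map_apply (measurable_shift v) hT]

/-- Take for `w` a multiple of the index that exceeds all coordinates of `W` in absolute value, and
`N = 2 * w`. -/
theorem exists_grid (hL : L.FiniteIndex) (W : Finset (Vertex d)) :
    ∃ N w : ℕ, 0 < N ∧ L.index ∣ N ∧ L.index ∣ w ∧
      ∀ y ∈ W, ∀ i, -(w : ℤ) ≤ y i ∧ y i < N - w := by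
  have hp : 0 < L.index := Nat.pos_of_ne_zero hL.index_ne_zero
  set M := ∑ y ∈ W, ∑ i, (y i).natAbs with hM
  refine ⟨2 * (L.index * (M + 1)), L.index * (M + 1), by positivity, ⟨2 * (M + 1), by ring⟩,
    ⟨M + 1, rfl⟩, fun y hy i => ?_⟩
  have h1 : (y i).natAbs ≤ M := (Finset.single_le_sum (f := fun i => (y i).natAbs)
    (fun _ _ => Nat.zero_le _) (Finset.mem_univ i)).trans
    (Finset.single_le_sum (f := fun y : Vertex d => ∑ i, (y i).natAbs)
      (fun _ _ => Nat.zero_le _) hy)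
  have h2 : M + 1 ≤ L.index * (M + 1) := Nat.le_mul_of_pos_left _ hp
  generalize L.index * (M + 1) = w at h2 ⊢
  push_cast
  omega

theorem tendsto_box_ratio (d : ℕ) :
    Tendsto (fun k : ℕ => ((k + 1 : ℝ) / k) ^ d) atTop (𝓝 1) := by
  have h1 : Tendsto (fun k : ℕ => (k + 1 : ℝ) / k) atTop (𝓝 1) := by
    have h2 := (tendsto_const_div_atTop_nhds_zero_nat (1 : ℝ)).const_add 1
    rw [add_zero] at h2
    refine h2.congr' ?_
    filter_upwards [eventually_gt_atTop 0] with k hk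
    have hk' : (k : ℝ) ≠ 0 := Nat.cast_ne_zero.2 hk.ne'
    field_simp
  simpa using h1.pow d

/-- An efficient resampling contradicts the minimality of the specific free energy. -/
theorem IsSplit.not_isEfficient (H : IsSplit L A q Φ Ψ Ξ C) (hd : 0 < d) (hL : L.FiniteIndex)
    (hμ : IsMinimizer L Φ μ) (hμl : IsLipschitzMeasure q μ) (h : IsEfficient q Ψ C μ Λ W b S P a)
    (ha : 0 < a) : False := by
  have := hμl.isProb
  have hq := H.strong.constraint.quasimetric
  have hinv := hμ.invariant.map_shift
  have hl := h.isLocalEvent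
  have hS : MeasurableSet S := gradAlg_le _ _ hl.measurableSet
  obtain ⟨u, η, hslope, hη, hmin, htop⟩ := hμ.minimal
  obtain ⟨e, l, he, hlim, rfl⟩ := H.exists_specificFreeEnergy hd hL hμl hinv hη htop
  obtain ⟨N, w, hN, hNL, hwL, hW⟩ := exists_grid hL W
  obtain ⟨K, hK⟩ := H.exists_hasFreeEnergy_resampleGrid hL h hμl hinv hN hNL hwL hW
  set ν := averageMeasure (box d N) (resampleGrid L μ P b S N w) with hν
  have hne : (box d N).Nonempty := ⟨0, zero_mem_box hN⟩
  have hνc : ∀ c, IsLipschitzMeasure q (resampleGrid L μ P b S N w c) := fun c =>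
    hl.isLipschitzMeasure_resampleAll hq hμl (fun x hx => hx.1)
      fun x hx y hy => gridSite_add hW hx hy
  have hνl : IsLipschitzMeasure q ν := isLipschitzMeasure_averageMeasure hne fun c _ => hνc c
  have := hνl.isProb
  have hνinv : ∀ v ∈ L, ν.map (shift v) = ν := fun v hv =>
    map_shift_averageMeasure hS hl.base_notMem hinv hN hv
  have hcard : ((box d N).card : ℝ) = (N : ℝ) ^ d := by
    rw [card_box]
    push_cast
    rfl
  have hNd : (0 : ℝ) < (N : ℝ) ^ d := by positivity
  have hνslope : HasSlope L ν u := by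
    refine hslope.of_bounded hμl hνl hinv hνinv (B := 4 * ∑ y ∈ Λ, |heightRange q b y|) fun z => ?_
    have h1 := (integral_averageMeasure hne fun c _ => (hνc c).integrable 0 z).2
    have h2 : ∀ c, |∫ φ, E.toReal (φ z - φ 0) ∂(resampleGrid L μ P b S N w c) -
        ∫ φ, E.toReal (φ z - φ 0) ∂μ| ≤ 4 * ∑ y ∈ Λ, |heightRange q b y| := fun c =>
      hl.abs_integral_sub_le hq hμl (fun x hx => hx.1) (fun x hx y hy => gridSite_add hW hx hy) z
    have h3 : ∫ φ, E.toReal (φ z - φ 0) ∂ν - ∫ φ, E.toReal (φ z - φ 0) ∂μ =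
        ((N : ℝ) ^ d)⁻¹ * ∑ c ∈ box d N, (∫ φ, E.toReal (φ z - φ 0) ∂(resampleGrid L μ P b S N w c) -
          ∫ φ, E.toReal (φ z - φ 0) ∂μ) := by
      rw [Finset.sum_sub_distrib, Finset.sum_const, nsmul_eq_mul, hcard, mul_sub,
        inv_mul_cancel_left₀ hNd.ne', ← hcard]
      exact congrArg (· - _) h1
    rw [h3, abs_mul, abs_of_pos (inv_pos.2 hNd), inv_mul_le_iff₀ hNd]
    refine (Finset.abs_sum_le_sum_abs _ _).trans ((Finset.sum_le_sum fun c _ => h2 c).trans ?_)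
    rw [Finset.sum_const, nsmul_eq_mul, hcard]
  have hgrid : ∀ k : ℕ, 0 < k → ∃ e', HasFreeEnergy Φ ν (box d (k * N)) e' ∧
      e' ≤ e ((k + 1) * N) + K * ((((k + 1) * N : ℕ) : ℝ) ^ d - ((k * N : ℕ) : ℝ) ^ d) -
        (k + 1 : ℝ) ^ d * a / (N : ℝ) ^ d := by
    intro k hk
    have h1 := fun c => hK c k _ hk (he ((k + 1) * N) (Nat.mul_pos (Nat.succ_pos k) hN))
    choose e₁ h2 h3 h4 using h1
    obtain ⟨e₂, h5, h6⟩ := H.hasFreeEnergy_averageMeasure hne (fun c _ => hνc c)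
      ⟨0, zero_mem_box (Nat.mul_pos hk hN)⟩ (fun c _ => h2 c)
    refine ⟨e₂, h5, h6.trans ?_⟩
    set M := e ((k + 1) * N) + K * ((((k + 1) * N : ℕ) : ℝ) ^ d - ((k * N : ℕ) : ℝ) ^ d) with hM
    -- The gain of the single offset `c = 0`, which lies in `L`, is enough; the average dilutes it
    -- by `N ^ d`.
    have h7 : ∑ c ∈ box d N, e₁ c ≤ ∑ c ∈ box d N, (M - if c = 0 then (k + 1 : ℝ) ^ d * a else 0) := by
      refine Finset.sum_le_sum fun c _ => ?_
      split_ifs with hc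
      · exact h4 c (hc ▸ L.zero_mem)
      · rw [sub_zero]
        exact h3 c
    rw [Finset.sum_sub_distrib, Finset.sum_const, nsmul_eq_mul, Finset.sum_ite_eq',
      if_pos (zero_mem_box hN)] at h7
    rw [hcard] at h7 ⊢
    calc ((N : ℝ) ^ d)⁻¹ * ∑ c ∈ box d N, e₁ c
        ≤ ((N : ℝ) ^ d)⁻¹ * ((N : ℝ) ^ d * M - (k + 1 : ℝ) ^ d * a) :=
          mul_le_mul_of_nonneg_left h7 (inv_pos.2 hNd).le
      _ = M - (k + 1 : ℝ) ^ d * a / (N : ℝ) ^ d := by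
          field_simp
  have hmulN : Tendsto (fun k : ℕ => k * N) atTop atTop :=
    tendsto_id.atTop_mul_const' hN
  have hbox : ∀ n, ∃ e', 0 < n → HasFreeEnergy Φ ν (box d n) e' := by
    intro n
    by_cases hn : 0 < n
    · obtain ⟨e', he'⟩ := H.hasFreeEnergy_box_of_frequently hL hνl
        (hmulN.frequently (Eventually.frequently (by
          filter_upwards [eventually_gt_atTop 0] with k hk
          obtain ⟨e', he', -⟩ := hgrid k hk
          exact ⟨e', he'⟩))) hn
      exact ⟨e', fun _ => he'⟩
    · exact ⟨0, fun h => absurd h hn⟩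
  choose e' he' using hbox
  -- This is the bound from `hgrid` per vertex of the box of side `k * N`. One factor `N ^ d` below
  -- `a` comes from the average over offsets, the other from the density of the grid.
  set r : ℕ → ℝ := fun k => e ((k + 1) * N) / (((k + 1) * N : ℕ) : ℝ) ^ d * ((k + 1 : ℝ) / k) ^ d +
    K * (((k + 1 : ℝ) / k) ^ d - 1) - ((k + 1 : ℝ) / k) ^ d * (a / ((N : ℝ) ^ d * (N : ℝ) ^ d))
    with hr
  have hr_lim : Tendsto r atTop (𝓝 (l - a / ((N : ℝ) ^ d * (N : ℝ) ^ d))) := by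
    have h1 := hlim.comp (hmulN.comp (tendsto_add_atTop_nat 1))
    have h2 := tendsto_box_ratio d
    have h3 := ((h1.mul h2).add ((h2.sub_const 1).const_mul K)).sub
      (h2.mul_const (a / ((N : ℝ) ^ d * (N : ℝ) ^ d)))
    rw [sub_self, mul_zero, add_zero, mul_one, one_mul] at h3
    exact h3
  have hle : ∀ k : ℕ, 0 < k → e' (k * N) / ((k * N : ℕ) : ℝ) ^ d ≤ r k := by
    intro k hk
    obtain ⟨e₁, h1, h2⟩ := hgrid k hk
    have hkN := Nat.mul_pos hk hN
    rw [(he' _ hkN).unique H h1 ⟨0, zero_mem_box hkN⟩]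
    have hk' : (0 : ℝ) < k := Nat.cast_pos.2 hk
    have hN' : (0 : ℝ) < N := Nat.cast_pos.2 hN
    have hpos : (0 : ℝ) < ((k * N : ℕ) : ℝ) ^ d := by positivity
    rw [div_le_iff₀ hpos]
    refine h2.trans (le_of_eq ?_)
    rw [hr]
    push_cast
    simp only [mul_pow, div_pow]
    field_simp
  -- The bound is known only for multiples of `N`, that is, along a subsequence; superadditivity
  -- upgrades it to convergence of the full sequence.
  obtain ⟨l', hl'⟩ := H.exists_tendsto hd hL hνl hνinv he' ⟨l - a / ((N : ℝ) ^ d * (N : ℝ) ^ d) + 1, by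
    refine hmulN.frequently (Eventually.frequently ?_)
    filter_upwards [eventually_gt_atTop 0, hr_lim.eventually_lt_const (lt_add_one _)] with k hk hrk
    have hkN := Nat.mul_pos hk hN
    have h1 := (hle k hk).trans hrk.le
    rwa [div_le_iff₀ (by positivity)] at h1⟩
  have hll : l' ≤ l - a / ((N : ℝ) ^ d * (N : ℝ) ^ d) := by
    refine le_of_tendsto_of_tendsto (hl'.comp hmulN) hr_lim ?_
    filter_upwards [eventually_gt_atTop 0] with k hk
    exact hle k hk
  have hlt : l' < l := hll.trans_lt (sub_lt_self _ (by positivity))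
  have h1 : surfaceTension L Φ u ≤ l' := sInf_le
    ⟨ν, ⟨hνl.isProb, hνinv⟩, hνslope, hasSpecificFreeEnergy_of_tendsto H he' hl'⟩
  rw [← hmin] at h1
  exact absurd (EReal.coe_le_coe_iff.1 h1) (not_le.2 hlt)

end Minimal

end

section
/-! ### Minimizers are supported on Lipschitz functions -/

section Support

variable {L : AddSubgroup (Vertex d)} {A : SimpleGraph (Vertex d)} {q : Vertex d → Vertex d → ℝ}
  {Φ Ψ Ξ : GradPotential E d} {C : ℝ} {μ : Measure (Config E d)} {Λ W : Finset (Vertex d)}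
  {b : Vertex d} {S : Set (Config E d)}

/-- Finite free energy in large boxes gives a density with respect to a measure that does not charge
violated edges. An arbitrary edge is moved into such a box by a translation from `L`, and invariance
carries the conclusion back. -/
theorem IsSplit.isLipschitzMeasure (H : IsSplit L A q Φ Ψ Ξ C) (hL : L.FiniteIndex)
    (hμ : IsInvariantProb L μ) {h : EReal} (hh : HasSpecificFreeEnergy Φ μ h) (htop : h < ⊤) :
    IsLipschitzMeasure q μ := by
  have := hμ.isProb
  have hp : 0 < L.index := Nat.pos_of_ne_zero hL.index_ne_zero
  obtain ⟨B, hB, -⟩ := EReal.lt_iff_exists_real_btwn.1 htop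
  obtain ⟨n₀, hn₀⟩ := eventually_atTop.1 (hh.eventually_lt hB)
  have hedge : ∀ x y, A.Adj x y → ∀ᵐ φ ∂μ, E.toReal (φ y) - E.toReal (φ x) ≤ q x y := by
    intro x y hA
    set M := ∑ i, ((x i).natAbs + (y i).natAbs) with hM
    have hxy : ∀ i, (x i).natAbs + (y i).natAbs ≤ M := fun i =>
      Finset.single_le_sum (f := fun i => (x i).natAbs + (y i).natAbs) (fun _ _ => Nat.zero_le _)
        (Finset.mem_univ i)
    -- A diagonal translation in `L`, large enough to make all coordinates of `x` and `y`
    -- nonnegative.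
    set v : Vertex d := L.index • fun _ => (M : ℤ) with hv
    have hvL : v ∈ L := index_smul_mem L dvd_rfl _
    set n := max n₀ (L.index * M + M + 1) with hn
    have hle : M ≤ L.index * M := Nat.le_mul_of_pos_left _ hp
    have hmem : ∀ z : Vertex d, (∀ i, (z i).natAbs ≤ M) → z + v ∈ box d n := fun z hz =>
      mem_box.2 fun i => by
        have h1 := hz i
        have h2 : ((L.index * M + M + 1 : ℕ) : ℤ) ≤ n := by exact_mod_cast le_max_right _ _
        rw [Pi.add_apply, hv, nsmul_apply, ← Nat.cast_mul]
        generalize L.index * M = t at hle h2 ⊢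
        omega
    have h0 := zero_mem_box (d := d) (n := n) (by omega)
    obtain ⟨f, hf, -⟩ := exists_hasDensity_of_freeEnergy_ne_top (H.weight_ne_top (box d n)) h0
      (hn₀ n (le_max_left _ _)).1
    have h1 : ∀ᵐ φ ∂μ, φ ∈ {φ : Config E d | E.toReal (φ y - φ x) ≤ q x y} := by
      rw [← hμ.map_shift v hvL]
      refine (ae_map_iff (measurable_shift v).aemeasurable (measurableSet_le
        ((measurable_toReal E).comp (measurable_grad x y)) measurable_const)).2 ?_
      filter_upwards [hf.ae_weight_ne_zero h0] with φ hφ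
      have h2 := H.edge_of_weight_ne_zero hφ
        (hmem x fun i => (Nat.le_add_right _ _).trans (hxy i))
        (hmem y fun i => (Nat.le_add_left _ _).trans (hxy i))
        ((H.strong.constraint.graph.invariant v hvL x y).2 hA)
      rw [H.strong.constraint.quasimetric.invariant v hvL, ← toReal_sub] at h2
      exact h2
    filter_upwards [h1] with φ hφ
    rw [← toReal_sub]
    exact hφ
  refine ⟨this, ?_⟩
  have hall : ∀ᵐ φ ∂μ, ∀ x y, A.Adj x y → E.toReal (φ y) - E.toReal (φ x) ≤ q x y :=
    ae_all_iff.2 fun x => ae_all_iff.2 fun y => by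
      by_cases hA : A.Adj x y
      · exact (hedge x y hA).mono fun φ hφ _ => hφ
      · exact Eventually.of_forall fun φ h => absurd h hA
  exact hall.mono fun φ hφ => lipschitz_of_edges H.strong.constraint hφ

/-! ### The strong interaction near a finite set -/

/-- The sets in `D` which meet `Λ`. -/
def meeting (Λ D : Finset (Vertex d)) : Finset (Finset (Vertex d)) :=
  (subsets D).filter fun Γ => ∃ x ∈ Γ, x ∈ Λ

/-- The vertices at distance at most `R` from `Λ` in each coordinate. -/
def thicken (R : ℕ) (Λ : Finset (Vertex d)) : Finset (Vertex d) :=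
  Λ.biUnion fun x => translate x (Fintype.piFinset fun _ => Finset.Icc (-(R : ℤ)) R)

theorem mem_thicken {R : ℕ} {x y : Vertex d} (hx : x ∈ Λ) (h : dist1 x y ≤ R) :
    y ∈ thicken R Λ := by
  refine Finset.mem_biUnion.2 ⟨x, hx, mem_translate.2 (Fintype.mem_piFinset.2 fun i => ?_)⟩
  have h1 : (x i - y i).natAbs ≤ dist1 x y :=
    Finset.single_le_sum (f := fun i => (x i - y i).natAbs) (fun _ _ => Nat.zero_le _)
      (Finset.mem_univ i)
  rw [Finset.mem_Icc, Pi.sub_apply]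
  omega

theorem subset_thicken (R : ℕ) (Λ : Finset (Vertex d)) : Λ ⊆ thicken R Λ := fun x hx =>
  mem_thicken hx (by simp [dist1])

/-- By the finite range, all that counts are the sets within the thickening. -/
theorem strongPart_meeting_le {R : ℕ} (hR : ∀ Λ : Finset (Vertex d),
      (∃ x ∈ Λ, ∃ y ∈ Λ, R < dist1 x y) → ∀ φ, Ψ Λ φ = 0) (D : Finset (Vertex d))
    (φ : Config E d) :
    strongPart Ψ (meeting Λ D) φ ≤ strongPart Ψ (meeting Λ (thicken R Λ)) φ := by
  refine Finset.sum_le_sum_of_ne_zero fun Γ hΓ h0 => ?_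
  obtain ⟨h1, x, hx, hxΛ⟩ := Finset.mem_filter.1 hΓ
  refine Finset.mem_filter.2 ⟨mem_subsets.2 ⟨fun y hy => ?_, x, hx⟩, x, hx, hxΛ⟩
  by_contra h2
  refine h0 ?_
  rw [hR Γ ⟨x, hx, y, hy, ?_⟩, EReal.toENNReal_zero]
  by_contra! h3
  exact h2 (mem_thicken hxΛ h3)

theorem measurable_strongPart (Ψ : GradPotential E d) (Λ D : Finset (Vertex d)) :
    Measurable[gradAlg E (D : Set (Vertex d))] (strongPart Ψ (meeting Λ D)) := by
  let m := gradAlg E (D : Set (Vertex d))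
  refine Finset.measurable_fun_sum _ fun Γ hΓ => ?_
  have h1 : (Γ : Set (Vertex d)) ⊆ D :=
    Finset.coe_subset.2 (mem_subsets.1 (Finset.mem_filter.1 hΓ).1).1
  exact ((Ψ.measurable Γ).mono (gradAlg_mono h1) le_rfl).ereal_toENNReal

/-- Violated edges are the only source of infinite strong energy. -/
theorem IsSplit.strongPart_ne_top (H : IsSplit L A q Φ Ψ Ξ C) (s : Finset (Finset (Vertex d)))
    {φ : Config E d} (hφ : φ ∈ lipschitzSet E q) : strongPart Ψ s φ ≠ ⊤ := by
  refine ENNReal.sum_ne_top.2 fun Γ _ h => ?_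
  rw [EReal.toENNReal_eq_top_iff, H.strong.lipschitz] at h
  obtain ⟨x, y, -, -, h1⟩ := h
  exact absurd (hφ x y) (not_le.2 h1)

/-- An edge that meets `Λ` cannot be violated, because its energy is part of a finite sum; an edge
that avoids `Λ` keeps its old heights. -/
theorem IsSplit.propose_mem (H : IsSplit L A q Φ Ψ Ξ C) {R : ℕ} (hR : ∀ Λ : Finset (Vertex d),
      (∃ x ∈ Λ, ∃ y ∈ Λ, R < dist1 x y) → ∀ φ, Ψ Λ φ = 0) {φ : Config E d}
    (hφ : φ ∈ lipschitzSet E q) {ψ : Λ → E}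
    (h : strongPart Ψ (meeting Λ (thicken R Λ)) (propose Λ b φ ψ) ≠ ⊤) :
    propose Λ b φ ψ ∈ lipschitzSet E q := by
  refine lipschitz_of_edges H.strong.constraint fun x y hA => ?_
  have hmeet : (∃ z ∈ ({x, y} : Finset (Vertex d)), z ∈ Λ) →
      E.toReal (propose Λ b φ ψ y) - E.toReal (propose Λ b φ ψ x) ≤ q x y := by
    intro hz
    refine H.edge_of_strong_ne_top hA fun h1 => h (top_unique ?_)
    refine le_trans ?_ (strongPart_meeting_le hR {x, y} _)
    refine le_trans ?_ (Finset.single_le_sum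
      (f := fun Γ => (Ψ Γ (propose Λ b φ ψ)).toENNReal) (fun _ _ => zero_le)
      (Finset.mem_filter.2 ⟨mem_subsets.2 ⟨subset_rfl, x, by simp⟩, hz⟩))
    simp [h1]
  by_cases hx : x ∈ Λ
  · exact hmeet ⟨x, by simp, hx⟩
  by_cases hy : y ∈ Λ
  · exact hmeet ⟨y, by simp, hy⟩
  rw [propose, glue_apply_notMem _ _ hx, glue_apply_notMem _ _ hy]
  exact hφ x y

/-! ### Approximation by local events -/

theorem isSetRing_local (E : HeightSpace) (d : ℕ) : IsSetRing {T : Set (Config E d) |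
    ∃ W : Finset (Vertex d), MeasurableSet[gradAlg E (W : Set (Vertex d))] T} where
  empty_mem := ⟨∅, @MeasurableSet.empty _ (gradAlg E _)⟩
  union_mem := by
    rintro s t ⟨V, hV⟩ ⟨W, hW⟩
    exact ⟨V ∪ W, MeasurableSet.union
      (gradAlg_mono (Finset.coe_subset.2 Finset.subset_union_left) _ hV)
      (gradAlg_mono (Finset.coe_subset.2 Finset.subset_union_right) _ hW)⟩
  sdiff_mem := by
    rintro s t ⟨V, hV⟩ ⟨W, hW⟩
    exact ⟨V ∪ W, MeasurableSet.diff
      (gradAlg_mono (Finset.coe_subset.2 Finset.subset_union_left) _ hV)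
      (gradAlg_mono (Finset.coe_subset.2 Finset.subset_union_right) _ hW)⟩

theorem generateFrom_local (E : HeightSpace) (d : ℕ) :
    (inferInstance : MeasurableSpace (Config E d)) = MeasurableSpace.generateFrom
      {T | ∃ W : Finset (Vertex d), MeasurableSet[gradAlg E (W : Set (Vertex d))] T} := by
  refine le_antisymm ?_ (MeasurableSpace.generateFrom_le fun T ⟨W, hW⟩ => gradAlg_le _ _ hW)
  have h := (@measurable_config_iff E d _ (MeasurableSpace.generateFrom
    {T | ∃ W : Finset (Vertex d), MeasurableSet[gradAlg E (W : Set (Vertex d))] T}) Set.univ id).2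
    fun x _ y _ t ht => MeasurableSpace.measurableSet_generateFrom
      ⟨{x, y}, measurable_grad_of_mem (by simp) (by simp) ht⟩
  have h1 := h.comap_le
  rwa [MeasurableSpace.comap_id] at h1

/-- The gradient sigma-algebra is generated by the ring of events that depend on finitely many
vertices. -/
theorem exists_local_symmDiff_lt {ν : Measure (Config E d)} [IsFiniteMeasure ν]
    {T : Set (Config E d)} (hT : MeasurableSet T) {ε : ℝ≥0∞} (hε : 0 < ε) :
    ∃ (W : Finset (Vertex d)) (T' : Set (Config E d)),
      MeasurableSet[gradAlg E (W : Set (Vertex d))] T' ∧ ν (symmDiff T' T) < ε := by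
  obtain ⟨T', ⟨W, hW⟩, h⟩ := exists_measure_symmDiff_lt_of_generateFrom_isSetRing (μ := ν)
    (isSetRing_local E d) ⟨{Set.univ}, Set.countable_singleton _,
      Set.singleton_subset_iff.2 ⟨∅, @MeasurableSet.univ _ (gradAlg E _)⟩, by simp⟩
    (generateFrom_local E d) hT hε
  exact ⟨W, T', hW, h⟩

end Support

end

section
/-! ### The choice of the proposals and of the event -/

section Choice

variable {L : AddSubgroup (Vertex d)} {A : SimpleGraph (Vertex d)} {q : Vertex d → Vertex d → ℝ}
  {Φ Ψ Ξ : GradPotential E d} {C : ℝ} {μ : Measure (Config E d)} {Λ : Finset (Vertex d)}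
  {b : Vertex d} {S T : Set (Config E d)}

/-- The uniform distribution on the heights in `Λ` of absolute value at most `r`. -/
def uniformProposal (E : HeightSpace) (Λ : Finset (Vertex d)) (r : ℝ) : Measure (Λ → E) :=
  ((Measure.pi fun _ : Λ => E.refMeasure) (Set.univ.pi fun _ => heightBall E r))⁻¹ •
    (Measure.pi fun _ : Λ => E.refMeasure).restrict (Set.univ.pi fun _ => heightBall E r)

theorem pi_heightBall_ne_top (Λ : Finset (Vertex d)) (r : ℝ) :
    (Measure.pi fun _ : Λ => E.refMeasure) (Set.univ.pi fun _ => heightBall E r) ≠ ⊤ := by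
  rw [Measure.pi_pi]
  exact (ENNReal.prod_lt_top fun _ _ => refMeasure_heightBall_lt_top E r).ne

/-- Nonemptiness of `Λ` matters: over no vertices the volume is `1` whatever the radius. -/
theorem natCast_le_pi_heightBall (hΛ : Λ.Nonempty) {n : ℕ} (hn : 0 < n) :
    (n : ℝ≥0∞) ≤ (Measure.pi fun _ : Λ => E.refMeasure) (Set.univ.pi fun _ => heightBall E n) := by
  rw [Measure.pi_pi, Finset.prod_const, Finset.card_univ, Fintype.card_coe]
  have h1 : (1 : ℝ≥0∞) ≤ n := by exact_mod_cast hn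
  calc (n : ℝ≥0∞) ≤ (n : ℝ≥0∞) ^ Λ.card := le_self_pow h1 hΛ.card_pos.ne'
    _ ≤ _ := pow_le_pow_left' (natCast_le_refMeasure_heightBall E n) _

theorem uniformProposal_le (r : ℝ) : uniformProposal E Λ r ≤
    ((Measure.pi fun _ : Λ => E.refMeasure) (Set.univ.pi fun _ => heightBall E r))⁻¹ •
      Measure.pi fun _ : Λ => E.refMeasure := by
  refine Measure.le_iff.2 fun T _ => ?_
  rw [uniformProposal, Measure.smul_apply, Measure.smul_apply]
  exact mul_le_mul_right (Measure.restrict_apply_le _ _) _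

theorem isProbabilityMeasure_uniformProposal {r : ℝ}
    (h0 : (Measure.pi fun _ : Λ => E.refMeasure) (Set.univ.pi fun _ => heightBall E r) ≠ 0) :
    IsProbabilityMeasure (uniformProposal E Λ r) := by
  refine ⟨?_⟩
  rw [uniformProposal, Measure.smul_apply, Measure.restrict_apply_univ, smul_eq_mul,
    ENNReal.inv_mul_cancel h0 (pi_heightBall_ne_top Λ r)]

/-- Translation of the heights in `Λ` by `φ b` does not affect the reference measure, so absolute
heights and heights relative to `b` define the same resampling. -/
theorem resample_apply_propose (hT : MeasurableSet T) (b : Vertex d) : resample μ Λ T =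
    ∫⁻ φ, (Measure.pi fun _ : Λ => E.refMeasure) {ψ | propose Λ b φ ψ ∈ T} ∂μ := by
  rw [resample_apply μ Λ hT]
  refine lintegral_congr fun φ => ?_
  have h1 := integrateOut_add_const (F := T.indicator 1) Λ φ (φ b)
  have h2 : MeasurableSet {ψ : Λ → E | glue Λ φ ψ ∈ T} := measurable_glue Λ φ hT
  have h3 : MeasurableSet {ψ : Λ → E | propose Λ b φ ψ ∈ T} :=
    (measurable_propose Λ (Set.mem_univ b) measurable_fst measurable_snd).comp
      (measurable_prodMk_left (x := φ)) hT
  rw [← lintegral_indicator_one h2, ← lintegral_indicator_one h3]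
  exact h1

/-- Inside `T` the proposed heights automatically lie in the ball, so its truncation loses nothing
and only the normalization remains. -/
theorem measure_propose_uniform [IsProbabilityMeasure μ] (hb : b ∉ Λ) {r : ℝ}
    [IsProbabilityMeasure (uniformProposal E Λ r)] (hT : MeasurableSet T)
    (hTr : T ⊆ boundedAt E Λ b r) : (μ.prod (uniformProposal E Λ r)) {p | propose Λ b p.1 p.2 ∈ T} =
      ((Measure.pi fun _ : Λ => E.refMeasure) (Set.univ.pi fun _ => heightBall E r))⁻¹ *
        resample μ Λ T := by
  have hprop : Measurable fun p : Config E d × (Λ → E) => propose Λ b p.1 p.2 :=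
    measurable_propose Λ (Set.mem_univ b) measurable_fst measurable_snd
  have hm : MeasurableSet {p : Config E d × (Λ → E) | propose Λ b p.1 p.2 ∈ T} := hprop hT
  have hslice : Measurable fun φ : Config E d =>
      (Measure.pi fun _ : Λ => E.refMeasure) {ψ | propose Λ b φ ψ ∈ T} :=
    measurable_measure_prodMk_left hm
  rw [resample_apply_propose hT b, Measure.prod_apply hm, ← lintegral_const_mul _ hslice]
  refine lintegral_congr fun φ => ?_
  rw [uniformProposal, Measure.smul_apply, smul_eq_mul]
  congr 1
  refine Measure.restrict_eq_self _ fun ψ hψ y _ => ?_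
  have h1 := hTr hψ y y.2
  rwa [propose, glue_apply_mem _ _ y.2, glue_apply_notMem _ _ hb, add_sub_cancel_right] at h1

/-- If the resampling charges a null set, then there is an efficient resampling. -/
theorem IsSplit.exists_isEfficient (H : IsSplit L A q Φ Ψ Ξ C) (hd : 0 < d)
    [IsProbabilityMeasure μ] (hΛ : Λ.Nonempty) (hT : MeasurableSet T) (hμT : μ T = 0)
    (hres : resample μ Λ (T ∩ lipschitzSet E q) ≠ 0) :
    ∃ (W : Finset (Vertex d)) (b : Vertex d) (S : Set (Config E d)) (P : Measure (Λ → E)) (a : ℝ),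
      IsProbabilityMeasure P ∧ IsEfficient q Ψ C μ Λ W b S P a ∧ 0 < a := by
  have : Nonempty (Fin d) := Fin.pos_iff_nonempty.1 hd
  obtain ⟨b, hb⟩ := Infinite.exists_notMem_finset Λ
  obtain ⟨R, hR⟩ := H.strong.finite_range
  obtain ⟨r, hr⟩ := exists_forall_mem_boundedAt E q Λ b
  set g : Config E d → ℝ≥0∞ := strongPart Ψ (meeting Λ (thicken R Λ)) with hg
  have hgm := measurable_strongPart Ψ Λ (thicken R Λ)
  have hgu : Measurable g := hgm.mono (gradAlg_le _) le_rfl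
  have hlip := measurableSet_lipschitzSet E q
  -- The strong interaction may be assumed to be bounded.
  obtain ⟨n, hn⟩ : ∃ n : ℕ, resample μ Λ (T ∩ lipschitzSet E q ∩ {φ | g φ ≤ n}) ≠ 0 := by
    by_contra! h0
    refine hres (measure_mono_null (fun φ hφ => ?_) (measure_iUnion_null h0))
    obtain ⟨n, hn⟩ := ENNReal.exists_nat_gt (H.strongPart_ne_top _ hφ.2)
    exact Set.mem_iUnion.2 ⟨n, hφ, hn.le⟩
  set B := T ∩ lipschitzSet E q ∩ {φ | g φ ≤ n} with hB
  have hgn : MeasurableSet[gradAlg E (thicken R Λ : Set (Vertex d))] {φ : Config E d | g φ ≤ n} :=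
    hgm measurableSet_Iic
  have hBm : MeasurableSet B := (hT.inter hlip).inter (gradAlg_le _ _ hgn)
  -- Up to the proposal density `V⁻¹`, this is the constant that has to be at most `exp (-2)` in the
  -- single-step estimate.
  set X : ℝ≥0∞ := 2 * (ENNReal.ofReal (Real.exp (n + 2 * (C * Λ.card))) *
    (Measure.pi fun _ : Λ => E.refMeasure) (Set.univ.pi fun _ => heightBall E r)) with hX
  have hXtop : X ≠ ⊤ := ENNReal.mul_ne_top ENNReal.ofNat_ne_top
    (ENNReal.mul_ne_top ENNReal.ofReal_ne_top (pi_heightBall_ne_top Λ r))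
  set ε := ENNReal.ofReal (Real.exp (-2)) with hε
  have hε0 : ε ≠ 0 := (ENNReal.ofReal_pos.2 (Real.exp_pos _)).ne'
  obtain ⟨m, hm⟩ := ENNReal.exists_nat_gt (ENNReal.div_ne_top hXtop hε0)
  obtain ⟨m', hm'⟩ := exists_nat_ge r
  -- The radius makes `V ≥ X / ε`, exceeds the Lipschitz range `r` so that the ball contains all
  -- heights occurring in `B`, and is positive so that `V ≠ 0`.
  set M := max (max m m') 1 with hM
  set V := (Measure.pi fun _ : Λ => E.refMeasure) (Set.univ.pi fun _ => heightBall E M) with hV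
  have hMV : (M : ℝ≥0∞) ≤ V := natCast_le_pi_heightBall hΛ (by omega)
  have hV0 : V ≠ 0 := fun h => by
    rw [h] at hMV
    have h1 : (M : ℝ≥0∞) = 0 := le_antisymm hMV zero_le
    have h2 : M = 0 := by exact_mod_cast h1
    omega
  have hVtop : V ≠ ⊤ := pi_heightBall_ne_top Λ M
  have hrM : r ≤ M := hm'.trans (by exact_mod_cast le_max_of_le_left (le_max_right m m'))
  set P := uniformProposal E Λ M with hP
  have hPprob : IsProbabilityMeasure P := isProbabilityMeasure_uniformProposal hV0
  have hprop : Measurable fun p : Config E d × (Λ → E) => propose Λ b p.1 p.2 :=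
    measurable_propose Λ (Set.mem_univ b) measurable_fst measurable_snd
  set Q := (μ.prod P).map fun p => propose Λ b p.1 p.2 with hQ
  have : IsProbabilityMeasure Q := Measure.isProbabilityMeasure_map hprop.aemeasurable
  have hQB : Q B ≠ 0 := by
    rw [hQ, Measure.map_apply hprop hBm]
    refine ne_of_eq_of_ne (measure_propose_uniform (μ := μ) hb hBm fun φ hφ y hy =>
      heightBall_mono hrM (hr φ hφ.1.2 y hy)) ?_
    exact mul_ne_zero (ENNReal.inv_ne_zero.2 hVtop) hn
  have hQB2 : Q B / 2 ≠ 0 := (ENNReal.half_pos hQB).ne'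
  -- Approximating under the sum controls both measures at once: since `μ T = 0`, `μ` gives the
  -- local event at most `Q B / 2`, while `Q` gives it at least that much.
  obtain ⟨W₀, T', hT', hsymm⟩ := exists_local_symmDiff_lt (ν := μ + Q) hT (pos_iff_ne_zero.2 hQB2)
  rw [Measure.add_apply] at hsymm
  -- The energy bound is itself local, so it can be imposed exactly. It makes accepted proposals
  -- Lipschitz, although `S` need not consist of Lipschitz functions.
  set S := T' ∩ {φ | g φ ≤ n} with hS
  set W := insert b (W₀ ∪ thicken R Λ) with hW
  have hW₀W : W₀ ⊆ W := Finset.subset_union_left.trans (Finset.subset_insert _ _)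
  have hRW : thicken R Λ ⊆ W := Finset.subset_union_right.trans (Finset.subset_insert _ _)
  have hSm : MeasurableSet[gradAlg E (W : Set (Vertex d))] S :=
    MeasurableSet.inter (gradAlg_mono (Finset.coe_subset.2 hW₀W) _ hT')
      (gradAlg_mono (Finset.coe_subset.2 hRW) _ hgn)
  have hSu : MeasurableSet S := gradAlg_le _ _ hSm
  have hQS : Q B / 2 ≤ Q S := by
    have h1 : Q B ≤ Q S + Q B / 2 := by
      refine (measure_mono (t := S ∪ symmDiff T' T) fun φ hφ => ?_).trans
        ((measure_union_le _ _).trans (add_le_add le_rfl (le_add_self.trans hsymm.le)))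
      by_cases h : φ ∈ T'
      · exact .inl ⟨h, hφ.2⟩
      · exact .inr (.inr ⟨hφ.1.1, h⟩)
    have h2 : Q B / 2 ≠ ⊤ := ENNReal.div_ne_top (measure_ne_top Q B) two_ne_zero
    rw [← ENNReal.add_le_add_iff_right h2, ENNReal.add_halves]
    exact h1
  have hμS : μ S ≤ Q B / 2 := by
    refine le_trans ?_ (le_self_add.trans hsymm.le)
    refine (measure_mono (t := symmDiff T' T ∪ T) fun φ hφ => ?_).trans
      ((measure_union_le _ _).trans (by rw [hμT, add_zero]))
    by_cases h : φ ∈ T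
    · exact .inr h
    · exact .inl (.inl ⟨hφ.1, h⟩)
  have hQS0 : Q S ≠ 0 := fun h => hQB2 (le_antisymm (h ▸ hQS) zero_le)
  refine ⟨W, b, S, P, (Q S).toReal, hPprob, ⟨⟨(subset_thicken R Λ).trans hRW,
    Finset.mem_insert_self _ _, hb, hSm, fun φ hφ ψ hψ => ?_⟩, ENNReal.toReal_nonneg, ?_, ?_, ?_⟩,
    ENNReal.toReal_pos hQS0 (measure_ne_top Q S)⟩
  · exact H.propose_mem hR hφ (ne_top_of_le_ne_top (ENNReal.natCast_ne_top n) hψ.2)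
  · rw [ENNReal.ofReal_toReal (measure_ne_top Q S), hQ, Measure.map_apply hprop hSu]
    rfl
  · rw [ENNReal.ofReal_toReal (measure_ne_top Q S)]
    exact hμS.trans hQS
  · refine ⟨n, r, V⁻¹, Nat.cast_nonneg n, fun D φ hφ => ?_, uniformProposal_le _, hr, ?_⟩
    · rw [ENNReal.ofReal_natCast]
      exact (strongPart_meeting_le hR D φ).trans hφ.2
    · have h1 : X / ε ≤ V := hm.le.trans (le_trans (by
        exact_mod_cast le_max_of_le_left (le_max_left m m')) hMV)
      have h2 : X ≤ V * ε := (ENNReal.div_le_iff hε0 ENNReal.ofReal_ne_top).1 h1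
      calc _ = V⁻¹ * X := by
            rw [hX]
            ring
        _ ≤ V⁻¹ * (V * ε) := mul_le_mul_right h2 _
        _ = ε := by rw [← mul_assoc, ENNReal.inv_mul_cancel hV0 hVtop, one_mul]

theorem resample_empty : resample μ (∅ : Finset (Vertex d)) = μ := by
  ext T hT
  rw [resample_apply μ ∅ hT]
  have h1 : ∀ (φ : Config E d) (ψ : (∅ : Finset (Vertex d)) → E), glue ∅ φ ψ = φ := fun φ ψ => by
    ext y
    exact glue_apply_notMem _ _ (Finset.notMem_empty y)
  simp only [h1]
  rw [← lintegral_indicator_one hT]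
  refine lintegral_congr fun φ => ?_
  by_cases hφ : φ ∈ T <;> simp [hφ]

end Choice

end

end HeightModel

end

theorem theorem4p2 (E : HeightModel.HeightSpace) (d : ℕ) (hd : 2 ≤ d)
    (L : AddSubgroup (HeightModel.Vertex d)) (hL : L.FiniteIndex)
    (A : SimpleGraph (HeightModel.Vertex d))
    (q : HeightModel.Vertex d → HeightModel.Vertex d → ℝ)
    (hq : E = HeightModel.HeightSpace.int → ∀ x y, ∃ n : ℤ, q x y = n)
    (Φ : HeightModel.GradPotential E d) (hΦ : HeightModel.IsStrongPlusWeak L A q Φ)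
    (μ : MeasureTheory.Measure (HeightModel.Config E d)) (hμ : HeightModel.IsMinimizer L Φ μ)
    (Λ : Finset (HeightModel.Vertex d)) :
    ((HeightModel.resample μ Λ).restrict (HeightModel.lipschitzSet E q)).AbsolutelyContinuous
      μ := by
  obtain ⟨Ψ, Ξ, C, H⟩ := hΦ.exists_isSplit
  have hd0 : 0 < d := by omega
  refine MeasureTheory.Measure.AbsolutelyContinuous.mk fun T hT hμT => ?_
  rw [MeasureTheory.Measure.restrict_apply hT]
  -- For empty `Λ` there is nothing to spread out, but the resampled measure is then `μ` itself.
  rcases Λ.eq_empty_or_nonempty with rfl | hΛ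
  · rw [HeightModel.resample_empty]
    exact MeasureTheory.measure_mono_null Set.inter_subset_left hμT
  by_contra hres
  have := hμ.invariant.isProb
  obtain ⟨W, b, S, P, a, hP, h, ha⟩ := H.exists_isEfficient hd0 hΛ hT hμT hres
  obtain ⟨u, η, -, hη, -, htop⟩ := hμ.minimal
  exact H.not_isEfficient hd0 hL hμ (H.isLipschitzMeasure hL hμ.invariant hη htop) h ha
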